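/- Let $\mathbb{T}^2=\mathbb{R}^2/\mathbb{Z}^2$, and for $w:\mathbb{T}^2\to\mathbb{R}^2$ let $\mathrm{Lip}(w)$ denote its best Lipschitz constant. For every $L\ge 0$ there exists $\delta\in(0,1)$, depending only on $L$, such that the following holds. Let $v:[0,1)\times\mathbb{T}^2\to\mathbb{R}^2$ be bounded, with $v(t,\cdot)$ divergence free (in the sense of distributions) and $\mathrm{Lip}(v(t,\cdot))\le L$ for every $t\in[0,1)$, and suppose that there is a partition $0=t_0<t_1<\dots<t_m=1$ such that $v$ is continuous on $[t_{i-1},t_i)\times\mathbb{T}^2$ for each $i=1,\dots,m$. Let $\psi_t$, $t\in[0,1]$, be the flow map of $v$, that is, $\frac{d}{dt}\psi_t(z)=v(t,\psi_t(z))$ (as a right derivative, at every $t\in[0,1)$), with $\psi_0(z)=z$ and $t\mapsto\psi_t(z)$ continuous on $[0,1]$. For $\nu>0$ let $$\Psi_\nu g=e^{\nu\Delta}\bigl(g\circ\psi_1^{-1}\bigr),$$ where $e^{\nu\Delta}$ denotes convolution with the periodized heat kernel $\sum_{k\in\mathbb{Z}^2}\frac{1}{4\pi\nu}e^{-|z+k|^2/(4\nu)}$.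 Suppose that $\nu>0$ and $n_0\in\mathbb{N}$ are such that $$\|\Psi_\nu^{n_0}g\|_{L^2}\le\tfrac12\|g\|_{L^2}\qquad\text{for every mean-zero } g\in L^2(\mathbb{T}^2).$$ Then for every mean-zero $f_0\in L^2(\mathbb{T}^2)$, the weak solution $f\in C([0,\infty);L^2)\cap L^2_{\mathrm{loc}}([0,\infty);H^1)$ of $$\partial_t f+u\cdot\nabla f=\nu\Delta f,\qquad f|_{t=0}=f_0,$$ where $u$ is the $1$-periodic-in-time extension of $v$, satisfies $$\|f(n_0+1)\|_{L^2}\le(1-\delta)\|f_0\|_{L^2}.$$ -/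

import Mathlib

open MeasureTheory Set
open scoped ContDiff NNReal

noncomputable section

namespace PulsedDiffusion

/-- The two-dimensional torus `ℝ² / ℤ²`. -/
abbrev Torus2 : Type := UnitAddTorus (Fin 2)

/-- The Euclidean plane, in which velocity fields and gradients take their values. -/
abbrev Plane : Type := EuclideanSpace ℝ (Fin 2)

/-- Lebesgue measure on the torus (normalised to total mass one). -/
abbrev torusMeasure : Measure Torus2 :=
  Measure.pi fun _ : Fin 2 => (AddCircle.haarAddCircle : Measure UnitAddCircle)

/-- The projection `ℝ² → ℝ² / ℤ²`. -/
def proj (y : Plane) : Torus2 := fun i => (y i : UnitAddCircle)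

/-- The representative in `[0,1)` of the `i`-th coordinate of a point of the torus. -/
def coord (z : Torus2) (i : Fin 2) : ℝ := (AddCircle.equivIco (1 : ℝ) 0 (z i) : ℝ)

/-- A function on the torus is smooth if its periodic lift to the plane is `C^∞`. -/
def IsSmooth (φ : Torus2 → ℝ) : Prop := ContDiff ℝ ∞ fun y : Plane => φ (proj y)

/-- The classical partial derivative in the `i`-th coordinate direction. -/
def partialDeriv (i : Fin 2) (φ : Torus2 → ℝ) (z : Torus2) : ℝ :=
  deriv (fun s : ℝ => φ (z + Pi.single i (s : UnitAddCircle))) 0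

/-- The classical gradient of a function on the torus. -/
def grad (φ : Torus2 → ℝ) (z : Torus2) : Plane :=
  WithLp.toLp 2 fun i => partialDeriv i φ z

/-- `G` is the weak (distributional) gradient of `h` on the torus. -/
def IsWeakGradient (h : Torus2 → ℝ) (G : Torus2 → Plane) : Prop :=
  ∀ φ : Torus2 → ℝ, IsSmooth φ → ∀ i : Fin 2,
    ∫ z, h z * partialDeriv i φ z ∂torusMeasure = -∫ z, G z i * φ z ∂torusMeasure

/-- `w` is divergence free in the sense of distributions. -/
def IsDivFree (w : Torus2 → Plane) : Prop :=
  ∀ φ : Torus2 → ℝ, IsSmooth φ → ∫ z, inner ℝ (w z) (grad φ z) ∂torusMeasure = 0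

/-- Piecewise continuity in time: there is a partition `0 = τ 0 < τ 1 < ⋯ < τ m = 1` with `v`
continuous on each `[τ i, τ (i+1)) × 𝕋²`. -/
def IsPiecewiseContinuous (v : ℝ → Torus2 → Plane) : Prop :=
  ∃ (m : ℕ) (τ : ℕ → ℝ), τ 0 = 0 ∧ τ m = 1 ∧ (∀ i < m, τ i < τ (i + 1)) ∧
    ∀ i < m, ContinuousOn (fun p : ℝ × Torus2 => v p.1 p.2) (Ico (τ i) (τ (i + 1)) ×ˢ univ)

/-- The velocity fields `v : [0,1) × 𝕋² → ℝ²` under consideration, with Lipschitz constant in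
space at most `L` at every time. Only the values `v t` with `t ∈ [0,1)` matter. The Lipschitz
norm is finite uniformly in time: `v` is bounded, and has a uniform Lipschitz constant. -/
structure IsVelocityField (L : ℝ≥0) (v : ℝ → Torus2 → Plane) : Prop where
  lipschitz : ∀ t ∈ Ico (0 : ℝ) 1, LipschitzWith L (v t)
  bounded : ∃ M : ℝ, ∀ t ∈ Ico (0 : ℝ) 1, ∀ z, ‖v t z‖ ≤ M
  divFree : ∀ t ∈ Ico (0 : ℝ) 1, IsDivFree (v t)
  piecewiseContinuous : IsPiecewiseContinuous v

/-- `ψ t`, `t ∈ [0,1]`, is the flow map of `v`: each trajectory starts at its base point and lifts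
to a continuous curve in the plane that solves `d/dt ψ_t(z) = v(t, ψ_t(z))`. Since `v` is only
piecewise continuous in time (from the right), the derivative is the right derivative. -/
def IsFlowMap (v : ℝ → Torus2 → Plane) (ψ : ℝ → Torus2 → Torus2) : Prop :=
  ∀ z : Torus2, ψ 0 z = z ∧
    ∃ X : ℝ → Plane, ContinuousOn X (Icc 0 1) ∧
      (∀ t ∈ Icc (0 : ℝ) 1, proj (X t) = ψ t z) ∧
      ∀ t ∈ Ico (0 : ℝ) 1, HasDerivWithinAt X (v t (ψ t z)) (Ici t) t

/-- The periodized heat kernel on the torus at time `ν`: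
`∑_{k ∈ ℤ²} (4πν)⁻¹ exp (-|z + k|² / (4ν))`. -/
def heatKernel (ν : ℝ) (z : Torus2) : ℝ :=
  ∑' k : Fin 2 → ℤ,
    (4 * Real.pi * ν)⁻¹ * Real.exp (-(∑ i, (coord z i + (k i : ℝ)) ^ 2) / (4 * ν))

/-- The heat semigroup `e^{νΔ}`, as convolution with the periodized heat kernel. -/
def heat (ν : ℝ) (g : Torus2 → ℝ) (z : Torus2) : ℝ :=
  ∫ w, heatKernel ν (z - w) * g w ∂torusMeasure

/-- One step of the pulsed diffusion, `Ψ_ν g = e^{νΔ} (g ∘ ψ₁⁻¹)`. -/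
def pulsed (ν : ℝ) (ψ : ℝ → Torus2 → Torus2) (g : Torus2 → ℝ) : Torus2 → ℝ :=
  heat ν (g ∘ Function.invFun (ψ 1))

/-- The one-periodic extension in time of a field given on `[0,1)`. -/
def periodicExt (v : ℝ → Torus2 → Plane) (t : ℝ) : Torus2 → Plane := v (Int.fract t)

/-- `f` is the (weak) solution on `[0,∞)` of `∂ₜ f + u · ∇f = ν Δ f`, `f(0) = f₀`, in the class
`C([0,∞); L²) ∩ L²_loc([0,∞); H¹)`. -/
def IsSolution (ν : ℝ) (u : ℝ → Torus2 → Plane) (f₀ : Lp ℝ 2 torusMeasure)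
    (f : ℝ → Lp ℝ 2 torusMeasure) : Prop :=
  ContinuousOn f (Ici 0) ∧ f 0 = f₀ ∧
    ∃ G : ℝ → Lp Plane 2 torusMeasure,
      (∀ T : ℝ, 0 < T → MemLp G 2 (volume.restrict (Ioc 0 T))) ∧
      (∀ᵐ t ∂(volume.restrict (Ioi (0 : ℝ))), IsWeakGradient (f t) (G t)) ∧
      ∀ φ : Torus2 → ℝ, IsSmooth φ → ∀ t : ℝ, 0 ≤ t →
        ∫ z, f t z * φ z ∂torusMeasure - ∫ z, f₀ z * φ z ∂torusMeasure =
          -∫ s in (0 : ℝ)..t, ∫ z,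
            (inner ℝ (u s z) (G s z) * φ z + ν * inner ℝ (G s z) (grad φ z)) ∂torusMeasure

end PulsedDiffusion

end

/-!
The idea is to compare the solution with the pulsed diffusion `Ψ_ν` over `n₀` periods, and to see
that if the solution dissipated almost nothing, then it would stay almost parallel to a function
whose norm `Ψ_ν` has halved.

Suppose that `‖f (n₀ + 1)‖ > (1 - δ) ‖f₀‖`. By the energy identity (`IsEvolution.energy_eq`) the
total dissipation `ν ∫ ‖∇f‖²` on `[0, n₀ + 1]` is at most `δ ‖f₀‖²`. Choose a time `s` in the first
period at which `‖∇f‖` is at most its mean, let `g₀` be `f s`, transported along the flow to the end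
of the period, and let `gₙ = Ψ_νⁿ g₀`. Since `v` is Lipschitz, composition with the flow multiplies
the norm of a gradient by a constant that depends on `L` only (`EnergyLE.comp`, together with
Grönwall's inequality for the flow); since `v` is divergence free, it preserves the norm of `L²`
(`measurePreserving_flow`).

The pairings `Pₙ = ⟨f (n + 1), gₙ⟩` hardly change with `n`. Transporting the test function along the
flow cancels the advection, so that over one period the pairing changes only by a diffusive term, of
size `ν ‖∇φ‖ ∫ ‖∇f‖` for the transported function `φ`
(`IsEvolution.abs_inner_sub_inner_pull_le`). The heat step changes it by a term of the same size
(`abs_inner_heatL2_sub_self_le`). Finally the gradient of `gₙ₊₁` is paid for by the heat step which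
produced it, `2 ν ‖∇gₙ₊₁‖² ≤ ‖gₙ‖² - ‖gₙ₊₁‖²` (`energyLE_heatL2`), and this telescopes. Hence
`Pₙ` stays close to `‖f s‖²`, with an error which by a weighted Cauchy–Schwarz inequality is at most
a small multiple of `‖f₀‖²` (`IsEvolution.exists_energyLE_and_abs_sub_le`). But
`Pₙ₀ ≤ ‖f₀‖²/2` by the hypothesis on `Ψ_ν`, which is a contradiction if `δ` is small in terms of `L`
(`IsEvolution.norm_le_of_pulsedL2`).

Derivatives are handled on the Fourier side. The family of all `cos (2π k · z)`, `sin (2π k · z)` is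
a Parseval frame of `L²` (`trigL2_isParsevalFrame`), bounds of `‖∇g‖²` are bounds of
`∑ λᵢ ⟨eᵢ, g⟩²` (`EnergyLE`), the heat semigroup is a Fourier multiplier by Poisson summation
(`hasSum_heatKernel`), and the solution is described by its coefficients, which are absolutely
continuous functions of time (`IsEvolution`).
-/

open MeasureTheory Set
open scoped ContDiff NNReal

noncomputable section

namespace PulsedDiffusion

open Filter Topology UnitAddTorus

/-! ### Parseval frames in a real Hilbert space -/

section Frame

variable {H I : Type*} [NormedAddCommGroup H] [InnerProductSpace ℝ H]

/-- A Parseval frame: a family for which Bessel's inequality is an equality. -/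
def IsParsevalFrame (e : I → H) : Prop :=
  ∀ g : H, HasSum (fun i => inner ℝ (e i) g ^ 2) (‖g‖ ^ 2)

variable {e : I → H}

theorem IsParsevalFrame.hasSum_inner_mul_inner (he : IsParsevalFrame e) (g h : H) :
    HasSum (fun i => inner ℝ (e i) g * inner ℝ (e i) h) (inner ℝ g h) := by
  have h1 := ((he (g + h)).sub (he (g - h))).mul_left (1 / 4)
  convert! h1 using 1
  · ext i; rw [inner_add_right, inner_sub_right]; ring
  · rw [norm_add_sq_real, norm_sub_sq_real]; ring

theorem IsParsevalFrame.sum_sq_le (he : IsParsevalFrame e) (F : Finset I) (g : H) :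
    ∑ i ∈ F, inner ℝ (e i) g ^ 2 ≤ ‖g‖ ^ 2 :=
  sum_le_hasSum F (fun _ _ => sq_nonneg _) (he g)

/-- Synthesis is a contraction: it is the adjoint of the isometric analysis map. -/
theorem IsParsevalFrame.norm_sum_sq_le (he : IsParsevalFrame e) (F : Finset I) (c : I → ℝ) :
    ‖∑ i ∈ F, c i • e i‖ ^ 2 ≤ ∑ i ∈ F, c i ^ 2 := by
  set S := ∑ i ∈ F, c i • e i with hS
  have h1 : ‖S‖ ^ 2 = ∑ i ∈ F, c i * inner ℝ (e i) S := by
    rw [← real_inner_self_eq_norm_sq]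
    nth_rewrite 1 [hS]
    simp only [sum_inner, real_inner_smul_left]
  have h2 := Finset.sum_mul_sq_le_sq_mul_sq F c (fun i => inner ℝ (e i) S)
  rw [← h1] at h2
  have h3 := he.sum_sq_le F S
  have h4 : 0 ≤ ∑ i ∈ F, c i ^ 2 := Finset.sum_nonneg fun _ _ => sq_nonneg _
  by_cases h0 : ‖S‖ ^ 2 = 0
  · rw [h0]; exact h4
  · have h5 : 0 < ‖S‖ ^ 2 := lt_of_le_of_ne (sq_nonneg _) (Ne.symm h0)
    have : (‖S‖ ^ 2) * ‖S‖ ^ 2 ≤ (∑ i ∈ F, c i ^ 2) * ‖S‖ ^ 2 := by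
      nlinarith [mul_le_mul_of_nonneg_left h3 h4]
    exact le_of_mul_le_mul_right this h5

theorem IsParsevalFrame.summable_smul [CompleteSpace H] (he : IsParsevalFrame e) {c : I → ℝ}
    (hc : Summable fun i => c i ^ 2) : Summable fun i => c i • e i := by
  rw [summable_iff_vanishing_norm] at hc ⊢
  intro ε hε
  obtain ⟨s, hs⟩ := hc (ε ^ 2) (by positivity)
  refine ⟨s, fun t ht => ?_⟩
  have h1 := hs t ht
  rw [Real.norm_of_nonneg (Finset.sum_nonneg fun _ _ => sq_nonneg _)] at h1
  have h2 := (he.norm_sum_sq_le t c).trans_lt h1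
  exact lt_of_pow_lt_pow_left₀ 2 hε.le h2

theorem IsParsevalFrame.hasSum_smul [CompleteSpace H] (he : IsParsevalFrame e) (g : H) :
    HasSum (fun i => inner ℝ (e i) g • e i) g := by
  have h1 := (he.summable_smul (he g).summable).hasSum
  convert! h1 using 1
  refine ext_inner_right ℝ fun h => ?_
  have h2 := h1.mapL (innerSL ℝ h)
  have h3 := he.hasSum_inner_mul_inner g h
  rw [real_inner_comm]
  rw [real_inner_comm] at h3
  refine h3.unique ?_
  convert! h2 using 1
  · ext i
    simp [real_inner_comm]
  · rw [innerSL_apply_apply, real_inner_comm]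

end Frame

/-! ### The trigonometric frame of the torus -/

/-- Real-valued square-integrable functions on the torus. -/
abbrev L2 : Type := Lp ℝ 2 torusMeasure

/-- Indices of the real trigonometric functions: a frequency, and `false` for the cosine or `true`
for the sine. Both `k` and `-k` occur, so that the family is a Parseval frame and not a basis. -/
abbrev Mode : Type := (Fin 2 → ℤ) × Bool

/-- `cos (2π k · z)` for the index `(k, false)`, and `sin (2π k · z)` for `(k, true)`. -/
def trig (i : Mode) : C(Torus2, ℝ) where
  toFun z := if i.2 then (mFourier i.1 z).im else (mFourier i.1 z).re
  continuous_toFun := by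
    have := (mFourier i.1).continuous
    split_ifs <;> fun_prop

/-- The index of the other trigonometric function of the same frequency. -/
def Mode.flip (i : Mode) : Mode := (i.1, !i.2)

/-- The factor in `∂ⱼ (trig i) = i.freq j * trig i.flip`. -/
def Mode.freq (i : Mode) (j : Fin 2) : ℝ := (if i.2 then 1 else -1) * (2 * Real.pi * i.1 j)

/-- The eigenvalue of `-Δ` at `trig i`. -/
def Mode.eig (i : Mode) : ℝ := ∑ j, i.freq j ^ 2

@[simp] theorem Mode.flip_flip (i : Mode) : i.flip.flip = i := by simp [Mode.flip]

@[simp] theorem Mode.freq_flip (i : Mode) (j : Fin 2) : i.flip.freq j = -i.freq j := by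
  rcases i with ⟨k, _ | _⟩ <;> simp [Mode.flip, Mode.freq]

theorem Mode.eig_nonneg (i : Mode) : 0 ≤ i.eig := Finset.sum_nonneg fun _ _ => sq_nonneg _

theorem trig_false (k : Fin 2 → ℤ) (z : Torus2) : trig (k, false) z = (mFourier k z).re := rfl

theorem trig_true (k : Fin 2 → ℤ) (z : Torus2) : trig (k, true) z = (mFourier k z).im := rfl

theorem abs_trig_le (i : Mode) (z : Torus2) : |trig i z| ≤ 1 := by
  have h1 : ‖mFourier i.1 z‖ ≤ 1 := by
    simpa [mFourier_norm] using (mFourier i.1).norm_coe_le_norm z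
  rcases i with ⟨k, _ | _⟩
  · exact (Complex.abs_re_le_norm _).trans h1
  · exact (Complex.abs_im_le_norm _).trans h1

/-- A continuous function on the torus, as an element of `L²`. -/
abbrev toL2 : C(Torus2, ℝ) →L[ℝ] L2 := ContinuousMap.toLp 2 torusMeasure ℝ

/-- The trigonometric functions as elements of `L²`. -/
def trigL2 (i : Mode) : L2 := toL2 (trig i)

theorem L2_inner_eq (f g : L2) : inner ℝ f g = ∫ z, f z * g z ∂torusMeasure := by
  rw [MeasureTheory.L2.inner_def]
  simp [mul_comm]

theorem inner_toL2 (f : L2) (g : C(Torus2, ℝ)) :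
    inner ℝ (toL2 g) f = ∫ z, f z * g z ∂torusMeasure := by
  rw [L2_inner_eq]
  refine integral_congr_ae ?_
  filter_upwards [ContinuousMap.coeFn_toLp (p := 2) (𝕜 := ℝ) torusMeasure g] with z hz
  rw [hz, mul_comm]

theorem inner_toL2_toL2 (f g : C(Torus2, ℝ)) :
    inner ℝ (toL2 g) (toL2 f) = ∫ z, f z * g z ∂torusMeasure := by
  rw [inner_toL2]
  refine integral_congr_ae ?_
  filter_upwards [ContinuousMap.coeFn_toLp (p := 2) (𝕜 := ℝ) torusMeasure f] with z hz
  rw [hz]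

theorem integrable_mul_continuous {f : Torus2 → ℝ} (hf : Integrable f torusMeasure)
    (g : C(Torus2, ℝ)) : Integrable (fun z => f z * g z) torusMeasure :=
  hf.mul_bdd (c := ‖g‖) g.continuous.aestronglyMeasurable
    (Eventually.of_forall fun z => g.norm_coe_le_norm z)

theorem L2_integrable (f : L2) : Integrable f torusMeasure :=
  (Lp.memLp f).integrable (by norm_num)

theorem trigL2_isParsevalFrame : IsParsevalFrame trigL2 := by
  intro g
  have hg := L2_integrable g
  -- complexify, to quote Parseval's identity for Fourier series
  have hm : MemLp (fun z => (g z : ℂ)) 2 torusMeasure := (Lp.memLp g).ofReal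
  set G : Lp ℂ 2 torusMeasure := hm.toLp _ with hG
  have h1 := hasSum_sq_mFourierCoeff G
  have h2 : ∫ t, ‖G t‖ ^ 2 ∂torusMeasure = ‖g‖ ^ 2 := by
    rw [← real_inner_self_eq_norm_sq, L2_inner_eq]
    refine integral_congr_ae ?_
    filter_upwards [hm.coeFn_toLp] with z hz
    rw [hz]; simp [sq]
  have h3 : ∀ k : Fin 2 → ℤ, ‖mFourierCoeff G k‖ ^ 2 =
      inner ℝ (trigL2 (k, false)) g ^ 2 + inner ℝ (trigL2 (k, true)) g ^ 2 := by
    intro k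
    have h4 : mFourierCoeff G k = ∫ z, mFourier (-k) z * (g z : ℂ) ∂torusMeasure := by
      refine integral_congr_ae ?_
      filter_upwards [hm.coeFn_toLp] with z hz
      rw [hz]; rfl
    have hi : Integrable (fun z => mFourier (-k) z * (g z : ℂ)) torusMeasure := by
      refine Integrable.bdd_mul hg.ofReal (c := ‖mFourier (-k)‖)
        (mFourier (-k)).continuous.aestronglyMeasurable
        (Eventually.of_forall fun z => (mFourier (-k)).norm_coe_le_norm z)
    have hre : (mFourierCoeff G k).re = inner ℝ (trigL2 (k, false)) g := by
      rw [h4, trigL2, inner_toL2]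
      have := integral_re hi
      simp only [RCLike.re_eq_complex_re] at this
      rw [← this]
      refine integral_congr_ae (Eventually.of_forall fun z => ?_)
      simp [mFourier_neg, trig_false, mul_comm]
    have him : (mFourierCoeff G k).im = -inner ℝ (trigL2 (k, true)) g := by
      rw [h4, trigL2, inner_toL2, ← integral_neg]
      have := integral_im hi
      simp only [RCLike.im_eq_complex_im] at this
      rw [← this]
      refine integral_congr_ae (Eventually.of_forall fun z => ?_)
      simp [mFourier_neg, trig_true, mul_comm]
    rw [← Complex.normSq_eq_norm_sq, Complex.normSq_apply, hre, him]
    ring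
  have h5 : HasSum (fun k : Fin 2 → ℤ => ∑ b : Bool, inner ℝ (trigL2 (k, b)) g ^ 2)
      (‖g‖ ^ 2) := by
    rw [← h2]
    convert! h1 using 1
    ext k
    rw [h3, Fintype.sum_bool, add_comm]
  have hs : Summable (fun i : Mode => inner ℝ (trigL2 i) g ^ 2) := by
    rw [summable_prod_of_nonneg fun _ => sq_nonneg _]
    refine ⟨fun k => Summable.of_finite, ?_⟩
    simpa only [tsum_fintype] using h5.summable
  have h6 := hs.hasSum.prod_fiberwise (fun k => hasSum_fintype _)
  rw [h5.unique h6]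
  exact hs.hasSum

/-! ### Taylor expansions on the torus -/

/-- The projection of a displacement in the plane to the torus, in the sup-norm model `ℝ × ℝ`. -/
def disp (δ : Fin 2 → ℝ) : Torus2 := fun j => (δ j : UnitAddCircle)

theorem disp_add (a b : Fin 2 → ℝ) : disp (a + b) = disp a + disp b := by
  ext j; simp [disp]

theorem disp_single (j : Fin 2) (s : ℝ) :
    disp (Pi.single j s) = Pi.single j (s : UnitAddCircle) := by
  ext l
  rcases eq_or_ne l j with rfl | h
  · simp [disp]
  · simp [disp, h]

/-- `g` has gradient `Γ`, with a remainder of second order that is uniform over the torus. -/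
def HasGrad (g : C(Torus2, ℝ)) (Γ : Fin 2 → C(Torus2, ℝ)) : Prop :=
  ∃ C : ℝ, 0 ≤ C ∧ ∀ (z : Torus2) (δ : Fin 2 → ℝ),
    |g (z + disp δ) - g z - ∑ j, δ j * Γ j z| ≤ C * ‖δ‖ ^ 2

theorem HasGrad.add {g h : C(Torus2, ℝ)} {Γ Δ : Fin 2 → C(Torus2, ℝ)} (hg : HasGrad g Γ)
    (hh : HasGrad h Δ) : HasGrad (g + h) (Γ + Δ) := by
  obtain ⟨C, hC, h1⟩ := hg
  obtain ⟨D, hD, h2⟩ := hh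
  refine ⟨C + D, by positivity, fun z δ => ?_⟩
  have := abs_add_le (g (z + disp δ) - g z - ∑ j, δ j * Γ j z)
    (h (z + disp δ) - h z - ∑ j, δ j * Δ j z)
  have h3 := h1 z δ
  have h4 := h2 z δ
  have h5 : (g + h) (z + disp δ) - (g + h) z - ∑ j, δ j * (Γ + Δ) j z =
    (g (z + disp δ) - g z - ∑ j, δ j * Γ j z) + (h (z + disp δ) - h z - ∑ j, δ j * Δ j z) := by
    simp [mul_add, Finset.sum_add_distrib]; ring
  rw [h5]
  nlinarith

theorem HasGrad.smul {g : C(Torus2, ℝ)} {Γ : Fin 2 → C(Torus2, ℝ)} (hg : HasGrad g Γ) (c : ℝ) :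
    HasGrad (c • g) (c • Γ) := by
  obtain ⟨C, hC, h1⟩ := hg
  refine ⟨|c| * C, by positivity, fun z δ => ?_⟩
  have h5 : (c • g) (z + disp δ) - (c • g) z - ∑ j, δ j * (c • Γ) j z =
    c * (g (z + disp δ) - g z - ∑ j, δ j * Γ j z) := by
    simp [mul_sub]; ring
  rw [h5, abs_mul, mul_assoc]
  exact mul_le_mul_of_nonneg_left (h1 z δ) (abs_nonneg _)

theorem hasGrad_zero : HasGrad 0 0 := ⟨0, le_rfl, fun z δ => by simp⟩

theorem HasGrad.sum {I : Type*} (F : Finset I) {g : I → C(Torus2, ℝ)}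
    {Γ : I → Fin 2 → C(Torus2, ℝ)} (hg : ∀ i, HasGrad (g i) (Γ i)) :
    HasGrad (∑ i ∈ F, g i) (∑ i ∈ F, Γ i) := by
  classical
  induction F using Finset.induction_on with
  | empty => simpa using hasGrad_zero
  | insert a s ha ih => rw [Finset.sum_insert ha, Finset.sum_insert ha]; exact (hg a).add ih

/-- Fourier monomials are characters. -/
theorem mFourier_apply_add (k : Fin 2 → ℤ) (z w : Torus2) :
    mFourier k (z + w) = mFourier k z * mFourier k w := by
  simp only [mFourier, ContinuousMap.coe_mk, Pi.add_apply, fourier_apply, smul_add,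
    AddCircle.toCircle_add, Circle.coe_mul, Finset.prod_mul_distrib]

theorem mFourier_disp (k : Fin 2 → ℤ) (δ : Fin 2 → ℝ) :
    mFourier k (disp δ) = Complex.exp ((2 * Real.pi * ∑ j, k j * δ j : ℝ) * Complex.I) := by
  simp only [mFourier, ContinuousMap.coe_mk, disp, fourier_coe_apply, ← Complex.exp_sum]
  congr 1
  push_cast
  rw [Finset.mul_sum, Finset.sum_mul]
  refine Finset.sum_congr rfl fun j _ => ?_
  ring

theorem abs_one_sub_cos_le (x : ℝ) : |1 - Real.cos x| ≤ x ^ 2 := by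
  rw [abs_of_nonneg (by linarith [Real.cos_le_one x])]
  nlinarith [Real.one_sub_sq_div_two_le_cos (x := x), sq_nonneg x]

theorem abs_sub_sin_le (x : ℝ) : |x - Real.sin x| ≤ 2 * x ^ 2 := by
  rcases le_or_gt |x| 1 with h | h
  · have h1 := Real.sin_bound h
    have h2 : |x - Real.sin x| ≤ |Real.sin x - (x - x ^ 3 / 6)| + |x ^ 3 / 6| := by
      have := abs_sub (-(Real.sin x - (x - x ^ 3 / 6))) (-(x^3/6))
      rw [abs_neg, abs_neg] at this
      convert! this using 2
      ring
    have h3 : |x ^ 3 / 6| = |x| ^ 2 * |x| / 6 := by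
      rw [abs_div, abs_pow, abs_of_pos (by norm_num : (0 : ℝ) < 6)]; ring
    rw [h3] at h2
    rw [← sq_abs x]
    have h4 : |x| ^ 2 * |x| ≤ |x| ^ 2 := mul_le_of_le_one_right (sq_nonneg _) h
    have h5 : |x| ^ 5 ≤ |x| ^ 2 := pow_le_pow_of_le_one (abs_nonneg _) h (by norm_num)
    nlinarith [sq_nonneg |x|]
  · have h1 := abs_sub x (Real.sin x)
    have h2 := Real.abs_sin_le_one x
    rw [← sq_abs x]
    nlinarith

/-- The partial derivatives of the trigonometric functions. -/
def trigGrad (i : Mode) (j : Fin 2) : C(Torus2, ℝ) := i.freq j • trig i.flip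

theorem hasGrad_trig (i : Mode) : HasGrad (trig i) (trigGrad i) := by
  rcases i with ⟨k, b⟩
  set K : ℝ := 2 * Real.pi * ∑ j, |(k j : ℝ)| with hK
  refine ⟨3 * K ^ 2, by positivity, fun z δ => ?_⟩
  set x : ℝ := 2 * Real.pi * ∑ j, k j * δ j with hx
  have hxK : |x| ≤ K * ‖δ‖ := by
    rw [hx, hK, abs_mul, abs_of_pos Real.two_pi_pos, mul_assoc (2 * Real.pi)]
    refine mul_le_mul_of_nonneg_left ?_ Real.two_pi_pos.le
    rw [Finset.sum_mul]
    refine (Finset.abs_sum_le_sum_abs _ _).trans (Finset.sum_le_sum fun j _ => ?_)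
    rw [abs_mul]
    exact mul_le_mul_of_nonneg_left (norm_le_pi_norm δ j) (abs_nonneg _)
  have hx2 : x ^ 2 ≤ K ^ 2 * ‖δ‖ ^ 2 := by
    rw [← mul_pow, ← sq_abs]; exact pow_le_pow_left₀ (abs_nonneg _) hxK 2
  have hE : mFourier k (z + disp δ) = mFourier k z * Complex.exp (x * Complex.I) := by
    rw [mFourier_apply_add, mFourier_disp]
  have hc := abs_one_sub_cos_le x
  have hs := abs_sub_sin_le x
  have hb : ∀ i : Mode, |trig i z| ≤ 1 := fun i => abs_trig_le i z
  have hsum : ∀ s : ℝ, ∑ j, δ j * ((s * (2 * Real.pi * (k j : ℝ)))) = s * x := by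
    intro s
    rw [hx, Finset.mul_sum, Finset.mul_sum]
    exact Finset.sum_congr rfl fun j _ => by ring
  -- with `A`, `B` bounded by one, both remainders have the same shape
  have key : ∀ A B : ℝ, |A| ≤ 1 → |B| ≤ 1 →
      |A * (1 - Real.cos x) + B * (x - Real.sin x)| ≤ 3 * K ^ 2 * ‖δ‖ ^ 2 := by
    intro A B hA hB
    refine (abs_add_le _ _).trans ?_
    rw [abs_mul, abs_mul]
    have h1 := mul_le_mul hA hc (abs_nonneg _) zero_le_one
    have h2 := mul_le_mul hB hs (abs_nonneg _) zero_le_one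
    linarith
  cases b
  · have h1 : trig (k, false) (z + disp δ) - trig (k, false) z -
        ∑ j, δ j * trigGrad (k, false) j z =
        (-trig (k, false) z) * (1 - Real.cos x) + trig (k, true) z * (x - Real.sin x) := by
      have h2 : ∑ j, δ j * trigGrad (k, false) j z = (-1 * x) * trig (k, true) z := by
        rw [← hsum, Finset.sum_mul]
        exact Finset.sum_congr rfl fun j _ => by simp [trigGrad, Mode.freq, Mode.flip]; ring
      rw [h2, trig_false, hE, trig_false, trig_true, Complex.mul_re, Complex.exp_ofReal_mul_I_re,
        Complex.exp_ofReal_mul_I_im]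
      ring
    rw [h1]
    exact key _ _ (by rw [abs_neg]; exact hb _) (hb _)
  · have h1 : trig (k, true) (z + disp δ) - trig (k, true) z -
        ∑ j, δ j * trigGrad (k, true) j z =
        (-trig (k, true) z) * (1 - Real.cos x) + (-trig (k, false) z) * (x - Real.sin x) := by
      have h2 : ∑ j, δ j * trigGrad (k, true) j z = (1 * x) * trig (k, false) z := by
        rw [← hsum, Finset.sum_mul]
        exact Finset.sum_congr rfl fun j _ => by simp [trigGrad, Mode.freq, Mode.flip]; ring
      rw [h2, trig_true, hE, trig_false, trig_true, Complex.mul_im, Complex.exp_ofReal_mul_I_re,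
        Complex.exp_ofReal_mul_I_im]
      ring
    rw [h1]
    exact key _ _ (by rw [abs_neg]; exact hb _) (by rw [abs_neg]; exact hb _)

theorem isSmooth_trig (i : Mode) : IsSmooth (trig i) := by
  rcases i with ⟨k, b⟩
  have h : ∀ y : Plane, mFourier k (proj y) =
      Complex.exp ((2 * Real.pi * ∑ j, k j * y j : ℝ) * Complex.I) := fun y =>
    mFourier_disp k (fun j => y j)
  have hlin : ContDiff ℝ ∞ fun y : Plane => 2 * Real.pi * ∑ j, (k j : ℝ) * y j := by fun_prop
  cases b
  · have : (fun y : Plane => trig (k, false) (proj y)) =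
        fun y : Plane => Real.cos (2 * Real.pi * ∑ j, k j * y j) := by
      ext y; rw [trig_false, h, Complex.exp_ofReal_mul_I_re]
    rw [IsSmooth, this]
    exact hlin.cos
  · have : (fun y : Plane => trig (k, true) (proj y)) =
        fun y : Plane => Real.sin (2 * Real.pi * ∑ j, k j * y j) := by
      ext y; rw [trig_true, h, Complex.exp_ofReal_mul_I_im]
    rw [IsSmooth, this]
    exact hlin.sin

/-- The distance of two points of the torus is the length of the shortest displacement. -/
theorem exists_disp_eq (z w : Torus2) : ∃ δ : Fin 2 → ℝ, w = z + disp δ ∧ ‖δ‖ = dist z w := by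
  have h : ∀ a : UnitAddCircle, ∃ x : ℝ, (x : UnitAddCircle) = a ∧ |x| = ‖a‖ := by
    intro a
    induction a using QuotientAddGroup.induction_on with
    | H x =>
      refine ⟨x - round x, ?_, ?_⟩
      · have : ((round x : ℝ) : UnitAddCircle) = 0 := by
          rw [AddCircle.coe_eq_zero_iff]
          exact ⟨round x, by simp⟩
        rw [AddCircle.coe_sub, this, sub_zero]
      · exact (UnitAddCircle.norm_eq (x := x)).symm
  choose r hr1 hr2 using h
  refine ⟨fun j => r (w j - z j), ?_, ?_⟩
  · ext j; simp [disp, hr1]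
  · rw [dist_comm, dist_eq_norm]
    refine le_antisymm ((pi_norm_le_iff_of_nonneg (norm_nonneg _)).2 fun j => ?_)
      ((pi_norm_le_iff_of_nonneg (norm_nonneg _)).2 fun j => ?_)
    · rw [Real.norm_eq_abs, hr2]
      exact norm_le_pi_norm (w - z) j
    · rw [Pi.sub_apply, ← hr2]
      exact norm_le_pi_norm (fun j => r (w j - z j)) j

theorem dist_add_disp_le (z : Torus2) (δ : Fin 2 → ℝ) : dist z (z + disp δ) ≤ ‖δ‖ := by
  rw [dist_comm, dist_eq_norm, add_sub_cancel_left]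
  refine (pi_norm_le_iff_of_nonneg (norm_nonneg _)).2 fun j => le_trans ?_ (norm_le_pi_norm δ j)
  change ‖((δ j : ℝ) : UnitAddCircle)‖ ≤ |δ j|
  rw [UnitAddCircle.norm_eq]
  simpa using round_le (δ j) 0

theorem dist_disp_le (a b : Fin 2 → ℝ) : dist (disp a) (disp b) ≤ ‖a - b‖ := by
  have := dist_add_disp_le (disp a) (b - a)
  rwa [← disp_add, add_sub_cancel, norm_sub_rev] at this

variable {g : C(Torus2, ℝ)} {Γ : Fin 2 → C(Torus2, ℝ)}

theorem abs_le_norm (g : C(Torus2, ℝ)) (z : Torus2) : |g z| ≤ ‖g‖ := g.norm_coe_le_norm z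

/-- Functions with a gradient in the sense of `HasGrad` are Lipschitz. -/
theorem HasGrad.exists_lipschitz (hg : HasGrad g Γ) :
    ∃ K : ℝ≥0, ∀ z w : Torus2, |g z - g w| ≤ K * dist z w := by
  obtain ⟨C, hC, h1⟩ := hg
  refine ⟨⟨C + ∑ j, ‖Γ j‖, by positivity⟩, fun z w => ?_⟩
  obtain ⟨δ, rfl, hδ⟩ := exists_disp_eq z w
  have h2 := h1 z δ
  rw [← hδ]
  have hle : ‖δ‖ ≤ 1 := by
    rw [hδ, dist_eq_norm]
    refine (pi_norm_le_iff_of_nonneg zero_le_one).2 fun j => ?_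
    have := AddCircle.norm_le_half_period (1 : ℝ) one_ne_zero (x := (z - (z + disp δ)) j)
    norm_num at this ⊢
    linarith
  have h3 : |∑ j, δ j * Γ j z| ≤ (∑ j, ‖Γ j‖) * ‖δ‖ := by
    rw [Finset.sum_mul]
    refine (Finset.abs_sum_le_sum_abs _ _).trans (Finset.sum_le_sum fun j _ => ?_)
    rw [abs_mul, mul_comm]
    exact mul_le_mul (abs_le_norm _ _) (norm_le_pi_norm δ j) (abs_nonneg _) (norm_nonneg _)
  have h4 : |g z - g (z + disp δ)| ≤
      |g (z + disp δ) - g z - ∑ j, δ j * Γ j z| + |∑ j, δ j * Γ j z| := by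
    rw [abs_sub_comm]
    have := abs_add_le (g (z + disp δ) - g z - ∑ j, δ j * Γ j z) (∑ j, δ j * Γ j z)
    rwa [sub_add_cancel] at this
  have h5 : C * ‖δ‖ ^ 2 ≤ C * ‖δ‖ := by
    refine mul_le_mul_of_nonneg_left ?_ hC
    nlinarith [norm_nonneg δ]
  change _ ≤ (C + ∑ j, ‖Γ j‖) * ‖δ‖
  linarith

theorem HasGrad.hasFDerivAt (hg : HasGrad g Γ) (z : Torus2) :
    HasFDerivAt (fun δ : Fin 2 → ℝ => g (z + disp δ))
      (∑ j, Γ j z • ContinuousLinearMap.proj (R := ℝ) (φ := fun _ : Fin 2 => ℝ) j) 0 := by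
  obtain ⟨C, hC, h1⟩ := hg
  rw [hasFDerivAt_iff_isLittleO_nhds_zero]
  refine Asymptotics.IsBigO.trans_isLittleO (g := fun δ : Fin 2 → ℝ => ‖δ‖ ^ 2)
    (Asymptotics.IsBigO.of_bound C (Eventually.of_forall fun δ => ?_)) ?_
  · have := h1 z δ
    have h0 : disp 0 = 0 := by ext j; simp [disp]
    simp only [zero_add, h0, add_zero, Real.norm_eq_abs, abs_pow, abs_norm]
    convert! this using 3
    simp [mul_comm]
  · exact Asymptotics.isLittleO_norm_pow_id one_lt_two

theorem HasGrad.partialDeriv_eq (hg : HasGrad g Γ) (j : Fin 2) (z : Torus2) :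
    partialDeriv j g z = Γ j z := by
  have h1 := hg.hasFDerivAt z
  have h2 : HasDerivAt (fun s : ℝ => (Pi.single j s : Fin 2 → ℝ)) (Pi.single j 1) 0 :=
    hasDerivAt_single j 0
  have h0 : (0 : Fin 2 → ℝ) = Pi.single j (0 : ℝ) := by simp
  rw [h0] at h1
  have h3 := h1.comp_hasDerivAt (0 : ℝ) h2
  have h4 := h3.deriv
  simp only [Function.comp_def, disp_single] at h4
  rw [partialDeriv, h4]
  fin_cases j <;> simp

theorem HasGrad.grad_eq (hg : HasGrad g Γ) (z : Torus2) (V : Plane) :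
    inner ℝ V (grad g z) = ∑ j, V j * Γ j z := by
  simp [grad, hg.partialDeriv_eq, PiLp.inner_apply, mul_comm]

/-- The chain rule for a one-sided derivative along the projection of a curve in the plane. -/
theorem HasGrad.hasDerivWithinAt_comp (hg : HasGrad g Γ) {X : ℝ → Plane} {V : Plane} {t : ℝ}
    {s : Set ℝ} (hX : HasDerivWithinAt X V s t) :
    HasDerivWithinAt (fun r => g (proj (X r))) (∑ j, V j * Γ j (proj (X t))) s t := by
  have h1 := hg.hasFDerivAt (proj (X t))
  have h2 : HasDerivWithinAt (fun r => (fun j => X r j - X t j : Fin 2 → ℝ)) (fun j => V j)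
      s t := by
    rw [hasDerivWithinAt_pi]
    intro j
    have := (EuclideanSpace.proj (𝕜 := ℝ) (ι := Fin 2) j).hasFDerivAt.comp_hasDerivWithinAt t hX
    exact this.sub_const _
  have h0 : (0 : Fin 2 → ℝ) = fun j => X t j - X t j := by ext j; simp
  rw [h0] at h1
  have h3 := h1.comp_hasDerivWithinAt t h2
  convert! h3 using 1
  · ext r
    simp only [Function.comp_def]
    congr 1
    ext j
    simp [disp, proj]
  · simp [mul_comm]

/-! ### Dirichlet energy -/

/-- The Dirichlet energy `∑ λᵢ ⟨eᵢ, g⟩²` of `g`, that is, the squared norm of its weak gradient, is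
at most `B`. In particular it is finite. -/
def EnergyLE (g : L2) (B : ℝ) : Prop :=
  ∀ F : Finset Mode, ∑ i ∈ F, i.eig * inner ℝ (trigL2 i) g ^ 2 ≤ B

theorem EnergyLE.nonneg {g : L2} {B : ℝ} (h : EnergyLE g B) : 0 ≤ B := by simpa using h ∅

theorem EnergyLE.mono {g : L2} {A B : ℝ} (h : EnergyLE g A) (hAB : A ≤ B) : EnergyLE g B :=
  fun F => (h F).trans hAB

theorem EnergyLE.of_tendsto {ι : Type*} {l : Filter ι} [l.NeBot] {g : ι → L2} {g' : L2} {B : ℝ}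
    (hg : Tendsto g l (𝓝 g')) (h : ∀ i, EnergyLE (g i) B) : EnergyLE g' B := by
  intro F
  refine le_of_tendsto (f := fun n => ∑ i ∈ F, i.eig * inner ℝ (trigL2 i) (g n) ^ 2) (x := l) ?_
    (Eventually.of_forall fun n => h n F)
  refine tendsto_finsetSum _ fun i _ => ?_
  exact ((tendsto_const_nhds.inner hg).pow 2).const_mul _

/-- The Cauchy–Schwarz inequality for the Dirichlet form, with a Fourier multiplier `m` dominated by
that of `-Δ`. -/
theorem EnergyLE.abs_sum_le {g h : L2} {A B : ℝ} (hg : EnergyLE g A) (hh : EnergyLE h B)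
    (F : Finset Mode) {m : Mode → ℝ} (hm : ∀ i, |m i| ≤ i.eig) :
    |∑ i ∈ F, m i * (inner ℝ (trigL2 i) g * inner ℝ (trigL2 i) h)| ≤ √A * √B := by
  have h1 : ∀ i ∈ F, |m i * (inner ℝ (trigL2 i) g * inner ℝ (trigL2 i) h)| ≤
      (√i.eig * |inner ℝ (trigL2 i) g|) * (√i.eig * |inner ℝ (trigL2 i) h|) := by
    intro i _
    rw [abs_mul, abs_mul]
    have := Real.mul_self_sqrt i.eig_nonneg
    calc _ ≤ i.eig * (|inner ℝ (trigL2 i) g| * |inner ℝ (trigL2 i) h|) :=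
          mul_le_mul_of_nonneg_right (hm i) (by positivity)
      _ = _ := by
          nth_rewrite 1 [← this]
          ring
  refine (Finset.abs_sum_le_sum_abs _ _).trans ((Finset.sum_le_sum h1).trans ?_)
  refine (Real.sum_mul_le_sqrt_mul_sqrt F _ _).trans ?_
  refine mul_le_mul (Real.sqrt_le_sqrt ?_) (Real.sqrt_le_sqrt ?_) (Real.sqrt_nonneg _)
    (Real.sqrt_nonneg _)
  · refine le_trans (Finset.sum_le_sum fun i _ => le_of_eq ?_) (hg F)
    rw [mul_pow, Real.sq_sqrt i.eig_nonneg, sq_abs]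
  · refine le_trans (Finset.sum_le_sum fun i _ => le_of_eq ?_) (hh F)
    rw [mul_pow, Real.sq_sqrt i.eig_nonneg, sq_abs]

/-- Exchange of cosine and sine. -/
def flipEquiv : Mode ≃ Mode := ⟨Mode.flip, Mode.flip, Mode.flip_flip, Mode.flip_flip⟩

theorem toL2_trigGrad (i : Mode) (j : Fin 2) : toL2 (trigGrad i j) = i.freq j • trigL2 i.flip := by
  rw [trigGrad, map_smul]; rfl

/-- If `D 0`, `D 1` are the weak partial derivatives of `g`, the Dirichlet energy of `g` is
the sum of their squared norms. -/
theorem hasSum_energy {g : L2} {D : Fin 2 → L2}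
    (hD : ∀ i j, inner ℝ (trigL2 i) (D j) = -inner ℝ (toL2 (trigGrad i j)) g) :
    HasSum (fun i : Mode => i.eig * inner ℝ (trigL2 i) g ^ 2) (∑ j, ‖D j‖ ^ 2) := by
  have h1 : ∀ j, HasSum (fun i : Mode => i.freq j ^ 2 * inner ℝ (trigL2 i) g ^ 2) (‖D j‖ ^ 2) := by
    intro j
    rw [← flipEquiv.hasSum_iff]
    convert! trigL2_isParsevalFrame (D j) using 1
    ext i
    rw [hD, toL2_trigGrad, real_inner_smul_left]
    simp [flipEquiv, mul_pow]
  convert! hasSum_sum (s := Finset.univ) fun j _ => h1 j using 1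
  ext i
  rw [Mode.eig, Finset.sum_mul]

theorem EnergyLE.of_hasSum {g : L2} {B : ℝ}
    (h : HasSum (fun i : Mode => i.eig * inner ℝ (trigL2 i) g ^ 2) B) : EnergyLE g B :=
  fun F => sum_le_hasSum F (fun i _ => mul_nonneg i.eig_nonneg (sq_nonneg _)) h

theorem flip_parsevalFrame : IsParsevalFrame fun i : Mode => trigL2 i.flip := fun g =>
  flipEquiv.hasSum_iff.2 (trigL2_isParsevalFrame g)

/-- Composition with a measure-preserving map, as an isometry of `L²`. -/
abbrev compL2 {R : Torus2 → Torus2} (hR : MeasurePreserving R torusMeasure torusMeasure) :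
    L2 →ₗᵢ[ℝ] L2 :=
  Lp.compMeasurePreservingₗᵢ ℝ R hR

theorem coeFn_compL2 {R : Torus2 → Torus2} (hR : MeasurePreserving R torusMeasure torusMeasure)
    (g : L2) : compL2 hR g =ᵐ[torusMeasure] g ∘ R :=
  Lp.coeFn_compMeasurePreserving g hR

theorem measurePreserving_add_left (w : Torus2) :
    MeasurePreserving (fun z : Torus2 => z + w) torusMeasure torusMeasure :=
  measurePreserving_add_right torusMeasure w

theorem norm_toL2_sq (g : C(Torus2, ℝ)) : ‖toL2 g‖ ^ 2 = ∫ z, g z ^ 2 ∂torusMeasure := by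
  rw [← real_inner_self_eq_norm_sq, inner_toL2_toL2]
  simp [sq]

theorem integrable_of_continuous {g : Torus2 → ℝ} (hg : Continuous g) :
    Integrable g torusMeasure :=
  hg.integrable_of_hasCompactSupport (HasCompactSupport.of_compactSpace _)

theorem continuous_integrable (g : C(Torus2, ℝ)) : Integrable g torusMeasure :=
  g.continuous.integrable_of_hasCompactSupport (HasCompactSupport.of_compactSpace _)

/-- The difference quotient of `h` in direction `j` with step `s`. -/
def diffQuot (h : C(Torus2, ℝ)) (j : Fin 2) (s : ℝ) : C(Torus2, ℝ) where
  toFun z := s⁻¹ * (h (z + disp (Pi.single j s)) - h z)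
  continuous_toFun := by fun_prop

theorem norm_pi_single (j : Fin 2) (s : ℝ) : ‖(Pi.single j s : Fin 2 → ℝ)‖ = |s| := by
  rw [Pi.norm_single, Real.norm_eq_abs]

/-- Discrete integration by parts: only `g` has to be differentiable. -/
theorem tendsto_inner_diffQuot (hg : HasGrad g Γ) (h : C(Torus2, ℝ)) (j : Fin 2) :
    Tendsto (fun s => inner ℝ (toL2 g) (toL2 (diffQuot h j s))) (𝓝[≠] 0)
      (𝓝 (-inner ℝ (toL2 (Γ j)) (toL2 h))) := by
  obtain ⟨C, hC, h1⟩ := hg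
  have hbound : ∀ s : ℝ, s ≠ 0 → |inner ℝ (toL2 g) (toL2 (diffQuot h j s)) -
      (-inner ℝ (toL2 (Γ j)) (toL2 h))| ≤ C * ‖h‖ * |s| := by
    intro s hs
    rw [inner_toL2_toL2, inner_toL2_toL2]
    -- move the translation from `h` to `g`
    have h2 : ∫ z, diffQuot h j s z * g z ∂torusMeasure =
        ∫ z, h z * (s⁻¹ * (g (z + disp (Pi.single j (-s))) - g z)) ∂torusMeasure := by
      have hT := measurePreserving_add_left (disp (Pi.single j s))
      have h3 : ∫ z, h z * g (z + disp (Pi.single j (-s))) ∂torusMeasure =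
          ∫ z, h (z + disp (Pi.single j s)) * g z ∂torusMeasure := by
        rw [← integral_add_right_eq_self (μ := torusMeasure)
          (fun z => h z * g (z + disp (Pi.single j (-s)))) (disp (Pi.single j s))]
        simp [disp_single, add_assoc, ← Pi.single_add]
      have i1 : Integrable (fun z => h z * g z) torusMeasure :=
        continuous_integrable (h * g)
      have i2 : Integrable (fun z => h (z + disp (Pi.single j s)) * g z) torusMeasure :=
        integrable_of_continuous (by fun_prop)
      have i3 : Integrable (fun z => h z * g (z + disp (Pi.single j (-s)))) torusMeasure :=
        integrable_of_continuous (by fun_prop)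
      calc _ = ∫ z, s⁻¹ * (h (z + disp (Pi.single j s)) * g z - h z * g z) ∂torusMeasure := by
            refine integral_congr_ae (Eventually.of_forall fun z => ?_)
            simp only [diffQuot, ContinuousMap.coe_mk]; ring
        _ = ∫ z, s⁻¹ * (h z * g (z + disp (Pi.single j (-s))) - h z * g z) ∂torusMeasure := by
            rw [integral_const_mul, integral_const_mul, integral_sub i2 i1, integral_sub i3 i1, h3]
        _ = _ := by
            refine integral_congr_ae (Eventually.of_forall fun z => ?_)
            simp only; ring
    have i4 : Integrable (fun z => h z * (s⁻¹ * (g (z + disp (Pi.single j (-s))) - g z)))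
        torusMeasure := integrable_of_continuous (by fun_prop)
    have i5 : Integrable (fun z => h z * Γ j z) torusMeasure := continuous_integrable (h * Γ j)
    rw [h2, sub_neg_eq_add, ← integral_add i4 i5]
    have h6 : ∀ z, ‖h z * (s⁻¹ * (g (z + disp (Pi.single j (-s))) - g z)) + h z * Γ j z‖ ≤
        C * ‖h‖ * |s| := by
      intro z
      have h7 := h1 z (Pi.single j (-s))
      rw [norm_pi_single, abs_neg] at h7
      have h8 : ∑ l, (Pi.single j (-s) : Fin 2 → ℝ) l * Γ l z = -s * Γ j z := by
        simp [Pi.single_apply]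
      rw [h8] at h7
      have h9 : h z * (s⁻¹ * (g (z + disp (Pi.single j (-s))) - g z)) + h z * Γ j z =
          h z * (s⁻¹ * (g (z + disp (Pi.single j (-s))) - g z - -s * Γ j z)) := by
        field_simp; ring
      rw [h9, norm_mul, norm_mul, norm_inv, Real.norm_eq_abs, Real.norm_eq_abs, Real.norm_eq_abs]
      have hs' : 0 < |s| := abs_pos.2 hs
      calc _ ≤ ‖h‖ * (|s|⁻¹ * (C * |s| ^ 2)) := by
            refine mul_le_mul (abs_le_norm h z) ?_ (by positivity) (norm_nonneg _)
            exact mul_le_mul_of_nonneg_left h7 (by positivity)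
        _ = _ := by field_simp
    have := norm_integral_le_of_norm_le_const (μ := torusMeasure) (Eventually.of_forall h6)
    simpa using this
  rw [tendsto_iff_norm_sub_tendsto_zero]
  refine squeeze_zero' (Eventually.of_forall fun _ => norm_nonneg _)
    (eventually_mem_nhdsWithin.mono fun s hs => hbound s hs) ?_
  have : Tendsto (fun s : ℝ => C * ‖h‖ * |s|) (𝓝 0) (𝓝 (C * ‖h‖ * |0|)) := by
    apply Continuous.tendsto; fun_prop
  rw [abs_zero, mul_zero] at this
  exact this.mono_left nhdsWithin_le_nhds

/-- The composition with a Lipschitz map is Lipschitz only, so its Fourier coefficients are bounded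
through difference quotients, to which Bessel's inequality applies. -/
theorem energyLE_comp_of_hasGrad (hg : HasGrad g Γ) {R : C(Torus2, Torus2)} {Λ : ℝ≥0}
    (hL : LipschitzWith Λ R) (hR : MeasurePreserving R torusMeasure torusMeasure) :
    EnergyLE (toL2 (g.comp R)) (4 * Λ ^ 2 * ∑ j, ‖toL2 (Γ j)‖ ^ 2) := by
  obtain ⟨C, hC, h1⟩ := hg
  set N := ∑ j, ‖toL2 (Γ j)‖ ^ 2 with hN
  set h := g.comp R with hh
  -- pointwise bound for difference quotients
  have hpt : ∀ (j : Fin 2) (s : ℝ), s ≠ 0 → ∀ z, |diffQuot h j s z| ≤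
      Λ * (|Γ 0 (R z)| + |Γ 1 (R z)|) + C * Λ ^ 2 * |s| := by
    intro j s hs z
    have hs' : 0 < |s| := abs_pos.2 hs
    obtain ⟨δ, hδ, hδ'⟩ := exists_disp_eq (R z) (R (z + disp (Pi.single j s)))
    have h2 : ‖δ‖ ≤ Λ * |s| := by
      rw [hδ', ← norm_pi_single j s]
      exact (hL.dist_le_mul _ _).trans
        (mul_le_mul_of_nonneg_left (dist_add_disp_le _ _) Λ.coe_nonneg)
    have h3 := h1 (R z) δ
    have h4 : |h (z + disp (Pi.single j s)) - h z| ≤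
        (Λ * (|Γ 0 (R z)| + |Γ 1 (R z)|) + C * Λ ^ 2 * |s|) * |s| := by
      have h5 : h (z + disp (Pi.single j s)) = g (R z + disp δ) := by rw [← hδ]; rfl
      rw [h5]
      change |g (R z + disp δ) - g (R z)| ≤ _
      have h6 := abs_add_le (g (R z + disp δ) - g (R z) - ∑ j, δ j * Γ j (R z))
        (∑ j, δ j * Γ j (R z))
      rw [sub_add_cancel] at h6
      have h7 : |∑ j, δ j * Γ j (R z)| ≤ Λ * |s| * (|Γ 0 (R z)| + |Γ 1 (R z)|) := by
        rw [Fin.sum_univ_two, mul_add]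
        refine (abs_add_le _ _).trans (add_le_add ?_ ?_)
        · rw [abs_mul]
          exact mul_le_mul_of_nonneg_right ((norm_le_pi_norm δ 0).trans h2) (abs_nonneg _)
        · rw [abs_mul]
          exact mul_le_mul_of_nonneg_right ((norm_le_pi_norm δ 1).trans h2) (abs_nonneg _)
      have h8 : C * ‖δ‖ ^ 2 ≤ C * (Λ * |s|) ^ 2 :=
        mul_le_mul_of_nonneg_left (pow_le_pow_left₀ (norm_nonneg _) h2 2) hC
      calc _ ≤ _ := h6
        _ ≤ C * (Λ * |s|) ^ 2 + Λ * |s| * (|Γ 0 (R z)| + |Γ 1 (R z)|) :=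
          add_le_add (h3.trans h8) h7
        _ = _ := by ring
    change |s⁻¹ * (h (z + disp (Pi.single j s)) - h z)| ≤ _
    rw [abs_mul, abs_inv, inv_mul_le_iff₀ hs', mul_comm |s|]
    exact h4
  -- integrated bound
  set D : ℝ := 2 * (Λ * (‖Γ 0‖ + ‖Γ 1‖)) * (C * Λ ^ 2) + (C * Λ ^ 2) ^ 2 with hD
  have hint : ∀ (j : Fin 2) (s : ℝ), s ≠ 0 → |s| ≤ 1 →
      ‖toL2 (diffQuot h j s)‖ ^ 2 ≤ 2 * Λ ^ 2 * N + D * |s| := by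
    intro j s hs hs1
    have h2 : ∀ z, diffQuot h j s z ^ 2 ≤
        2 * Λ ^ 2 * (Γ 0 (R z) ^ 2 + Γ 1 (R z) ^ 2) + D * |s| := by
      intro z
      have h3 := pow_le_pow_left₀ (abs_nonneg _) (hpt j s hs z) 2
      rw [sq_abs] at h3
      refine h3.trans ?_
      set a := |Γ 0 (R z)| with ha
      set b := |Γ 1 (R z)| with hb
      have ha' : a ≤ ‖Γ 0‖ := abs_le_norm _ _
      have hb' : b ≤ ‖Γ 1‖ := abs_le_norm _ _
      rw [← sq_abs (Γ 0 (R z)), ← sq_abs (Γ 1 (R z)), ← ha, ← hb]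
      have e1 : (Λ * (a + b) + C * Λ ^ 2 * |s|) ^ 2 = Λ ^ 2 * (a + b) ^ 2 +
        2 * (Λ * (a + b)) * (C * Λ ^ 2) * |s| + (C * Λ ^ 2) ^ 2 * (|s| * |s|) := by ring
      have e2 : (Λ : ℝ) ^ 2 * (a + b) ^ 2 ≤ 2 * Λ ^ 2 * (a ^ 2 + b ^ 2) := by
        nlinarith [mul_nonneg (sq_nonneg (Λ : ℝ)) (sq_nonneg (a - b))]
      have e3 : 2 * (Λ * (a + b)) * (C * Λ ^ 2) * |s| ≤
          2 * (Λ * (‖Γ 0‖ + ‖Γ 1‖)) * (C * Λ ^ 2) * |s| := by gcongr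
      have e4 : (C * (Λ : ℝ) ^ 2) ^ 2 * (|s| * |s|) ≤ (C * Λ ^ 2) ^ 2 * |s| :=
        mul_le_mul_of_nonneg_left (mul_le_of_le_one_right (abs_nonneg _) hs1) (sq_nonneg _)
      rw [e1, hD, add_mul]
      linarith
    rw [norm_toL2_sq]
    have i1 : ∀ j, Integrable (fun z => Γ j (R z) ^ 2) torusMeasure := fun j =>
      integrable_of_continuous (by fun_prop)
    have i2 : Integrable (fun z => 2 * Λ ^ 2 * (Γ 0 (R z) ^ 2 + Γ 1 (R z) ^ 2)) torusMeasure :=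
      ((i1 0).add (i1 1)).const_mul _
    have i3 : ∀ j, ∫ z, Γ j (R z) ^ 2 ∂torusMeasure = ‖toL2 (Γ j)‖ ^ 2 := by
      intro j
      rw [norm_toL2_sq]
      have := integral_map (μ := torusMeasure) hR.measurable.aemeasurable
        (f := fun z => Γ j z ^ 2)
        (Continuous.aestronglyMeasurable (by fun_prop))
      rw [hR.map_eq] at this
      exact this.symm
    calc _ ≤ ∫ z, (2 * Λ ^ 2 * (Γ 0 (R z) ^ 2 + Γ 1 (R z) ^ 2) + D * |s|) ∂torusMeasure := by
          refine integral_mono (integrable_of_continuous (by fun_prop))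
            (i2.add (integrable_const _))
            h2
      _ = _ := by
          rw [integral_add i2 (integrable_const _), integral_const_mul,
            integral_add (i1 0) (i1 1), i3, i3, hN, Fin.sum_univ_two]
          simp
  -- pass to the limit in Bessel's inequality
  have hdir : ∀ (j : Fin 2) (F : Finset Mode),
      ∑ i ∈ F, i.freq j ^ 2 * inner ℝ (trigL2 i) (toL2 h) ^ 2 ≤ 2 * Λ ^ 2 * N := by
    intro j F
    have h2 : Tendsto (fun s => ∑ i ∈ F, inner ℝ (trigL2 i.flip) (toL2 (diffQuot h j s)) ^ 2)
        (𝓝[≠] 0) (𝓝 (∑ i ∈ F, (-inner ℝ (toL2 (trigGrad i.flip j)) (toL2 h)) ^ 2)) :=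
      tendsto_finsetSum _ fun i _ => (tendsto_inner_diffQuot (hasGrad_trig i.flip) h j).pow 2
    have h3 : Tendsto (fun s : ℝ => 2 * Λ ^ 2 * N + D * |s|) (𝓝[≠] 0) (𝓝 (2 * Λ ^ 2 * N)) := by
      have : Tendsto (fun s : ℝ => 2 * Λ ^ 2 * N + D * |s|) (𝓝 0)
          (𝓝 (2 * Λ ^ 2 * N + D * |0|)) := by apply Continuous.tendsto; fun_prop
      rw [abs_zero, mul_zero, add_zero] at this
      exact this.mono_left nhdsWithin_le_nhds
    have h4 : ∀ᶠ s : ℝ in 𝓝[≠] 0,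
        ∑ i ∈ F, inner ℝ (trigL2 i.flip) (toL2 (diffQuot h j s)) ^ 2 ≤ 2 * Λ ^ 2 * N + D * |s| := by
      have : ∀ᶠ s : ℝ in 𝓝[≠] 0, |s| ≤ 1 := by
        refine Filter.Eventually.filter_mono nhdsWithin_le_nhds ?_
        have := Metric.closedBall_mem_nhds (0 : ℝ) one_pos
        filter_upwards [this] with s hs
        simpa using hs
      filter_upwards [this, eventually_mem_nhdsWithin] with s hs hs0
      exact (flip_parsevalFrame.sum_sq_le F _).trans (hint j s hs0 hs)
    refine le_trans (le_of_eq (Finset.sum_congr rfl fun i _ => ?_))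
      (le_of_tendsto_of_tendsto h2 h3 h4)
    rw [toL2_trigGrad, real_inner_smul_left]
    simp [mul_pow]
  intro F
  calc ∑ i ∈ F, i.eig * inner ℝ (trigL2 i) (toL2 h) ^ 2
      = ∑ j, ∑ i ∈ F, i.freq j ^ 2 * inner ℝ (trigL2 i) (toL2 h) ^ 2 := by
        rw [Finset.sum_comm]
        exact Finset.sum_congr rfl fun i _ => by rw [Mode.eig, Finset.sum_mul]
    _ ≤ ∑ _j : Fin 2, 2 * Λ ^ 2 * N := Finset.sum_le_sum fun j _ => hdir j F
    _ = 4 * Λ ^ 2 * N := by rw [Finset.sum_const]; simp; ring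

theorem compL2_toL2 {R : C(Torus2, Torus2)} (hR : MeasurePreserving R torusMeasure torusMeasure)
    (g : C(Torus2, ℝ)) : compL2 hR (toL2 g) = toL2 (g.comp R) := by
  refine Lp.ext ?_
  have h1 := coeFn_compL2 hR (toL2 g)
  have h2 := ContinuousMap.coeFn_toLp (p := 2) (𝕜 := ℝ) torusMeasure (g.comp R)
  have h3 := hR.quasiMeasurePreserving.ae
    (ContinuousMap.coeFn_toLp (p := 2) (𝕜 := ℝ) torusMeasure g)
  filter_upwards [h1, h2, h3] with z h1 h2 h3
  rw [h1, h2, Function.comp_apply, h3]; rfl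

/-- The trigonometric polynomial with coefficients `⟨eᵢ, g⟩` for `i ∈ F`. -/
def trunc (F : Finset Mode) (g : L2) : C(Torus2, ℝ) := ∑ i ∈ F, inner ℝ (trigL2 i) g • trig i

/-- The gradient of `trunc F g`. -/
def truncGrad (F : Finset Mode) (g : L2) (j : Fin 2) : C(Torus2, ℝ) :=
  ∑ i ∈ F, inner ℝ (trigL2 i) g • trigGrad i j

theorem hasGrad_trunc (F : Finset Mode) (g : L2) : HasGrad (trunc F g) (truncGrad F g) := by
  have := HasGrad.sum F fun i => (hasGrad_trig i).smul (inner ℝ (trigL2 i) g)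
  convert! this using 1
  ext j z
  simp [truncGrad]

theorem toL2_trunc (F : Finset Mode) (g : L2) :
    toL2 (trunc F g) = ∑ i ∈ F, inner ℝ (trigL2 i) g • trigL2 i := by
  simp only [trunc, map_sum, map_smul]; rfl

theorem tendsto_trunc (g : L2) : Tendsto (fun F => toL2 (trunc F g)) atTop (𝓝 g) := by
  simp only [toL2_trunc]
  exact trigL2_isParsevalFrame.hasSum_smul g

theorem toL2_truncGrad (F : Finset Mode) (g : L2) (j : Fin 2) :
    toL2 (truncGrad F g j) = ∑ i ∈ F, (inner ℝ (trigL2 i) g * i.freq j) • trigL2 i.flip := by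
  simp only [truncGrad, map_sum, map_smul, toL2_trigGrad, smul_smul]

/-- Only an inequality, since distinct modes need not be orthogonal. -/
theorem sum_norm_truncGrad_le (F : Finset Mode) (g : L2) :
    ∑ j, ‖toL2 (truncGrad F g j)‖ ^ 2 ≤ ∑ i ∈ F, i.eig * inner ℝ (trigL2 i) g ^ 2 := by
  calc _ ≤ ∑ j, ∑ i ∈ F, (inner ℝ (trigL2 i) g * i.freq j) ^ 2 := by
        refine Finset.sum_le_sum fun j _ => ?_
        rw [toL2_truncGrad]
        exact flip_parsevalFrame.norm_sum_sq_le F _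
    _ = _ := by
        rw [Finset.sum_comm]
        refine Finset.sum_congr rfl fun i _ => ?_
        rw [Mode.eig, Finset.sum_mul]
        exact Finset.sum_congr rfl fun j _ => by ring

theorem tendsto_truncGrad {g : L2} {D : Fin 2 → L2}
    (hD : ∀ i j, inner ℝ (trigL2 i) (D j) = -inner ℝ (toL2 (trigGrad i j)) g) (j : Fin 2) :
    Tendsto (fun F => toL2 (truncGrad F g j)) atTop (𝓝 (D j)) := by
  have h1 := trigL2_isParsevalFrame.hasSum_smul (D j)
  rw [← flipEquiv.hasSum_iff] at h1
  refine Tendsto.congr (fun F => ?_) h1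
  rw [toL2_truncGrad]
  refine Finset.sum_congr rfl fun i _ => ?_
  simp only [Function.comp_apply, flipEquiv, Equiv.coe_fn_mk]
  rw [hD, toL2_trigGrad, real_inner_smul_left]
  simp [mul_comm]

/-- Composition with a measure-preserving `Λ`-Lipschitz map multiplies the Dirichlet energy by at
most `4 Λ²`. (The factor `4` is lost in the passage between the sup metric of the torus and the
Euclidean norm of gradients.) -/
theorem EnergyLE.comp {g : L2} {B : ℝ} (hg : EnergyLE g B) {R : Torus2 → Torus2} {Λ : ℝ≥0}
    (hL : LipschitzWith Λ R) (hR : MeasurePreserving R torusMeasure torusMeasure) :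
    EnergyLE (compL2 hR g) (4 * Λ ^ 2 * B) := by
  have h1 : Tendsto (fun F => compL2 hR (toL2 (trunc F g))) atTop (𝓝 (compL2 hR g)) :=
    ((compL2 hR).continuous.tendsto g).comp (tendsto_trunc g)
  refine EnergyLE.of_tendsto h1 fun F => ?_
  have h2 := energyLE_comp_of_hasGrad (hasGrad_trunc F g) (R := ⟨R, hL.continuous⟩) hL hR
  rw [← compL2_toL2 (R := ⟨R, hL.continuous⟩) hR] at h2
  refine h2.mono ?_
  have := (sum_norm_truncGrad_le F g).trans (hg F)
  gcongr

/-! ### Trajectories of a Lipschitz field -/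

theorem exists_int_of_proj_eq {a b : Plane} (h : proj a = proj b) :
    ∃ k : Fin 2 → ℤ, ∀ j, a j = b j + k j := by
  have h1 : ∀ j, ∃ k : ℤ, a j = b j + k := by
    intro j
    have h2 : ((a j : ℝ) : UnitAddCircle) = (b j : ℝ) := congrFun h j
    have h3 : ((a j - b j : ℝ) : UnitAddCircle) = 0 := by rw [AddCircle.coe_sub, h2, sub_self]
    rw [AddCircle.coe_eq_zero_iff] at h3
    obtain ⟨k, hk⟩ := h3
    exact ⟨k, by simp at hk; linarith⟩
  choose k hk using h1
  exact ⟨k, hk⟩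

theorem proj_add_int (b : Plane) (k : Fin 2 → ℤ) :
    proj (b + WithLp.toLp 2 fun j => (k j : ℝ)) = proj b := by
  ext j
  simp [proj]

theorem dist_proj_le (a b : Plane) : dist (proj a) (proj b) ≤ ‖fun j => a j - b j‖ :=
  dist_disp_le (fun j => a j) (fun j => b j)

variable {L : ℝ≥0} {v : ℝ → Torus2 → Plane} {ψ : ℝ → Torus2 → Torus2}

/-- `X` is a lift to the plane of the trajectory that starts at `z`. -/
structure IsLift (v : ℝ → Torus2 → Plane) (ψ : ℝ → Torus2 → Torus2) (z : Torus2)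
    (X : ℝ → Plane) : Prop where
  continuousOn : ContinuousOn X (Icc 0 1)
  proj_eq : ∀ t ∈ Icc (0 : ℝ) 1, proj (X t) = ψ t z
  hasDeriv : ∀ t ∈ Ico (0 : ℝ) 1, HasDerivWithinAt X (v t (ψ t z)) (Ici t) t

theorem IsFlowMap.exists_lift (hψ : IsFlowMap v ψ) (z : Torus2) : ∃ X, IsLift v ψ z X := by
  obtain ⟨-, X, h1, h2, h3⟩ := hψ z
  exact ⟨X, h1, h2, h3⟩

/-- Lifts of two trajectories can be chosen so that at a given time they are as close to each other
as their projections. -/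
theorem IsFlowMap.exists_lifts (hψ : IsFlowMap v ψ) (z w : Torus2) {s : ℝ}
    (hs : s ∈ Icc (0 : ℝ) 1) {X : ℝ → Plane} (hX : IsLift v ψ z X) :
    ∃ Y, IsLift v ψ w Y ∧ ‖fun j => X s j - Y s j‖ = dist (ψ s z) (ψ s w) := by
  obtain ⟨Y, hY⟩ := hψ.exists_lift w
  obtain ⟨δ, h1, h2⟩ := exists_disp_eq (ψ s z) (ψ s w)
  have h3 : proj (X s + WithLp.toLp 2 δ) = proj (Y s) := by
    rw [hY.proj_eq s hs, h1, ← hX.proj_eq s hs]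
    ext j; simp [proj, disp]
  obtain ⟨k, hk⟩ := exists_int_of_proj_eq h3
  refine ⟨fun t => Y t + WithLp.toLp 2 fun j => (k j : ℝ), ⟨?_, ?_, ?_⟩, ?_⟩
  · exact hY.continuousOn.add continuousOn_const
  · intro t ht
    rw [proj_add_int, hY.proj_eq t ht]
  · intro t ht
    exact (hY.hasDeriv t ht).add_const _
  · rw [← h2, ← norm_neg δ]
    congr 1
    ext j
    have := hk j
    simp at this ⊢
    linarith

theorem coord_hasDerivWithinAt {X : ℝ → Plane} {V : Plane} {t : ℝ} {s : Set ℝ}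
    (hX : HasDerivWithinAt X V s t) :
    HasDerivWithinAt (fun r => (fun j => X r j : Fin 2 → ℝ)) (fun j => V j) s t := by
  rw [hasDerivWithinAt_pi]
  intro j
  exact (EuclideanSpace.proj (𝕜 := ℝ) (ι := Fin 2) j).hasFDerivAt.comp_hasDerivWithinAt t hX

theorem pi_norm_coord_le (V : Plane) : ‖(fun j => V j : Fin 2 → ℝ)‖ ≤ ‖V‖ :=
  (pi_norm_le_iff_of_nonneg (norm_nonneg _)).2 fun j => PiLp.norm_apply_le V j

section

variable {z w : Torus2} {X Y : ℝ → Plane}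

theorem IsLift.sub_continuousOn (hX : IsLift v ψ z X) (hY : IsLift v ψ w Y) :
    ContinuousOn (fun t => (fun j => X t j - Y t j : Fin 2 → ℝ)) (Icc 0 1) := by
  refine continuousOn_pi.2 fun j => ?_
  have h := fun {Z : ℝ → Plane} (hZ : ContinuousOn Z (Icc (0 : ℝ) 1)) =>
    (EuclideanSpace.proj (𝕜 := ℝ) (ι := Fin 2) j).continuous.comp_continuousOn hZ
  exact (h hX.continuousOn).sub (h hY.continuousOn)

theorem IsLift.sub_hasDeriv (hX : IsLift v ψ z X) (hY : IsLift v ψ w Y) {t : ℝ}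
    (ht : t ∈ Ico (0 : ℝ) 1) :
    HasDerivWithinAt (fun t => (fun j => X t j - Y t j : Fin 2 → ℝ))
      (fun j => v t (ψ t z) j - v t (ψ t w) j) (Ici t) t :=
  (coord_hasDerivWithinAt (hX.hasDeriv t ht)).sub (coord_hasDerivWithinAt (hY.hasDeriv t ht))

theorem IsLift.deriv_sub_le (hv : IsVelocityField L v) (hX : IsLift v ψ z X) (hY : IsLift v ψ w Y)
    {t : ℝ} (ht : t ∈ Ico (0 : ℝ) 1) :
    ‖(fun j => v t (ψ t z) j - v t (ψ t w) j : Fin 2 → ℝ)‖ ≤ L * ‖fun j => X t j - Y t j‖ := by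
  have h1 := pi_norm_coord_le (v t (ψ t z) - v t (ψ t w))
  have h2 := (hv.lipschitz t ht).dist_le_mul (ψ t z) (ψ t w)
  rw [dist_eq_norm] at h2
  have ht' := Ico_subset_Icc_self ht
  have h3 := dist_proj_le (X t) (Y t)
  rw [hX.proj_eq t ht', hY.proj_eq t ht'] at h3
  exact h1.trans (h2.trans (mul_le_mul_of_nonneg_left h3 L.coe_nonneg))

theorem IsLift.forward (hv : IsVelocityField L v) (hX : IsLift v ψ z X) (hY : IsLift v ψ w Y)
    {s t : ℝ} (hs : 0 ≤ s) (hst : s ≤ t) (ht : t ≤ 1) :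
    ‖fun j => X t j - Y t j‖ ≤ ‖fun j => X s j - Y s j‖ * Real.exp (L * (t - s)) := by
  have h := norm_le_gronwallBound_of_norm_deriv_right_le (δ := ‖fun j => X s j - Y s j‖)
    (K := L) (ε := 0) (a := s) (b := t)
    ((hX.sub_continuousOn hY).mono (Icc_subset_Icc hs ht))
    (fun r hr => hX.sub_hasDeriv hY ⟨hs.trans hr.1, hr.2.trans_le ht⟩) le_rfl
    (fun r hr => by
      rw [add_zero]; exact hX.deriv_sub_le hv hY ⟨hs.trans hr.1, hr.2.trans_le ht⟩) t ⟨hst, le_rfl⟩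
  rwa [gronwallBound_ε0] at h

/-- Grönwall's inequality backwards in time. Only right derivatives are available, so it is
obtained from the forward inequality for `-‖X - Y‖` with the negative constant `-L`. -/
theorem IsLift.backward (hv : IsVelocityField L v) (hX : IsLift v ψ z X) (hY : IsLift v ψ w Y)
    {s t : ℝ} (hs : 0 ≤ s) (hst : s ≤ t) (ht : t ≤ 1) :
    ‖fun j => X s j - Y s j‖ ≤ ‖fun j => X t j - Y t j‖ * Real.exp (L * (t - s)) := by
  set W : ℝ → Fin 2 → ℝ := fun t => (fun j => X t j - Y t j) with hW
  have hc : ContinuousOn W (Icc s t) := (hX.sub_continuousOn hY).mono (Icc_subset_Icc hs ht)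
  have h := le_gronwallBound_of_liminf_deriv_right_le (f := fun r => -‖W r‖)
    (f' := fun r => L * ‖W r‖) (δ := -‖W s‖) (K := -L) (ε := 0) (a := s) (b := t)
    hc.norm.neg ?_ le_rfl (fun r _ => by simp) t ⟨hst, le_rfl⟩
  · rw [gronwallBound_ε0] at h
    have h1 : ‖W s‖ * Real.exp (-L * (t - s)) ≤ ‖W t‖ := by linarith
    have h2 : Real.exp (-L * (t - s)) * Real.exp (L * (t - s)) = 1 := by
      rw [← Real.exp_add]; simp
    calc ‖W s‖ = ‖W s‖ * Real.exp (-L * (t - s)) * Real.exp (L * (t - s)) := by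
          rw [mul_assoc, h2, mul_one]
      _ ≤ _ := mul_le_mul_of_nonneg_right h1 (Real.exp_nonneg _)
  · intro r hr q hq
    have hr' : r ∈ Ico (0 : ℝ) 1 := ⟨hs.trans hr.1, hr.2.trans_le ht⟩
    have hd := hX.sub_hasDeriv hY hr'
    have hd1 := hasDerivWithinAt_iff_tendsto_slope.1 hd
    rw [Ici_sdiff_left] at hd1
    have hlim := hd1.norm
    have hlt : ‖(fun j => v r (ψ r z) j - v r (ψ r w) j : Fin 2 → ℝ)‖ < q :=
      (hX.deriv_sub_le hv hY hr').trans_lt hq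
    have hev := (hlim.eventually_lt_const hlt)
    refine Eventually.frequently ?_
    filter_upwards [hev, self_mem_nhdsWithin] with x hx hx0
    have hx0' : 0 < x - r := sub_pos.2 hx0
    refine lt_of_le_of_lt ?_ hx
    rw [slope_def_module, norm_smul, norm_inv, Real.norm_of_nonneg hx0'.le]
    refine mul_le_mul_of_nonneg_left ?_ (by positivity)
    have := norm_sub_norm_le (W r) (W x)
    rw [norm_sub_rev] at this
    linarith

/-- The displacement between two nearby times is Lipschitz with a small constant. -/
theorem IsLift.displacement (hv : IsVelocityField L v) (hX : IsLift v ψ z X) (hY : IsLift v ψ w Y)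
    {s t : ℝ} (hs : 0 ≤ s) (hst : s ≤ t) (ht : t ≤ 1) :
    ‖(fun j => X t j - Y t j : Fin 2 → ℝ) - fun j => X s j - Y s j‖ ≤
      L * Real.exp L * (t - s) * ‖fun j => X s j - Y s j‖ := by
  have h := norm_image_sub_le_of_norm_deriv_right_le_segment
    (f := fun t => (fun j => X t j - Y t j : Fin 2 → ℝ)) (a := s) (b := t)
    (C := L * (‖fun j => X s j - Y s j‖ * Real.exp L))
    ((hX.sub_continuousOn hY).mono (Icc_subset_Icc hs ht))
    (fun r hr => hX.sub_hasDeriv hY ⟨hs.trans hr.1, hr.2.trans_le ht⟩)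
    (fun r hr => by
      refine (hX.deriv_sub_le hv hY ⟨hs.trans hr.1, hr.2.trans_le ht⟩).trans ?_
      refine mul_le_mul_of_nonneg_left ((hX.forward hv hY hs hr.1 (hr.2.le.trans ht)).trans ?_)
        L.coe_nonneg
      refine mul_le_mul_of_nonneg_left (Real.exp_le_exp.2 ?_) (norm_nonneg _)
      refine mul_le_of_le_one_right L.coe_nonneg ?_
      linarith [hr.2]) t ⟨hst, le_rfl⟩
  refine h.trans (le_of_eq ?_)
  ring

end

/-- Two trajectories separate and approach at most exponentially; `t < s` is allowed. -/
theorem dist_flow_le (hv : IsVelocityField L v) (hψ : IsFlowMap v ψ) {s t : ℝ}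
    (hs : s ∈ Icc (0 : ℝ) 1) (ht : t ∈ Icc (0 : ℝ) 1) (z w : Torus2) :
    dist (ψ t z) (ψ t w) ≤ Real.exp (L * |t - s|) * dist (ψ s z) (ψ s w) := by
  obtain ⟨X, hX⟩ := hψ.exists_lift z
  obtain ⟨Y, hY, h1⟩ := hψ.exists_lifts z w hs hX
  have h2 := dist_proj_le (X t) (Y t)
  rw [hX.proj_eq t ht, hY.proj_eq t ht] at h2
  rw [← h1, mul_comm]
  refine h2.trans ?_
  rcases le_total s t with h | h
  · rw [abs_of_nonneg (sub_nonneg.2 h)]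
    exact hX.forward hv hY hs.1 h ht.2
  · rw [abs_of_nonpos (sub_nonpos.2 h), neg_sub]
    exact hX.backward hv hY ht.1 h hs.2

theorem exists_dist_flow_le (hv : IsVelocityField L v) (hψ : IsFlowMap v ψ) :
    ∃ M : ℝ, 0 ≤ M ∧ (∀ t ∈ Ico (0 : ℝ) 1, ∀ z, ‖v t z‖ ≤ M) ∧
      ∀ s ∈ Icc (0 : ℝ) 1, ∀ t ∈ Icc (0 : ℝ) 1, ∀ z, dist (ψ t z) (ψ s z) ≤ M * |t - s| := by
  obtain ⟨M, hM⟩ := hv.bounded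
  have hM0 : 0 ≤ M := (norm_nonneg _).trans (hM 0 ⟨le_rfl, zero_lt_one⟩ 0)
  have key : ∀ s t : ℝ, 0 ≤ s → s ≤ t → t ≤ 1 → ∀ z, dist (ψ t z) (ψ s z) ≤ M * (t - s) := by
    intro s t hs hst ht z
    obtain ⟨X, hX⟩ := hψ.exists_lift z
    have h := norm_image_sub_le_of_norm_deriv_right_le_segment (f := X) (a := s) (b := t) (C := M)
      (hX.continuousOn.mono (Icc_subset_Icc hs ht))
      (fun r hr => hX.hasDeriv r ⟨hs.trans hr.1, hr.2.trans_le ht⟩)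
      (fun r hr => hM r ⟨hs.trans hr.1, hr.2.trans_le ht⟩ _) t ⟨hst, le_rfl⟩
    have h2 := dist_proj_le (X t) (X s)
    rw [hX.proj_eq t ⟨hs.trans hst, ht⟩, hX.proj_eq s ⟨hs, hst.trans ht⟩] at h2
    exact h2.trans ((pi_norm_coord_le (X t - X s)).trans h)
  refine ⟨M, hM0, hM, fun s hs t ht z => ?_⟩
  rcases le_total s t with h | h
  · rw [abs_of_nonneg (sub_nonneg.2 h)]
    exact key s t hs.1 h ht.2 z
  · rw [abs_of_nonpos (sub_nonpos.2 h), neg_sub, dist_comm]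
    exact key t s ht.1 h hs.2 z

theorem flow_injective (hv : IsVelocityField L v) (hψ : IsFlowMap v ψ) {t : ℝ}
    (ht : t ∈ Icc (0 : ℝ) 1) : Function.Injective (ψ t) := by
  intro z w h
  have h1 := dist_flow_le hv hψ (s := t) (t := 0) ht ⟨le_rfl, zero_le_one⟩ z w
  rw [h, dist_self, mul_zero, (hψ z).1, (hψ w).1] at h1
  exact dist_le_zero.1 h1

/-- If the flow is onto at time `s`, it is onto at all slightly later times: the displacement
between the two times is a contraction, and a preimage is a fixed point. -/
theorem flow_surjective_step (hv : IsVelocityField L v) (hψ : IsFlowMap v ψ) {s t : ℝ}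
    (hs : 0 ≤ s) (hst : s ≤ t) (ht : t ≤ 1) (hsmall : L * Real.exp L * (t - s) ≤ 1 / 2)
    (h : Function.Surjective (ψ s)) : Function.Surjective (ψ t) := by
  have hs1 : s ∈ Icc (0 : ℝ) 1 := ⟨hs, hst.trans ht⟩
  have ht1 : t ∈ Icc (0 : ℝ) 1 := ⟨hs.trans hst, ht⟩
  choose y hy using h
  choose X hX using fun z => hψ.exists_lift (y z)
  intro p
  set d : Torus2 → Fin 2 → ℝ := fun z j => X z t j - X z s j with hd
  have hproj : ∀ z, ψ t (y z) = z + disp (d z) := by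
    intro z
    have h1 := (hX z).proj_eq t ht1
    have h2 := (hX z).proj_eq s hs1
    rw [hy] at h2
    have h3 : z + disp (d z) = proj (X z s) + disp (d z) := by rw [h2]
    rw [← h1, h3]
    ext j; simp [proj, disp, hd]
  have hcontr : ContractingWith (1 / 2) fun z => p - disp (d z) := by
    refine ⟨by norm_num, LipschitzWith.of_dist_le_mul fun z w => ?_⟩
    obtain ⟨Y, hY, h3⟩ := hψ.exists_lifts (y z) (y w) hs1 (hX z)
    have h4 := (hX z).displacement hv hY hs hst ht
    rw [h3, hy, hy] at h4
    -- the displacement does not depend on the lift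
    have h5 : ∀ j, Y t j - Y s j = X w t j - X w s j := by
      have h6 : proj (Y s) = proj (X w s) := by rw [hY.proj_eq s hs1, (hX w).proj_eq s hs1]
      obtain ⟨k, hk⟩ := exists_int_of_proj_eq h6
      have hX' : IsLift v ψ (y w) fun r => X w r + WithLp.toLp 2 fun j => (k j : ℝ) :=
        ⟨(hX w).continuousOn.add continuousOn_const,
          fun r hr => by rw [proj_add_int, (hX w).proj_eq r hr],
          fun r hr => ((hX w).hasDeriv r hr).add_const _⟩
      have h7 := hY.forward hv hX' hs hst ht
      have h8 : (fun j => Y s j - (X w s + WithLp.toLp 2 fun j => (k j : ℝ)) j : Fin 2 → ℝ) =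
          0 := by
        ext j; simp [hk j]
      rw [h8, norm_zero, zero_mul] at h7
      have h9 := norm_le_zero_iff.1 h7
      intro j
      have h10 := congrFun h9 j
      have h11 := hk j
      simp at h10
      linarith
    rw [dist_sub_left]
    refine (dist_disp_le _ _).trans ?_
    have h12 : d z - d w = (fun j => X z t j - Y t j : Fin 2 → ℝ) - fun j => X z s j - Y s j := by
      ext j
      have := h5 j
      simp only [hd, Pi.sub_apply]
      linarith
    rw [h12]
    refine h4.trans ?_
    have := mul_le_mul_of_nonneg_right hsmall (dist_nonneg (x := z) (y := w))
    simpa using this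
  have hfix := hcontr.fixedPoint_isFixedPt
  set z := ContractingWith.fixedPoint _ hcontr
  refine ⟨y z, ?_⟩
  rw [hproj]
  have h1 : p - disp (d z) = z := hfix
  rw [← h1]
  nth_rewrite 2 [h1]
  rw [sub_add_cancel]

theorem flow_surjective (hv : IsVelocityField L v) (hψ : IsFlowMap v ψ) {t : ℝ}
    (ht : t ∈ Icc (0 : ℝ) 1) : Function.Surjective (ψ t) := by
  obtain ⟨N, hN⟩ := exists_nat_gt (2 * (L * Real.exp L))
  have hN0 : (0 : ℝ) < N := lt_of_le_of_lt (by positivity) hN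
  have key : ∀ n : ℕ, ∀ r ∈ Icc (0 : ℝ) 1, r ≤ n / N → Function.Surjective (ψ r) := by
    intro n
    induction n with
    | zero =>
      intro r hr h
      have : r = 0 := le_antisymm (by simpa using h) hr.1
      subst this
      exact fun z => ⟨z, (hψ z).1⟩
    | succ n ih =>
      intro r hr h
      rcases le_total r (n / N) with h1 | h1
      · exact ih r hr h1
      · have h0 : (0 : ℝ) ≤ n / N := by positivity
        refine flow_surjective_step hv hψ h0 h1 hr.2 ?_ (ih _ ⟨h0, h1.trans hr.2⟩ le_rfl)
        have h2 : r - n / N ≤ 1 / N := by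
          have : ((n + 1 : ℕ) : ℝ) / N = n / N + 1 / N := by push_cast; ring
          linarith
        calc L * Real.exp L * (r - n / N) ≤ L * Real.exp L * (1 / N) :=
              mul_le_mul_of_nonneg_left h2 (by positivity)
          _ ≤ 1 / 2 := by rw [mul_one_div, div_le_iff₀ hN0]; linarith
  exact key N t ht (by rw [div_self hN0.ne']; exact ht.2)

/-- The flow from time `s` to time `t`, in either direction of time. -/
def flowBetween (ψ : ℝ → Torus2 → Torus2) (s t : ℝ) (z : Torus2) : Torus2 :=
  ψ t (Function.invFun (ψ s) z)

section flowBetween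

variable (hv : IsVelocityField L v) (hψ : IsFlowMap v ψ)
include hv hψ

theorem flow_invFun {s : ℝ} (hs : s ∈ Icc (0 : ℝ) 1) (z : Torus2) :
    ψ s (Function.invFun (ψ s) z) = z :=
  Function.rightInverse_invFun (flow_surjective hv hψ hs) z

theorem invFun_flow {s : ℝ} (hs : s ∈ Icc (0 : ℝ) 1) (z : Torus2) :
    Function.invFun (ψ s) (ψ s z) = z :=
  Function.leftInverse_invFun (flow_injective hv hψ hs) z

theorem flowBetween_self {s : ℝ} (hs : s ∈ Icc (0 : ℝ) 1) (z : Torus2) :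
    flowBetween ψ s s z = z := flow_invFun hv hψ hs z

theorem flowBetween_trans {r s t : ℝ} (hs : s ∈ Icc (0 : ℝ) 1) (z : Torus2) :
    flowBetween ψ s t (flowBetween ψ r s z) = flowBetween ψ r t z := by
  simp only [flowBetween, invFun_flow hv hψ hs]

theorem flowBetween_flow {s t : ℝ} (hs : s ∈ Icc (0 : ℝ) 1) (z : Torus2) :
    flowBetween ψ s t (ψ s z) = ψ t z := by
  simp only [flowBetween, invFun_flow hv hψ hs]

theorem flowBetween_symm {s t : ℝ} (hs : s ∈ Icc (0 : ℝ) 1) (ht : t ∈ Icc (0 : ℝ) 1) (z : Torus2) :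
    flowBetween ψ t s (flowBetween ψ s t z) = z := by
  rw [flowBetween_trans hv hψ ht, flowBetween_self hv hψ hs]

theorem flowBetween_zero_left {t : ℝ} (z : Torus2) : flowBetween ψ 0 t z = ψ t z := by
  have := flowBetween_flow hv hψ (s := 0) (t := t) ⟨le_rfl, zero_le_one⟩ z
  rwa [(hψ z).1] at this

omit hv in
theorem flowBetween_zero_right {t : ℝ} (z : Torus2) :
    flowBetween ψ t 0 z = Function.invFun (ψ t) z := (hψ _).1

theorem lipschitz_flowBetween {s t : ℝ} (hs : s ∈ Icc (0 : ℝ) 1) (ht : t ∈ Icc (0 : ℝ) 1) :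
    LipschitzWith (Real.toNNReal (Real.exp (L * |t - s|))) (flowBetween ψ s t) := by
  refine LipschitzWith.of_dist_le_mul fun z w => ?_
  rw [Real.coe_toNNReal _ (Real.exp_nonneg _)]
  have := dist_flow_le hv hψ hs ht (Function.invFun (ψ s) z) (Function.invFun (ψ s) w)
  rwa [flow_invFun hv hψ hs, flow_invFun hv hψ hs] at this

/-- A Lipschitz constant of the flow that does not depend on the two times. -/
theorem lipschitz_flowBetween_exp {s t : ℝ} (hs : s ∈ Icc (0 : ℝ) 1) (ht : t ∈ Icc (0 : ℝ) 1) :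
    LipschitzWith (Real.toNNReal (Real.exp L)) (flowBetween ψ s t) := by
  refine (lipschitz_flowBetween hv hψ hs ht).weaken (Real.toNNReal_le_toNNReal ?_)
  refine Real.exp_le_exp.2 (mul_le_of_le_one_right L.coe_nonneg ?_)
  rw [abs_le]
  constructor <;> linarith [hs.1, hs.2, ht.1, ht.2]

theorem continuous_flowBetween {s t : ℝ} (hs : s ∈ Icc (0 : ℝ) 1) (ht : t ∈ Icc (0 : ℝ) 1) :
    Continuous (flowBetween ψ s t) := (lipschitz_flowBetween hv hψ hs ht).continuous

theorem continuous_flow {t : ℝ} (ht : t ∈ Icc (0 : ℝ) 1) : Continuous (ψ t) := by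
  have : flowBetween ψ 0 t = ψ t := funext fun z => flowBetween_zero_left hv hψ z
  rw [← this]
  exact continuous_flowBetween hv hψ ⟨le_rfl, zero_le_one⟩ ht

end flowBetween

/-! ### Lipschitz maps and the Haar measure of the torus -/

section Hausdorff

open scoped MeasureTheory ENNReal

theorem hausdorffMeasure_plane : (μH[2] : Measure (Fin 2 → ℝ)) = volume := by
  have := hausdorffMeasure_pi_real (ι := Fin 2)
  simpa using this

theorem hausdorffMeasure_torus_ne_top : (μH[2] : Measure Torus2) univ ≠ ⊤ := by
  have h1 : (univ : Set Torus2) ⊆ disp '' (Icc 0 1) := by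
    intro z _
    refine ⟨fun j => AddCircle.equivIco 1 0 (z j), ⟨fun j => ?_, fun j => ?_⟩, ?_⟩
    · exact (AddCircle.equivIco 1 0 (z j)).2.1
    · have := (AddCircle.equivIco (1 : ℝ) 0 (z j)).2.2.le
      simpa using this
    · ext j
      exact (AddCircle.equivIco 1 0).symm_apply_apply (z j)
  have h2 : LipschitzWith 1 disp := LipschitzWith.of_dist_le_mul fun a b => by
    rw [NNReal.coe_one, one_mul, dist_eq_norm a b]
    exact dist_disp_le a b
  have h3 := h2.hausdorffMeasure_image_le (d := 2) (by norm_num) (Icc 0 1)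
  rw [hausdorffMeasure_plane] at h3
  refine ne_top_of_le_ne_top ?_ ((measure_mono h1).trans h3)
  simp [isCompact_Icc.measure_lt_top.ne]

/-- The projection is isometric on a small square, whose area is positive. -/
theorem hausdorffMeasure_torus_ne_zero : (μH[2] : Measure Torus2) ≠ 0 := by
  intro h0
  set S : Set (Fin 2 → ℝ) := Icc 0 (fun _ => 1 / 4) with hS
  have hdist : ∀ a ∈ S, ∀ b ∈ S, dist a b ≤ dist (disp a) (disp b) := by
    intro a ha b hb
    rw [dist_eq_norm]
    refine (pi_norm_le_iff_of_nonneg dist_nonneg).2 fun j => ?_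
    have h1 : ‖((a j - b j : ℝ) : UnitAddCircle)‖ = |a j - b j| := by
      rw [AddCircle.norm_coe_eq_abs_iff 1 one_ne_zero, abs_one, abs_le]
      have := ha.1 j; have := ha.2 j; have := hb.1 j; have := hb.2 j
      simp only [Pi.zero_apply] at *
      constructor <;> linarith
    rw [Pi.sub_apply, Real.norm_eq_abs, ← h1, AddCircle.coe_sub, ← dist_eq_norm]
    exact dist_le_pi_dist (disp a) (disp b) j
  have hinj : InjOn disp S := fun a ha b hb h => by
    have := hdist a ha b hb
    rw [h, dist_self] at this
    exact dist_le_zero.1 this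
  have hinv : LipschitzOnWith 1 (Function.invFunOn disp S) (disp '' S) := by
    refine LipschitzOnWith.of_dist_le_mul ?_
    rintro _ ⟨a, ha, rfl⟩ _ ⟨b, hb, rfl⟩
    rw [NNReal.coe_one, one_mul, hinj.leftInvOn_invFunOn ha, hinj.leftInvOn_invFunOn hb]
    exact hdist a ha b hb
  have h1 := hinv.hausdorffMeasure_image_le (d := 2) (by norm_num)
  rw [hinj.leftInvOn_invFunOn.image_image, h0, hausdorffMeasure_plane, hS, Real.volume_Icc_pi] at h1
  simp at h1

/-- The Haar measure is a multiple of the Hausdorff measure of dimension two, for which this is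
immediate. -/
theorem measure_image_le_of_lipschitz {K : ℝ≥0} {R : Torus2 → Torus2} (hR : LipschitzWith K R)
    (s : Set Torus2) : torusMeasure (R '' s) ≤ (K : ℝ≥0∞) ^ 2 * torusMeasure s := by
  have : IsFiniteMeasure (μH[2] : Measure Torus2) :=
    ⟨lt_top_iff_ne_top.2 hausdorffMeasure_torus_ne_top⟩
  have h1 := Measure.isAddInvariant_eq_smul_of_compactSpace (μH[2] : Measure Torus2) torusMeasure
  set c := Measure.addHaarScalarFactor (μH[2] : Measure Torus2) torusMeasure
  have hc : c ≠ 0 := by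
    intro hc
    rw [hc, zero_smul] at h1
    exact hausdorffMeasure_torus_ne_zero h1
  have h2 := hR.hausdorffMeasure_image_le (d := 2) (by norm_num) s
  rw [h1] at h2
  simp only [Measure.smul_apply, ENNReal.rpow_ofNat] at h2
  rw [ENNReal.smul_def, ENNReal.smul_def, smul_eq_mul, smul_eq_mul, mul_left_comm] at h2
  exact (ENNReal.mul_le_mul_iff_right (by simpa using hc) ENNReal.coe_ne_top).1 h2

end Hausdorff

/-! ### Density of trigonometric polynomials -/

theorem IsSmooth.add {f g : Torus2 → ℝ} (hf : IsSmooth f) (hg : IsSmooth g) : IsSmooth (f + g) :=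
  ContDiff.add hf hg

theorem IsSmooth.mul {f g : Torus2 → ℝ} (hf : IsSmooth f) (hg : IsSmooth g) : IsSmooth (f * g) :=
  ContDiff.mul hf hg

theorem IsSmooth.const_smul {f : Torus2 → ℝ} (hf : IsSmooth f) (c : ℝ) : IsSmooth (c • f) :=
  ContDiff.const_smul c hf

theorem isSmooth_const (c : ℝ) : IsSmooth fun _ => c := contDiff_const

theorem isSmooth_trunc (F : Finset Mode) (g : L2) : IsSmooth (trunc F g) := by
  have : (fun y : Plane => trunc F g (proj y)) =
      fun y => ∑ i ∈ F, inner ℝ (trigL2 i) g • trig i (proj y) := by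
    ext y; simp [trunc]
  rw [IsSmooth, this]
  exact ContDiff.sum fun i _ => (isSmooth_trig i).const_smul _

/-- Smooth functions with a gradient are uniformly dense in the continuous functions. -/
theorem exists_smooth_near (Φ : C(Torus2, ℝ)) {ε : ℝ} (hε : 0 < ε) :
    ∃ (g : C(Torus2, ℝ)) (Γ : Fin 2 → C(Torus2, ℝ)), HasGrad g Γ ∧ IsSmooth g ∧
      ∀ z, |Φ z - g z| ≤ ε := by
  let Good : (Torus2 → ℝ) → Prop := fun f =>
    ∃ (g : C(Torus2, ℝ)) (Γ : Fin 2 → C(Torus2, ℝ)), HasGrad g Γ ∧ IsSmooth g ∧ f = g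
  have hadd : ∀ f g, Good f → Good g → Good (f + g) := by
    rintro _ _ ⟨g, Γ, h1, h2, rfl⟩ ⟨h, Δ, h3, h4, rfl⟩
    exact ⟨g + h, Γ + Δ, h1.add h3, h2.add h4, rfl⟩
  have hsmul : ∀ (c : ℝ) f, Good f → Good (c • f) := by
    rintro c _ ⟨g, Γ, h1, h2, rfl⟩
    exact ⟨c • g, c • Γ, h1.smul c, h2.const_smul c, rfl⟩
  have hspan : ∀ p ∈ Submodule.span ℂ (range (mFourier (d := Fin 2))),
      Good (fun z => (p z).re) ∧ Good (fun z => (p z).im) := by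
    intro p hp
    induction hp using Submodule.span_induction with
    | mem x hx =>
      obtain ⟨k, rfl⟩ := hx
      exact ⟨⟨_, _, hasGrad_trig (k, false), isSmooth_trig _, rfl⟩,
        ⟨_, _, hasGrad_trig (k, true), isSmooth_trig _, rfl⟩⟩
    | zero => exact ⟨⟨0, 0, hasGrad_zero, isSmooth_const 0, rfl⟩,
        ⟨0, 0, hasGrad_zero, isSmooth_const 0, rfl⟩⟩
    | add x y _ _ hx hy => exact ⟨hadd _ _ hx.1 hy.1, hadd _ _ hx.2 hy.2⟩
    | smul a x _ hx =>
      refine ⟨?_, ?_⟩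
      · convert! hadd _ _ (hsmul a.re _ hx.1) (hsmul (-a.im) _ hx.2) using 1
        ext z
        simp [Complex.mul_re]; ring
      · convert! hadd _ _ (hsmul a.re _ hx.2) (hsmul a.im _ hx.1) using 1
  set Φc : C(Torus2, ℂ) := ⟨fun z => (Φ z : ℂ), by fun_prop⟩ with hΦc
  have hmem : Φc ∈ closure (Submodule.span ℂ (range (mFourier (d := Fin 2))) :
      Set C(Torus2, ℂ)) := by
    have h1 := span_mFourier_closure_eq_top (d := Fin 2)
    have h2 : Φc ∈ (Submodule.span ℂ (range (mFourier (d := Fin 2)))).topologicalClosure := by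
      rw [h1]; trivial
    exact h2
  obtain ⟨p, hp, hdist⟩ := Metric.mem_closure_iff.1 hmem ε hε
  obtain ⟨⟨g, Γ, h1, h2, h3⟩, -⟩ := hspan p hp
  refine ⟨g, Γ, h1, h2, fun z => ?_⟩
  have h4 : ‖Φc z - p z‖ ≤ ε := by
    rw [← dist_eq_norm]
    exact (ContinuousMap.dist_apply_le_dist z).trans hdist.le
  have h5 : Φ z - g z = (Φc z - p z).re := by
    rw [← congrFun h3 z]; simp [hΦc]
  rw [h5]
  exact (Complex.abs_re_le_norm _).trans h4

/-! ### Flows of divergence-free fields preserve the measure -/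

variable {L : ℝ≥0} {v : ℝ → Torus2 → Plane} {ψ : ℝ → Torus2 → Torus2}
variable {g : C(Torus2, ℝ)} {Γ : Fin 2 → C(Torus2, ℝ)}

theorem tendsto_slope_flow (hψ : IsFlowMap v ψ) (hg : HasGrad g Γ) {s : ℝ}
    (hs : s ∈ Ico (0 : ℝ) 1) (z : Torus2) :
    Tendsto (slope (fun r => g (ψ r z)) s) (𝓝[>] s)
      (𝓝 (∑ j, v s (ψ s z) j * Γ j (ψ s z))) := by
  obtain ⟨X, hX⟩ := hψ.exists_lift z
  have h1 := hg.hasDerivWithinAt_comp (hX.hasDeriv s hs)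
  rw [hX.proj_eq s (Ico_subset_Icc_self hs), hasDerivWithinAt_iff_tendsto_slope,
    Ici_sdiff_left] at h1
  refine h1.congr' ?_
  have h2 : Ioo s 1 ∈ 𝓝[>] s := Ioo_mem_nhdsGT hs.2
  filter_upwards [h2] with r hr
  simp only [slope, vsub_eq_sub]
  rw [hX.proj_eq s (Ico_subset_Icc_self hs), hX.proj_eq r ⟨hs.1.trans hr.1.le, hr.2.le⟩]

theorem abs_slope_flow_le {K : ℝ≥0} (hK : ∀ z w : Torus2, |g z - g w| ≤ K * dist z w) {M : ℝ}
    (hM : ∀ s ∈ Icc (0 : ℝ) 1, ∀ t ∈ Icc (0 : ℝ) 1, ∀ z, dist (ψ t z) (ψ s z) ≤ M * |t - s|)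
    {s t : ℝ} (hs : s ∈ Icc (0 : ℝ) 1) (ht : t ∈ Icc (0 : ℝ) 1) (z : Torus2) (hst : s < t) :
    |slope (fun r => g (ψ r z)) s t| ≤ K * M := by
  have h0 : 0 < t - s := sub_pos.2 hst
  rw [slope_def_field, abs_div, abs_of_pos h0, div_le_iff₀ h0, mul_assoc]
  refine (hK _ _).trans (mul_le_mul_of_nonneg_left ?_ K.coe_nonneg)
  have := hM s hs t ht z
  rwa [abs_of_pos h0] at this

/-- The right derivative of `r ↦ ∫ g (ψ r (Y z)) θ(z)`. -/
theorem hasDerivWithinAt_integral_flow (hv : IsVelocityField L v) (hψ : IsFlowMap v ψ)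
    (hg : HasGrad g Γ) {θ : Torus2 → ℝ} (hθ : Integrable θ torusMeasure) {Y : Torus2 → Torus2}
    (hY : Continuous Y) {s : ℝ} (hs : s ∈ Ico (0 : ℝ) 1) :
    HasDerivWithinAt (fun r => ∫ z, g (ψ r (Y z)) * θ z ∂torusMeasure)
      (∫ z, (∑ j, v s (ψ s (Y z)) j * Γ j (ψ s (Y z))) * θ z ∂torusMeasure) (Ici s) s := by
  obtain ⟨K, hK⟩ := hg.exists_lipschitz
  obtain ⟨M, hM0, -, hM⟩ := exists_dist_flow_le hv hψ
  have hs' := Ico_subset_Icc_self hs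
  rw [hasDerivWithinAt_iff_tendsto_slope, Ici_sdiff_left]
  have hIoo : Ioo s 1 ∈ 𝓝[>] s := Ioo_mem_nhdsGT hs.2
  have hint : ∀ r ∈ Icc (0 : ℝ) 1, Integrable (fun z => g (ψ r (Y z)) * θ z) torusMeasure := by
    intro r hr
    have hc := continuous_flow hv hψ hr
    have := integrable_mul_continuous hθ ⟨fun z => g (ψ r (Y z)), by fun_prop⟩
    simpa [mul_comm] using this
  have h1 := tendsto_integral_filter_of_dominated_convergence (μ := torusMeasure)
    (l := 𝓝[>] s) (F := fun r z => slope (fun r => g (ψ r (Y z))) s r * θ z)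
    (f := fun z => (∑ j, v s (ψ s (Y z)) j * Γ j (ψ s (Y z))) * θ z)
    (fun z => K * M * |θ z|) ?_ ?_ (hθ.abs.const_mul _) ?_
  · refine h1.congr' ?_
    filter_upwards [hIoo] with r hr
    rw [slope_def_field, ← integral_sub (hint r ⟨hs.1.trans hr.1.le, hr.2.le⟩) (hint s hs'),
      ← integral_div]
    refine integral_congr_ae (Eventually.of_forall fun z => ?_)
    simp only [slope_def_field]
    ring
  · filter_upwards [hIoo] with r hr
    have hc := continuous_flow hv hψ (t := r) ⟨hs.1.trans hr.1.le, hr.2.le⟩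
    have hc' := continuous_flow hv hψ hs'
    refine AEStronglyMeasurable.mul ?_ hθ.aestronglyMeasurable
    simp only [slope_def_field]
    refine Continuous.aestronglyMeasurable ?_
    fun_prop
  · filter_upwards [hIoo] with r hr
    refine Eventually.of_forall fun z => ?_
    rw [norm_mul, Real.norm_eq_abs, Real.norm_eq_abs]
    exact mul_le_mul_of_nonneg_right
      (abs_slope_flow_le hK hM hs' ⟨hs.1.trans hr.1.le, hr.2.le⟩ (Y z) hr.1) (abs_nonneg _)
  · exact Eventually.of_forall fun z => (tendsto_slope_flow hψ hg hs (Y z)).mul_const _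

/-- The flow over a time `|t - s|` changes volumes at most by a factor close to one. -/
theorem map_flowBetween_le (hv : IsVelocityField L v) (hψ : IsFlowMap v ψ) {s t : ℝ}
    (hs : s ∈ Icc (0 : ℝ) 1) (ht : t ∈ Icc (0 : ℝ) 1) :
    torusMeasure.map (flowBetween ψ s t) ≤
      ENNReal.ofReal (Real.exp (L * |t - s|) ^ 2) • torusMeasure := by
  refine Measure.le_iff.2 fun A hA => ?_
  rw [Measure.map_apply (continuous_flowBetween hv hψ hs ht).measurable hA, Measure.smul_apply,
    smul_eq_mul]
  have h1 : flowBetween ψ s t ⁻¹' A = flowBetween ψ t s '' A := by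
    ext z
    constructor
    · intro hz
      exact ⟨_, hz, flowBetween_symm hv hψ hs ht z⟩
    · rintro ⟨w, hw, rfl⟩
      rw [mem_preimage, flowBetween_symm hv hψ ht hs]
      exact hw
  rw [h1, abs_sub_comm]
  refine (measure_image_le_of_lipschitz (lipschitz_flowBetween hv hψ ht hs) A).trans (le_of_eq ?_)
  congr 1
  rw [ENNReal.ofReal_pow (Real.exp_nonneg _)]
  rfl

/-- A map that expands volumes at most by the factor `K` changes the mean of a bounded function
by at most `2 (K - 1)` times a bound of the function. -/
theorem abs_integral_comp_sub_le {R : Torus2 → Torus2} (hR : Continuous R) {K : ℝ} (hK : 0 ≤ K)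
    (hmap : torusMeasure.map R ≤ ENNReal.ofReal K • torusMeasure) {Φ : Torus2 → ℝ}
    (hΦ : Continuous Φ) {η : ℝ} (hη : ∀ z, |Φ z| ≤ η) :
    |∫ z, Φ (R z) ∂torusMeasure - ∫ z, Φ z ∂torusMeasure| ≤ 2 * η * |K - 1| := by
  have hη0 : 0 ≤ η := (abs_nonneg _).trans (hη 0)
  have key : ∀ Φ : Torus2 → ℝ, Continuous Φ → (∀ z, |Φ z| ≤ η) →
      ∫ z, Φ (R z) ∂torusMeasure - ∫ z, Φ z ∂torusMeasure ≤ 2 * η * |K - 1| := by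
    intro Φ hΦ hη
    have hi : Integrable (fun z => Φ z + η) torusMeasure := integrable_of_continuous (by fun_prop)
    have h1 := integral_mono_measure (f := fun z => Φ z + η) hmap
      (Eventually.of_forall fun z => by
        have := (abs_le.1 (hη z)).1
        change (0 : ℝ) ≤ Φ z + η
        linarith)
      (hi.smul_measure ENNReal.ofReal_ne_top)
    rw [integral_map hR.measurable.aemeasurable (Continuous.aestronglyMeasurable (by fun_prop)),
      integral_smul_measure, ENNReal.toReal_ofReal hK, smul_eq_mul,
      integral_add (integrable_of_continuous (by fun_prop)) (integrable_const _),
      integral_add (integrable_of_continuous hΦ) (integrable_const _)] at h1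
    simp only [integral_const, probReal_univ, smul_eq_mul, one_mul] at h1
    have h2 : |∫ z, Φ z ∂torusMeasure| ≤ η := by
      have := norm_integral_le_of_norm_le_const (μ := torusMeasure) (f := Φ)
        (Eventually.of_forall hη)
      simpa using this
    have h3 := abs_le.1 h2
    have h4 : (K - 1) * (∫ z, Φ z ∂torusMeasure + η) ≤ |K - 1| * (2 * η) := by
      refine (mul_le_mul_of_nonneg_right (le_abs_self _) (by linarith)).trans ?_
      exact mul_le_mul_of_nonneg_left (by linarith) (abs_nonneg _)
    nlinarith
  rw [abs_le]
  refine ⟨?_, key Φ hΦ hη⟩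
  have h1 := key (fun z => -Φ z) (by fun_prop) (fun z => by rw [abs_neg]; exact hη z)
  rw [integral_neg, integral_neg] at h1
  linarith

theorem HasGrad.integral_velocity (hg : HasGrad g Γ) (hs : IsSmooth g) {w : Torus2 → Plane}
    (hw : IsDivFree w) : ∫ z, ∑ j, w z j * Γ j z ∂torusMeasure = 0 := by
  rw [← hw g hs]
  exact integral_congr_ae (Eventually.of_forall fun z => (hg.grad_eq z _).symm)

theorem abs_exp_sq_sub_one_le {h : ℝ} (h0 : 0 ≤ h) (h1 : h ≤ 1) (L : ℝ≥0) :
    |Real.exp (L * h) ^ 2 - 1| ≤ 2 * L * Real.exp (2 * L) * h := by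
  have e1 : Real.exp (L * h) ^ 2 = Real.exp (2 * L * h) := by
    rw [← Real.exp_nat_mul]; congr 1; push_cast; ring
  have e2 : (1 : ℝ) ≤ Real.exp (2 * L * h) := Real.one_le_exp (by positivity)
  rw [e1, abs_of_nonneg (by linarith)]
  have e3 : 1 - 2 * L * h ≤ Real.exp (-(2 * L * h)) := by
    have := Real.add_one_le_exp (-(2 * L * h)); linarith
  have e4 : Real.exp (-(2 * L * h)) * Real.exp (2 * L * h) = 1 := by rw [← Real.exp_add]; simp
  have e5 : Real.exp (2 * L * h) - 1 ≤ 2 * L * h * Real.exp (2 * L * h) := by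
    nlinarith [Real.exp_pos (2 * L * h)]
  have e6 : Real.exp (2 * L * h) ≤ Real.exp (2 * L) :=
    Real.exp_le_exp.2 (mul_le_of_le_one_right (by positivity) h1)
  calc _ ≤ _ := e5
    _ ≤ 2 * L * h * Real.exp (2 * L) := mul_le_mul_of_nonneg_left e6 (by positivity)
    _ = _ := by ring

/-- The mean of `φ ∘ flowBetween ψ s t` has zero right derivative in `s`. As `φ` transported by the
flow is merely continuous, it is approximated by smooth functions; the errors are controlled by the
Lipschitz bound on volumes. -/
theorem hasDerivWithinAt_mean_flowBetween (hv : IsVelocityField L v) (hψ : IsFlowMap v ψ)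
    (φ : C(Torus2, ℝ)) {s t : ℝ} (hs : 0 ≤ s) (hst : s < t) (ht : t ≤ 1) :
    HasDerivWithinAt (fun r => ∫ z, φ (flowBetween ψ r t z) ∂torusMeasure) 0 (Ici s) s := by
  obtain ⟨M, hM0, -, hM⟩ := exists_dist_flow_le hv hψ
  have hs1 : s ∈ Icc (0 : ℝ) 1 := ⟨hs, hst.le.trans ht⟩
  have ht1 : t ∈ Icc (0 : ℝ) 1 := ⟨hs.trans hst.le, ht⟩
  rw [hasDerivWithinAt_iff_tendsto_slope, Ici_sdiff_left, Metric.tendsto_nhds]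
  intro ε hε
  set C : ℝ := 4 * (2 * L * Real.exp (2 * L)) with hC
  have hC0 : 0 ≤ C := by positivity
  set η : ℝ := ε / (2 * (C + 1)) with hη
  have hη0 : 0 < η := by positivity
  obtain ⟨g, Γ, hg, hgs, hgΦ⟩ := exists_smooth_near
    ⟨fun z => φ (flowBetween ψ s t z), φ.continuous.comp (continuous_flowBetween hv hψ hs1 ht1)⟩ hη0
  simp only [ContinuousMap.coe_mk] at hgΦ
  -- the smooth approximation has zero derivative, because the field is divergence free
  have hsm := hasDerivWithinAt_integral_flow hv hψ hg (θ := fun _ => 1) (integrable_const _)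
    (Y := Function.invFun (ψ s)) (by
      have := continuous_flowBetween hv hψ hs1 (t := 0) ⟨le_rfl, zero_le_one⟩
      refine this.congr fun z => flowBetween_zero_right hψ z) ⟨hs, hst.trans_le ht⟩
  simp only [mul_one, flow_invFun hv hψ hs1] at hsm
  rw [hg.integral_velocity hgs (hv.divFree s ⟨hs, hst.trans_le ht⟩),
    hasDerivWithinAt_iff_tendsto_slope, Ici_sdiff_left, Metric.tendsto_nhds] at hsm
  have hsm' := hsm (ε / 2) (by positivity)
  -- the transported function is uniformly continuous in time
  obtain ⟨ρ, hρ, hφ⟩ := Metric.uniformContinuous_iff.1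
    (CompactSpace.uniformContinuous_of_continuous φ.continuous) η hη0
  have hnear : Ioo s (min t (s + ρ / (Real.exp L * (M + 1)))) ∈ 𝓝[>] s := by
    refine Ioo_mem_nhdsGT (lt_min hst ?_)
    have : 0 < ρ / (Real.exp L * (M + 1)) := by positivity
    linarith
  filter_upwards [hsm', hnear] with r hr1 hr2
  have hrt : r < t := hr2.2.trans_le (min_le_left _ _)
  have hr01 : r ∈ Icc (0 : ℝ) 1 := ⟨hs.trans hr2.1.le, hrt.le.trans ht⟩
  have hrs : 0 < r - s := sub_pos.2 hr2.1
  have hrρ : Real.exp L * (M * (r - s)) < ρ := by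
    have h1 := hr2.2.trans_le (min_le_right _ _)
    have h2 : r - s < ρ / (Real.exp L * (M + 1)) := by linarith
    rw [lt_div_iff₀ (by positivity)] at h2
    have := Real.exp_pos L
    nlinarith
  set Φ : Torus2 → ℝ := fun z => φ (flowBetween ψ r t z) - g z with hΦ
  have hΦc : Continuous Φ :=
    (φ.continuous.comp (continuous_flowBetween hv hψ hr01 ht1)).sub g.continuous
  have hΦb : ∀ z, |Φ z| ≤ 2 * η := by
    intro z
    have h1 : dist (flowBetween ψ r t z) (flowBetween ψ s t z) < ρ := by
      have h2 : flowBetween ψ s t z = flowBetween ψ r t (flowBetween ψ s r z) :=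
        (flowBetween_trans hv hψ hr01 z).symm
      rw [h2]
      refine lt_of_le_of_lt ((lipschitz_flowBetween_exp hv hψ hr01 ht1).dist_le_mul _ _) ?_
      rw [Real.coe_toNNReal _ (Real.exp_nonneg _)]
      refine lt_of_le_of_lt (mul_le_mul_of_nonneg_left ?_ (Real.exp_nonneg _)) hrρ
      have h3 := hM r hr01 s hs1 (Function.invFun (ψ s) z)
      rw [flow_invFun hv hψ hs1, abs_sub_comm, abs_of_pos hrs] at h3
      exact h3
    have h4 := (hφ h1).le
    rw [Real.dist_eq] at h4
    have h5 := hgΦ z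
    have h6 := abs_add_le (φ (flowBetween ψ r t z) - φ (flowBetween ψ s t z))
      (φ (flowBetween ψ s t z) - g z)
    rw [sub_add_sub_cancel] at h6
    linarith
  have hmain := abs_integral_comp_sub_le (continuous_flowBetween hv hψ hs1 hr01)
    (sq_nonneg _) (map_flowBetween_le hv hψ hs1 hr01) hΦc hΦb
  have hK := abs_exp_sq_sub_one_le hrs.le (by linarith [hr01.2]) L
  rw [abs_of_pos hrs] at hmain
  have hi1 : ∀ q ∈ Icc (0 : ℝ) 1, Integrable (fun z => φ (flowBetween ψ q t z)) torusMeasure :=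
    fun q hq => integrable_of_continuous (φ.continuous.comp (continuous_flowBetween hv hψ hq ht1))
  have hcg : Integrable (fun z => g (flowBetween ψ s r z)) torusMeasure :=
    integrable_of_continuous (g.continuous.comp (continuous_flowBetween hv hψ hs1 hr01))
  -- rewrite the increment through the flow from `s` to `r`
  have e1 : ∫ z, Φ (flowBetween ψ s r z) ∂torusMeasure =
      ∫ z, φ (flowBetween ψ s t z) ∂torusMeasure -
        ∫ z, g (flowBetween ψ s r z) ∂torusMeasure := by
    rw [← integral_sub (hi1 s hs1) hcg]
    refine integral_congr_ae (Eventually.of_forall fun z => ?_)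
    simp only [hΦ, flowBetween_trans hv hψ hr01]
  have e2 : ∫ z, Φ z ∂torusMeasure =
      ∫ z, φ (flowBetween ψ r t z) ∂torusMeasure - ∫ z, g z ∂torusMeasure :=
    integral_sub (hi1 r hr01) (continuous_integrable g)
  rw [Real.dist_eq, sub_zero, slope_def_field, abs_div, abs_of_pos hrs, div_lt_iff₀ hrs] at hr1 ⊢
  rw [e1, e2] at hmain
  have hg1 : ∫ z, g (ψ s (Function.invFun (ψ s) z)) ∂torusMeasure = ∫ z, g z ∂torusMeasure := by
    simp only [flow_invFun hv hψ hs1]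
  simp only [flow_invFun hv hψ hs1] at hr1
  change |∫ z, g (flowBetween ψ s r z) ∂torusMeasure - ∫ z, g z ∂torusMeasure| < _ at hr1
  set a := ∫ z, φ (flowBetween ψ s t z) ∂torusMeasure
  set b := ∫ z, φ (flowBetween ψ r t z) ∂torusMeasure
  set c := ∫ z, g (flowBetween ψ s r z) ∂torusMeasure
  set d := ∫ z, g z ∂torusMeasure
  have h7 : |b - a| ≤ |a - c - (b - d)| + |c - d| := by
    have := abs_add_le (-(a - c - (b - d))) (-(c - d))
    rw [abs_neg, abs_neg] at this
    convert! this using 2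
    ring
  have h8 : 2 * (2 * η) * |Real.exp (L * (r - s)) ^ 2 - 1| ≤ η * C * (r - s) := by
    calc _ ≤ 2 * (2 * η) * (2 * L * Real.exp (2 * L) * (r - s)) :=
          mul_le_mul_of_nonneg_left hK (by positivity)
      _ = _ := by rw [hC]; ring
  have h9 : η * C ≤ ε / 2 := by
    rw [hη, div_mul_eq_mul_div, div_le_iff₀ (by positivity)]
    nlinarith
  have h10 := mul_le_mul_of_nonneg_right h9 hrs.le
  linarith

theorem continuousOn_mean_flowBetween (hv : IsVelocityField L v) (hψ : IsFlowMap v ψ)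
    (φ : C(Torus2, ℝ)) {t : ℝ} (ht : t ∈ Icc (0 : ℝ) 1) :
    ContinuousOn (fun r => ∫ z, φ (flowBetween ψ r t z) ∂torusMeasure) (Icc 0 1) := by
  obtain ⟨M, hM0, -, hM⟩ := exists_dist_flow_le hv hψ
  intro s hs
  refine tendsto_integral_filter_of_dominated_convergence (fun _ => ‖φ‖) ?_ ?_
    (integrable_const _) ?_
  · filter_upwards [self_mem_nhdsWithin] with r hr
    exact (φ.continuous.comp (continuous_flowBetween hv hψ hr ht)).aestronglyMeasurable
  · exact Eventually.of_forall fun r => Eventually.of_forall fun z => φ.norm_coe_le_norm _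
  · refine Eventually.of_forall fun z => (φ.continuous.tendsto _).comp ?_
    rw [tendsto_iff_dist_tendsto_zero]
    have h1 : Tendsto (fun r => Real.exp L * (M * |s - r|)) (𝓝[Icc 0 1] s) (𝓝 0) := by
      have : Tendsto (fun r => Real.exp L * (M * |s - r|)) (𝓝 s)
          (𝓝 (Real.exp L * (M * |s - s|))) := by apply Continuous.tendsto; fun_prop
      simp only [sub_self, abs_zero, mul_zero] at this
      exact this.mono_left nhdsWithin_le_nhds
    refine squeeze_zero' (Eventually.of_forall fun _ => dist_nonneg) ?_ h1
    filter_upwards [self_mem_nhdsWithin] with r hr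
    rw [← flowBetween_trans hv hψ hr (r := s) z]
    refine ((lipschitz_flowBetween_exp hv hψ hr ht).dist_le_mul _ _).trans ?_
    rw [Real.coe_toNNReal _ (Real.exp_nonneg _)]
    refine mul_le_mul_of_nonneg_left ?_ (Real.exp_nonneg _)
    have h3 := hM r hr s hs (Function.invFun (ψ s) z)
    rwa [flow_invFun hv hψ hs] at h3

/-- The mean of `φ ∘ flowBetween ψ s t` does not depend on `s ∈ [0, t]`; compare `s = 0` and
`s = t`. -/
theorem measurePreserving_flow (hv : IsVelocityField L v) (hψ : IsFlowMap v ψ) {t : ℝ}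
    (ht : t ∈ Icc (0 : ℝ) 1) : MeasurePreserving (ψ t) torusMeasure torusMeasure := by
  have hc := continuous_flow hv hψ ht
  refine ⟨hc.measurable, ?_⟩
  have : IsFiniteMeasure (torusMeasure.map (ψ t)) := inferInstance
  refine ext_of_forall_integral_eq_of_IsFiniteMeasure fun φ => ?_
  rw [integral_map hc.measurable.aemeasurable φ.continuous.aestronglyMeasurable]
  have h := constant_of_has_deriv_right_zero
    ((continuousOn_mean_flowBetween hv hψ φ.toContinuousMap ht).mono (Icc_subset_Icc_right ht.2))
    (fun s hs => hasDerivWithinAt_mean_flowBetween hv hψ φ.toContinuousMap hs.1 hs.2 ht.2)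
    t ⟨ht.1, le_rfl⟩
  simp only [flowBetween_self hv hψ ht, flowBetween_zero_left hv hψ] at h
  exact h.symm

theorem measurePreserving_flowBetween (hv : IsVelocityField L v) (hψ : IsFlowMap v ψ) {s t : ℝ}
    (hs : s ∈ Icc (0 : ℝ) 1) (ht : t ∈ Icc (0 : ℝ) 1) :
    MeasurePreserving (flowBetween ψ s t) torusMeasure torusMeasure := by
  have h1 := measurePreserving_flow hv hψ hs
  have h2 := measurePreserving_flow hv hψ ht
  have hm := (continuous_flowBetween hv hψ hs ht).measurable
  refine ⟨hm, ?_⟩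
  nth_rewrite 1 [← h1.map_eq]
  rw [Measure.map_map hm h1.measurable]
  have : flowBetween ψ s t ∘ ψ s = ψ t := funext fun z => flowBetween_flow hv hψ hs z
  rw [this, h2.map_eq]

/-! ### Multiplication and advection in `L²` -/

theorem memLp_mul (a : C(Torus2, ℝ)) (f : L2) :
    MemLp (fun z => a z * f z) 2 torusMeasure :=
  (Lp.memLp f).of_le_mul (c := ‖a‖)
    (a.continuous.aestronglyMeasurable.mul (Lp.memLp f).aestronglyMeasurable)
    (Eventually.of_forall fun z => by
      rw [norm_mul]; exact mul_le_mul_of_nonneg_right (a.norm_coe_le_norm z) (norm_nonneg _))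

/-- Multiplication by a continuous function, as an operator on `L²`. -/
def mulL2 (a : C(Torus2, ℝ)) : L2 →L[ℝ] L2 :=
  LinearMap.mkContinuous
    { toFun := fun f => (memLp_mul a f).toLp _
      map_add' := fun f g => by
        refine Lp.ext ?_
        filter_upwards [(memLp_mul a (f + g)).coeFn_toLp, (memLp_mul a f).coeFn_toLp,
          (memLp_mul a g).coeFn_toLp, Lp.coeFn_add ((memLp_mul a f).toLp _)
          ((memLp_mul a g).toLp _), Lp.coeFn_add f g] with z h1 h2 h3 h4 h5
        rw [h1, h4, Pi.add_apply, h2, h3, h5, Pi.add_apply, mul_add]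
      map_smul' := fun c f => by
        refine Lp.ext ?_
        filter_upwards [(memLp_mul a (c • f)).coeFn_toLp, (memLp_mul a f).coeFn_toLp,
          Lp.coeFn_smul c ((memLp_mul a f).toLp _), Lp.coeFn_smul c f] with z h1 h2 h4 h5
        rw [h1, RingHom.id_apply, h4, Pi.smul_apply, h2, h5, Pi.smul_apply, smul_eq_mul,
          smul_eq_mul]
        ring }
    ‖a‖ fun f => by
      refine Lp.norm_le_mul_norm_of_ae_le_mul (c := ‖a‖) ?_
      filter_upwards [(memLp_mul a f).coeFn_toLp] with z h1
      simp only [LinearMap.coe_mk, AddHom.coe_mk]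
      rw [h1, norm_mul]
      exact mul_le_mul_of_nonneg_right (a.norm_coe_le_norm z) (norm_nonneg _)

theorem coeFn_mulL2 (a : C(Torus2, ℝ)) (f : L2) :
    mulL2 a f =ᵐ[torusMeasure] fun z => a z * f z :=
  (memLp_mul a f).coeFn_toLp

theorem norm_mulL2_le (a : C(Torus2, ℝ)) (f : L2) : ‖mulL2 a f‖ ≤ ‖a‖ * ‖f‖ :=
  (mulL2 a).le_of_opNorm_le (LinearMap.mkContinuous_norm_le _ (norm_nonneg _) _) f

theorem mulL2_toL2 (a g : C(Torus2, ℝ)) : mulL2 a (toL2 g) = toL2 (a * g) := by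
  refine Lp.ext ?_
  filter_upwards [coeFn_mulL2 a (toL2 g),
    ContinuousMap.coeFn_toLp (p := 2) (𝕜 := ℝ) torusMeasure g,
    ContinuousMap.coeFn_toLp (p := 2) (𝕜 := ℝ) torusMeasure (a * g)] with z h1 h2 h3
  rw [h1, h2, h3]; rfl

theorem inner_mulL2 (a : C(Torus2, ℝ)) (f g : L2) :
    inner ℝ f (mulL2 a g) = inner ℝ (mulL2 a f) g := by
  rw [L2_inner_eq, L2_inner_eq]
  refine integral_congr_ae ?_
  filter_upwards [coeFn_mulL2 a f, coeFn_mulL2 a g] with z h1 h2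
  rw [h1, h2]; ring

theorem norm_toL2_le (g : C(Torus2, ℝ)) : ‖toL2 g‖ ≤ ‖g‖ := by
  refine le_of_sq_le_sq ?_ (norm_nonneg _)
  rw [norm_toL2_sq]
  have h1 : ∀ z, ‖g z ^ 2‖ ≤ ‖g‖ ^ 2 := fun z => by
    rw [norm_pow]; exact pow_le_pow_left₀ (norm_nonneg _) (g.norm_coe_le_norm z) 2
  have := norm_integral_le_of_norm_le_const (μ := torusMeasure) (Eventually.of_forall h1)
  simp only [probReal_univ, mul_one] at this
  exact (le_abs_self _).trans this

/-- The function `V · D` for a continuous vector field `V` and a square-integrable one `D`. -/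
def advect (V : Fin 2 → C(Torus2, ℝ)) (D : Fin 2 → L2) : L2 := ∑ j, mulL2 (V j) (D j)

theorem norm_advect_le {V : Fin 2 → C(Torus2, ℝ)} {M : ℝ} (hV : ∀ j, ‖V j‖ ≤ M)
    (D : Fin 2 → L2) : ‖advect V D‖ ≤ M * (‖D 0‖ + ‖D 1‖) := by
  rw [advect, Fin.sum_univ_two, mul_add]
  refine (norm_add_le _ _).trans (add_le_add ?_ ?_)
  · exact (norm_mulL2_le _ _).trans (mul_le_mul_of_nonneg_right (hV 0) (norm_nonneg _))
  · exact (norm_mulL2_le _ _).trans (mul_le_mul_of_nonneg_right (hV 1) (norm_nonneg _))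

theorem tendsto_advect {ι : Type*} {l : Filter ι} (V : Fin 2 → C(Torus2, ℝ)) {D : ι → Fin 2 → L2}
    {D' : Fin 2 → L2} (h : ∀ j, Tendsto (fun n => D n j) l (𝓝 (D' j))) :
    Tendsto (fun n => advect V (D n)) l (𝓝 (advect V D')) :=
  tendsto_finsetSum _ fun j _ => ((mulL2 (V j)).continuous.tendsto _).comp (h j)

/-- `D` is the weak gradient of `g`, expressed by testing against trigonometric functions. -/
def IsWeakGradL2 (g : L2) (D : Fin 2 → L2) : Prop :=
  ∀ i j, inner ℝ (trigL2 i) (D j) = -inner ℝ (toL2 (trigGrad i j)) g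

/-- `V` is weakly divergence free, expressed by smooth functions with gradients. -/
def IsDivFreeL2 (V : Fin 2 → C(Torus2, ℝ)) : Prop :=
  ∀ (g : C(Torus2, ℝ)) (Γ : Fin 2 → C(Torus2, ℝ)), HasGrad g Γ → IsSmooth g →
    ∫ z, ∑ j, V j z * Γ j z ∂torusMeasure = 0

theorem HasGrad.sq {g : C(Torus2, ℝ)} {Γ : Fin 2 → C(Torus2, ℝ)} (hg : HasGrad g Γ) :
    HasGrad (g * g) fun j => (2 : ℝ) • (g * Γ j) := by
  obtain ⟨K, hK⟩ := hg.exists_lipschitz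
  obtain ⟨C, hC, h1⟩ := hg
  refine ⟨K ^ 2 + 2 * ‖g‖ * C, by positivity, fun z δ => ?_⟩
  have h2 := h1 z δ
  have h3 : |g (z + disp δ) - g z| ≤ K * ‖δ‖ := by
    rw [abs_sub_comm]
    exact (hK _ _).trans (mul_le_mul_of_nonneg_left (dist_add_disp_le z δ) K.coe_nonneg)
  have h4 : (g * g) (z + disp δ) - (g * g) z - ∑ j, δ j * ((2 : ℝ) • (g * Γ j)) z =
      (g (z + disp δ) - g z) ^ 2 + 2 * g z * (g (z + disp δ) - g z - ∑ j, δ j * Γ j z) := by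
    simp [Fin.sum_univ_two]; ring
  rw [h4]
  refine (abs_add_le _ _).trans ?_
  rw [add_mul]
  refine add_le_add ?_ ?_
  · rw [abs_pow, ← mul_pow]; exact pow_le_pow_left₀ (abs_nonneg _) h3 2
  · rw [abs_mul, abs_mul, abs_two, mul_assoc (2 * ‖g‖)]
    exact mul_le_mul (mul_le_mul_of_nonneg_left (abs_le_norm g z) zero_le_two) h2 (abs_nonneg _)
      (by positivity)

theorem inner_toL2_advect (V Γ : Fin 2 → C(Torus2, ℝ)) (g : C(Torus2, ℝ)) :
    inner ℝ (toL2 g) (advect V fun j => toL2 (Γ j)) =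
      ∫ z, (∑ j, V j z * Γ j z) * g z ∂torusMeasure := by
  have h1 : advect V (fun j => toL2 (Γ j)) = toL2 (∑ j, V j * Γ j) := by
    simp only [advect, mulL2_toL2, map_sum]
  rw [h1, inner_toL2_toL2]
  simp

/-- Advection by a divergence-free field is skew. -/
theorem inner_self_advect {V : Fin 2 → C(Torus2, ℝ)} (hV : IsDivFreeL2 V) {g : L2} {D : Fin 2 → L2}
    (hD : IsWeakGradL2 g D) : inner ℝ g (advect V D) = 0 := by
  have h1 : Tendsto (fun F => inner ℝ (toL2 (trunc F g))
      (advect V fun j => toL2 (truncGrad F g j))) atTop (𝓝 (inner ℝ g (advect V D))) :=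
    (tendsto_trunc g).inner (tendsto_advect V fun j => tendsto_truncGrad hD j)
  refine tendsto_nhds_unique h1 (tendsto_const_nhds.congr fun F => ?_)
  have h2 := hV _ _ (hasGrad_trunc F g).sq ((isSmooth_trunc F g).mul (isSmooth_trunc F g))
  rw [inner_toL2_advect]
  have h3 : ∀ z, (∑ j, V j z * truncGrad F g j z) * trunc F g z =
      1 / 2 * ∑ j, V j z * ((2 : ℝ) • (trunc F g * truncGrad F g j)) z := by
    intro z; simp [Fin.sum_univ_two]; ring
  simp only [h3]
  rw [integral_const_mul, h2, mul_zero]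

/-- Advection by a divergence-free field has mean zero. -/
theorem inner_one_advect {V : Fin 2 → C(Torus2, ℝ)} (hV : IsDivFreeL2 V) {g : L2} {D : Fin 2 → L2}
    (hD : IsWeakGradL2 g D) : inner ℝ (toL2 1) (advect V D) = 0 := by
  have h1 : Tendsto (fun F => inner ℝ (toL2 1)
      (advect V fun j => toL2 (truncGrad F g j))) atTop (𝓝 (inner ℝ (toL2 1) (advect V D))) :=
    tendsto_const_nhds.inner (tendsto_advect V fun j => tendsto_truncGrad hD j)
  refine tendsto_nhds_unique h1 (tendsto_const_nhds.congr fun F => ?_)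
  have h2 := hV _ _ (hasGrad_trunc F g) (isSmooth_trunc F g)
  rw [inner_toL2_advect]
  simp [← h2]

/-! ### Weak solutions in Fourier coefficients -/

/-- The Euclidean norm in `L²` of a pair of components. -/
def gradNorm (D : Fin 2 → L2) : ℝ := √(∑ j, ‖D j‖ ^ 2)

theorem gradNorm_nonneg (D : Fin 2 → L2) : 0 ≤ gradNorm D := Real.sqrt_nonneg _

theorem gradNorm_sq (D : Fin 2 → L2) : gradNorm D ^ 2 = ∑ j, ‖D j‖ ^ 2 :=
  Real.sq_sqrt (Finset.sum_nonneg fun _ _ => sq_nonneg _)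

theorem norm_le_gradNorm (D : Fin 2 → L2) (j : Fin 2) : ‖D j‖ ≤ gradNorm D :=
  Real.le_sqrt_of_sq_le (Finset.single_le_sum (f := fun j => ‖D j‖ ^ 2)
    (fun _ _ => sq_nonneg _) (Finset.mem_univ j))

theorem norm_advect_le_gradNorm {V : Fin 2 → C(Torus2, ℝ)} {M : ℝ} (hV : ∀ j, ‖V j‖ ≤ M)
    (D : Fin 2 → L2) : ‖advect V D‖ ≤ 2 * M * gradNorm D := by
  have hM : 0 ≤ M := (norm_nonneg _).trans (hV 0)
  refine (norm_advect_le hV D).trans ?_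
  nlinarith [norm_le_gradNorm D 0, norm_le_gradNorm D 1]

theorem IsWeakGradL2.energyLE {g : L2} {D : Fin 2 → L2} (hD : IsWeakGradL2 g D) :
    EnergyLE g (gradNorm D ^ 2) := by
  rw [gradNorm_sq]; exact EnergyLE.of_hasSum (hasSum_energy hD)

/-- A solution of the advection–diffusion equation with drift `V` and gradient `D`, described by its
Fourier coefficients, which are absolutely continuous functions of time. -/
structure IsEvolution (ν M : ℝ) (V : ℝ → Fin 2 → C(Torus2, ℝ)) (f : ℝ → L2)
    (D : ℝ → Fin 2 → L2) : Prop where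
  continuousOn : ContinuousOn f (Ici 0)
  norm_le : ∀ s j, ‖V s j‖ ≤ M
  divFree : ∀ s, IsDivFreeL2 (V s)
  weakGrad : ∀ᵐ s ∂volume.restrict (Ioi (0 : ℝ)), IsWeakGradL2 (f s) (D s)
  memLp : ∀ T : ℝ, 0 < T → MemLp (fun s => gradNorm (D s)) 2 (volume.restrict (Ioc 0 T))
  absCont : ∀ T : ℝ, 0 < T → ∀ i,
    AbsolutelyContinuousOnInterval (fun t => inner ℝ (trigL2 i) (f t)) 0 T
  hasDeriv : ∀ᵐ s ∂volume.restrict (Ioi (0 : ℝ)), ∀ i,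
    HasDerivAt (fun t => inner ℝ (trigL2 i) (f t))
      (-(inner ℝ (trigL2 i) (advect (V s) (D s)) + ν * (i.eig * inner ℝ (trigL2 i) (f s)))) s

theorem exists_piece_mem {m : ℕ} {τ : ℕ → ℝ} (h0 : τ 0 = 0) (hm : τ m = 1) {r : ℝ}
    (hr : r ∈ Ico (0 : ℝ) 1) : ∃ i < m, r ∈ Ico (τ i) (τ (i + 1)) := by
  by_contra! hcon
  have : ∀ i ≤ m, τ i ≤ r := by
    intro i
    induction i with
    | zero => intro _; rw [h0]; exact hr.1
    | succ i ih =>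
      intro hi
      by_contra hlt
      exact hcon i hi ⟨ih (by omega), not_le.1 hlt⟩
  have := this m le_rfl
  rw [hm] at this
  exact absurd hr.2 (not_lt.2 this)

variable {L : ℝ≥0} {v : ℝ → Torus2 → Plane}

/-- Components of the periodic drift, as continuous functions on the torus. -/
theorem exists_components (hv : IsVelocityField L v) :
    ∃ V : ℝ → Fin 2 → C(Torus2, ℝ), (∀ s j z, V s j z = periodicExt v s z j) ∧
      (∀ s, IsDivFreeL2 (V s)) ∧ ∀ j, AEStronglyMeasurable (fun s => V s j) volume := by
  have hfr : ∀ s : ℝ, Int.fract s ∈ Ico (0 : ℝ) 1 := fun s =>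
    ⟨Int.fract_nonneg s, Int.fract_lt_one s⟩
  have hcont : ∀ s (j : Fin 2), Continuous fun z => periodicExt v s z j := by
    intro s j
    have h1 : Continuous (periodicExt v s) := (hv.lipschitz _ (hfr s)).continuous
    fun_prop
  refine ⟨fun s j => ⟨_, hcont s j⟩, fun s j z => rfl, fun s g Γ hg hgs => ?_, fun j => ?_⟩
  · exact hg.integral_velocity hgs (hv.divFree _ (hfr s))
  · obtain ⟨m, τ, h0, hm, hlt, hc⟩ := hv.piecewiseContinuous
    have hcover : (⋃ p : ℤ × Fin m, {s : ℝ | s - p.1 ∈ Ico (τ p.2) (τ (p.2 + 1)) ∧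
        s - p.1 ∈ Ico (0 : ℝ) 1}) = univ := by
      refine eq_univ_of_forall fun s => ?_
      obtain ⟨i, hi, hmem⟩ := exists_piece_mem h0 hm (hfr s)
      exact mem_iUnion.2 ⟨(⌊s⌋, ⟨i, hi⟩), hmem, hfr s⟩
    rw [← Measure.restrict_univ (μ := volume), ← hcover, aestronglyMeasurable_iUnion_iff]
    rintro ⟨n, i⟩
    set S : Set ℝ := {s : ℝ | s - n ∈ Ico (τ i) (τ (i + 1)) ∧ s - n ∈ Ico (0 : ℝ) 1} with hS
    have hSm : MeasurableSet S :=
      (measurableSet_Ico.preimage (measurable_id.sub_const (n : ℝ))).inter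
        (measurableSet_Ico.preimage (measurable_id.sub_const (n : ℝ)))
    refine ContinuousOn.aestronglyMeasurable ?_ hSm
    rw [continuousOn_iff_continuous_domRestrict]
    refine ContinuousMap.continuous_of_continuous_uncurry _ ?_
    have h1 : ContinuousOn (fun p : ℝ × Torus2 => v (p.1 - n) p.2) (S ×ˢ univ) := by
      refine (hc i i.2).comp (f := fun p : ℝ × Torus2 => (p.1 - n, p.2))
        (Continuous.continuousOn (by fun_prop)) ?_
      rintro ⟨s, z⟩ ⟨hs, -⟩
      exact ⟨hs.1, trivial⟩
    have h2 : Continuous fun p : S × Torus2 => v ((p.1 : ℝ) - n) p.2 :=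
      h1.comp_continuous (f := fun p : S × Torus2 => ((p.1 : ℝ), p.2)) (by fun_prop)
        fun p => ⟨p.1.2, trivial⟩
    have h3 := (EuclideanSpace.proj (𝕜 := ℝ) (ι := Fin 2) j).continuous.comp h2
    refine h3.congr ?_
    rintro ⟨s, z⟩
    have : Int.fract (s : ℝ) = s - n := by
      rw [Int.fract_eq_iff]
      exact ⟨s.2.2.1, s.2.2.2, n, by ring⟩
    change v ((s : ℝ) - n) z j = v (Int.fract (s : ℝ)) z j
    rw [this]

/-- The `j`-th component of a square-integrable vector field. -/
def compPlane (j : Fin 2) : Lp Plane 2 torusMeasure →L[ℝ] L2 :=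
  (EuclideanSpace.proj (𝕜 := ℝ) j).compLpL 2 torusMeasure

theorem coeFn_compPlane (j : Fin 2) (G : Lp Plane 2 torusMeasure) :
    compPlane j G =ᵐ[torusMeasure] fun z => G z j :=
  (EuclideanSpace.proj (𝕜 := ℝ) j).coeFn_compLpL G

theorem gradNorm_compPlane (G : Lp Plane 2 torusMeasure) :
    gradNorm (fun j => compPlane j G) = ‖G‖ := by
  rw [← Real.sqrt_sq (norm_nonneg G), gradNorm]
  congr 1
  have h1 : ∀ j, ‖compPlane j G‖ ^ 2 = ∫ z, G z j ^ 2 ∂torusMeasure := by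
    intro j
    rw [← real_inner_self_eq_norm_sq, L2_inner_eq]
    refine integral_congr_ae ?_
    filter_upwards [coeFn_compPlane j G] with z hz
    rw [hz, sq]
  have h2 : ∀ j, Integrable (fun z => G z j ^ 2) torusMeasure := by
    intro j
    refine ((Lp.memLp (compPlane j G)).integrable_sq).congr ?_
    filter_upwards [coeFn_compPlane j G] with z hz
    rw [hz]
  rw [← real_inner_self_eq_norm_sq, MeasureTheory.L2.inner_def]
  simp only [h1]
  rw [← integral_finsetSum _ fun j _ => h2 j]
  refine integral_congr_ae (Eventually.of_forall fun z => ?_)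
  simp only [PiLp.inner_apply, Fin.sum_univ_two, RCLike.inner_apply, conj_trivial, sq]

/-- Testing the weak equation against trigonometric functions gives integral equations for the
Fourier coefficients. -/
theorem IsSolution.exists_isEvolution (hv : IsVelocityField L v) {ν : ℝ} {f₀ : L2} {f : ℝ → L2}
    (hf : IsSolution ν (periodicExt v) f₀ f) :
    ∃ M V D, IsEvolution ν M V f D ∧ ∀ s j z, V s j z = periodicExt v s z j := by
  obtain ⟨hc, h0, G, hG, hw, heq⟩ := hf
  obtain ⟨V, hV, hdiv, hmeas⟩ := exists_components hv
  obtain ⟨M, hM⟩ := hv.bounded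
  have hM0 : 0 ≤ M := (norm_nonneg _).trans (hM 0 ⟨le_rfl, zero_lt_one⟩ 0)
  have hVM : ∀ s j, ‖V s j‖ ≤ M := by
    intro s j
    rw [ContinuousMap.norm_le _ hM0]
    intro z
    rw [hV]
    exact (PiLp.norm_apply_le _ j).trans (hM _ ⟨Int.fract_nonneg s, Int.fract_lt_one s⟩ z)
  set D : ℝ → Fin 2 → L2 := fun s j => compPlane j (G s) with hD
  have hgn : ∀ s, gradNorm (D s) = ‖G s‖ := fun s => gradNorm_compPlane (G s)
  have hweak : ∀ᵐ s ∂volume.restrict (Ioi (0 : ℝ)), IsWeakGradL2 (f s) (D s) := by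
    filter_upwards [hw] with s hs i j
    have h1 := hs (trig i) (isSmooth_trig i) j
    simp only [(hasGrad_trig i).partialDeriv_eq] at h1
    rw [trigL2, inner_toL2, inner_toL2, h1, neg_neg]
    refine integral_congr_ae ?_
    filter_upwards [coeFn_compPlane j (G s)] with z hz
    rw [hz]
  -- the right-hand side of the equation for the `i`-th coefficient
  set q : Mode → ℝ → ℝ := fun i s =>
    ∑ j, inner ℝ (toL2 (V s j * trig i + ν • trigGrad i j)) (D s j) with hq
  have hrate : ∀ i s, ∫ z, (inner ℝ (periodicExt v s z) (G s z) * trig i z +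
      ν * inner ℝ (G s z) (grad (trig i) z)) ∂torusMeasure = q i s := by
    intro i s
    simp only [hq, inner_toL2]
    rw [← integral_finsetSum _ fun j _ => integrable_mul_continuous (L2_integrable (D s j)) _]
    refine integral_congr_ae ?_
    filter_upwards [coeFn_compPlane 0 (G s), coeFn_compPlane 1 (G s)] with z hz0 hz1
    rw [(hasGrad_trig i).grad_eq, PiLp.inner_apply]
    simp [Fin.sum_univ_two, hD, hz0, hz1, hV]
    ring
  have hqm : ∀ i T, 0 < T → IntervalIntegrable (q i) volume 0 T := by
    intro i T hT
    rw [intervalIntegrable_iff_integrableOn_Ioc_of_le hT.le]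
    have hGi : Integrable (fun s => ‖G s‖) (volume.restrict (Ioc 0 T)) :=
      ((hG T hT).integrable (by norm_num)).norm
    refine integrable_finsetSum _ fun j _ => ?_
    have hb : ∀ s, ‖toL2 (V s j * trig i + ν • trigGrad i j)‖ ≤ M + |ν| * ‖trigGrad i j‖ := by
      intro s
      have h1 := norm_toL2_le (V s j * trig i + ν • trigGrad i j)
      have h2 : ‖trig i‖ ≤ 1 := (ContinuousMap.norm_le _ zero_le_one).2 (abs_trig_le i)
      refine h1.trans ((norm_add_le _ _).trans (add_le_add ?_ ?_))
      · refine (norm_mul_le _ _).trans ?_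
        have := mul_le_mul (hVM s j) h2 (norm_nonneg _) hM0
        simpa using this
      · rw [norm_smul, Real.norm_eq_abs]
    refine Integrable.mono' (hGi.const_mul (M + |ν| * ‖trigGrad i j‖)) ?_ ?_
    · refine AEStronglyMeasurable.inner ?_ ?_
      · have h2 : Continuous fun a : C(Torus2, ℝ) => toL2 (a * trig i + ν • trigGrad i j) := by
          fun_prop
        exact h2.comp_aestronglyMeasurable (hmeas j).restrict
      · exact (compPlane j).continuous.comp_aestronglyMeasurable (hG T hT).aestronglyMeasurable
    · refine Eventually.of_forall fun s => ?_
      refine (norm_inner_le_norm _ _).trans ?_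
      refine mul_le_mul (hb s) ?_ (norm_nonneg _) (by positivity)
      rw [← hgn]; exact norm_le_gradNorm (D s) j
  have hcoef : ∀ i t, 0 ≤ t →
      inner ℝ (trigL2 i) (f t) = inner ℝ (trigL2 i) f₀ + -∫ s in (0 : ℝ)..t, q i s := by
    intro i t ht
    have h1 := heq (trig i) (isSmooth_trig i) t ht
    simp only [hrate] at h1
    rw [trigL2, inner_toL2, inner_toL2]
    linarith
  have hq' : ∀ i s, IsWeakGradL2 (f s) (D s) → q i s =
      inner ℝ (trigL2 i) (advect (V s) (D s)) + ν * (i.eig * inner ℝ (trigL2 i) (f s)) := by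
    intro i s hs
    have h1 : ∀ j, inner ℝ (toL2 (V s j * trig i + ν • trigGrad i j)) (D s j) =
        inner ℝ (trigL2 i) (mulL2 (V s j) (D s j)) +
          ν * (i.freq j ^ 2 * inner ℝ (trigL2 i) (f s)) := by
      intro j
      rw [map_add, map_smul, ← mulL2_toL2, inner_add_left, ← inner_mulL2, real_inner_smul_left,
        toL2_trigGrad, real_inner_smul_left, hs, toL2_trigGrad, real_inner_smul_left]
      simp only [Mode.freq_flip, Mode.flip_flip, trigL2]
      ring
    simp only [hq, h1]
    rw [Finset.sum_add_distrib, advect, inner_sum, ← Finset.mul_sum, ← Finset.sum_mul, Mode.eig]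
  refine ⟨M, V, D, ⟨hc, hVM, hdiv, hweak, ?_, ?_, ?_⟩, hV⟩
  · intro T hT
    simp only [hgn]
    exact (hG T hT).norm
  · intro T hT i
    have h1 := ((hqm i T hT).absolutelyContinuousOnInterval_intervalIntegral
      (c := 0) left_mem_uIcc).neg
    have h2 : AbsolutelyContinuousOnInterval (fun _ : ℝ => inner ℝ (trigL2 i) f₀) 0 T :=
      (LipschitzWith.const _).lipschitzOnWith.absolutelyContinuousOnInterval (K := 0)
    have h3 := h2.add h1
    rw [absolutelyContinuousOnInterval_iff] at h3 ⊢
    intro ε hε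
    obtain ⟨δ, hδ, h4⟩ := h3 ε hε
    refine ⟨δ, hδ, fun E hE hEδ => ?_⟩
    refine lt_of_le_of_lt (Finset.sum_le_sum fun k hk => le_of_eq ?_) (h4 E hE hEδ)
    have hmem := hE.1 k hk
    rw [uIcc_of_le hT.le] at hmem
    simp only [Pi.add_apply, Pi.neg_apply]
    rw [hcoef i _ hmem.1.1, hcoef i _ hmem.2.1]
  · have hn : ∀ n : ℕ, ∀ᵐ s : ℝ ∂volume.restrict (Ioi (0 : ℝ)), s < n + 1 → ∀ i,
        HasDerivAt (fun t => inner ℝ (trigL2 i) (f t)) (-q i s) s := by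
      intro n
      have hT : (0 : ℝ) < n + 1 := by positivity
      have h1 : ∀ᵐ s : ℝ, ∀ i, s ∈ uIcc (0 : ℝ) (n + 1) →
          HasDerivAt (fun t => ∫ r in (0 : ℝ)..t, q i r) (q i s) s := by
        rw [ae_all_iff]
        intro i
        filter_upwards [(hqm i (n + 1) hT).ae_hasDerivAt_integral] with s hs hs'
        exact hs hs' 0 left_mem_uIcc
      rw [ae_restrict_iff' measurableSet_Ioi]
      filter_upwards [h1] with s hs hs0 hsn i
      have h2 := (hs i (by rw [uIcc_of_le hT.le]; exact ⟨hs0.le, hsn.le⟩)).neg.const_add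
        (inner ℝ (trigL2 i) f₀)
      refine h2.congr_of_eventuallyEq ?_
      filter_upwards [Ioi_mem_nhds hs0] with t ht
      exact hcoef i t ht.le
    have hn' : ∀ᵐ s : ℝ ∂volume.restrict (Ioi (0 : ℝ)), ∀ n : ℕ, s < n + 1 → ∀ i,
        HasDerivAt (fun t => inner ℝ (trigL2 i) (f t)) (-q i s) s := ae_all_iff.2 hn
    filter_upwards [hn', hweak] with s hs hs' i
    obtain ⟨n, hn⟩ := exists_nat_gt s
    have := hs n (hn.trans (by linarith)) i
    rwa [hq' i s hs'] at this

/-! ### Energy balance -/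

theorem AbsolutelyContinuousOnInterval.finsetSum {I : Type*} (F : Finset I) {a b : ℝ}
    {g : I → ℝ → ℝ} (hg : ∀ i, AbsolutelyContinuousOnInterval (g i) a b) :
    AbsolutelyContinuousOnInterval (fun t => ∑ i ∈ F, g i t) a b := by
  classical
  induction F using Finset.induction_on with
  | empty =>
    simpa using (LipschitzWith.const (0 : ℝ)).lipschitzOnWith.absolutelyContinuousOnInterval
  | insert i s hi ih =>
    simp only [Finset.sum_insert hi]
    exact (hg i).add ih

/-- The fundamental theorem of calculus for an absolutely continuous function with a known
derivative almost everywhere. -/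
theorem integral_eq_sub_of_absCont {A A' : ℝ → ℝ} {a b : ℝ} (hab : a ≤ b)
    (hA : AbsolutelyContinuousOnInterval A a b)
    (hd : ∀ᵐ s : ℝ, s ∈ Ioo a b → HasDerivAt A (A' s) s) :
    IntervalIntegrable A' volume a b ∧ ∫ s in a..b, A' s = A b - A a := by
  have hne : ∀ᵐ s : ℝ, s ≠ b := by simp [ae_iff]
  have h1 : ∀ᵐ s : ℝ, s ∈ uIoc a b → deriv A s = A' s := by
    filter_upwards [hd, hne] with s hs hsb hmem
    rw [uIoc_of_le hab] at hmem
    exact (hs ⟨hmem.1, lt_of_le_of_ne hmem.2 hsb⟩).deriv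
  refine ⟨hA.intervalIntegrable_deriv.congr_ae ?_, ?_⟩
  · exact (ae_restrict_iff' measurableSet_uIoc).2 h1
  · rw [← hA.integral_deriv_eq_sub]
    exact (intervalIntegral.integral_congr_ae h1).symm

section

variable {ν M : ℝ} {V : ℝ → Fin 2 → C(Torus2, ℝ)} {f : ℝ → L2} {D : ℝ → Fin 2 → L2}

theorem norm_toL2_trunc_le (F : Finset Mode) (g : L2) : ‖toL2 (trunc F g)‖ ≤ ‖g‖ := by
  refine le_of_sq_le_sq ?_ (norm_nonneg _)
  rw [toL2_trunc]
  exact (trigL2_isParsevalFrame.norm_sum_sq_le F _).trans (trigL2_isParsevalFrame.sum_sq_le F g)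

theorem inner_toL2_trunc (F : Finset Mode) (g h : L2) :
    inner ℝ (toL2 (trunc F g)) h = ∑ i ∈ F, inner ℝ (trigL2 i) g * inner ℝ (trigL2 i) h := by
  rw [toL2_trunc, sum_inner]
  exact Finset.sum_congr rfl fun i _ => real_inner_smul_left _ _ _

theorem gradNorm_truncGrad_le {g : L2} {D : Fin 2 → L2} (hD : IsWeakGradL2 g D)
    (F : Finset Mode) : gradNorm (fun j => toL2 (truncGrad F g j)) ≤ gradNorm D := by
  refine Real.sqrt_le_sqrt ((sum_norm_truncGrad_le F g).trans ?_)
  rw [← gradNorm_sq]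
  exact hD.energyLE F

theorem ae_Ioi {p : ℝ → Prop} (h : ∀ᵐ s ∂volume.restrict (Ioi (0 : ℝ)), p s) :
    ∀ᵐ s : ℝ, 0 < s → p s := (ae_restrict_iff' measurableSet_Ioi).1 h

theorem IsEvolution.intervalIntegrable (h : IsEvolution ν M V f D) {a b : ℝ} (ha : 0 ≤ a)
    (hab : a ≤ b) : IntervalIntegrable (fun s => gradNorm (D s)) volume a b := by
  rw [intervalIntegrable_iff_integrableOn_Ioc_of_le hab]
  have h1 := (h.memLp (b + 1) (by linarith)).integrable (by norm_num)
  exact IntegrableOn.mono_set h1 (Ioc_subset_Ioc ha (by linarith))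

theorem IsEvolution.intervalIntegrable_sq (h : IsEvolution ν M V f D) {a b : ℝ} (ha : 0 ≤ a)
    (hab : a ≤ b) : IntervalIntegrable (fun s => gradNorm (D s) ^ 2) volume a b := by
  rw [intervalIntegrable_iff_integrableOn_Ioc_of_le hab]
  have h1 := (h.memLp (b + 1) (by linarith)).integrable_sq
  exact IntegrableOn.mono_set h1 (Ioc_subset_Ioc ha (by linarith))

/-- The energy identity. The solution is only weakly differentiable in time, so the identity is
proved for the finitely many Fourier modes in `F`, and then `F` is exhausted. -/
theorem IsEvolution.energy_eq (h : IsEvolution ν M V f D) {T : ℝ} (hT : 0 < T) :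
    ‖f T‖ ^ 2 + 2 * ν * ∫ s in (0 : ℝ)..T, gradNorm (D s) ^ 2 = ‖f 0‖ ^ 2 := by
  obtain ⟨B, hB⟩ := isCompact_Icc.exists_bound_of_continuousOn
    (h.continuousOn.mono (Icc_subset_Ici_self : Icc 0 T ⊆ Ici 0))
  have hM : 0 ≤ M := (norm_nonneg _).trans (h.norm_le 0 0)
  have hB0 : 0 ≤ B := (norm_nonneg _).trans (hB 0 ⟨le_rfl, hT.le⟩)
  set Q : Finset Mode → ℝ → ℝ := fun F t => ∑ i ∈ F, inner ℝ (trigL2 i) (f t) *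
    inner ℝ (trigL2 i) (f t) with hQ
  set Q' : Finset Mode → ℝ → ℝ := fun F s => -2 * (inner ℝ (toL2 (trunc F (f s)))
    (advect (V s) (D s)) + ν * ∑ i ∈ F, i.eig * inner ℝ (trigL2 i) (f s) ^ 2) with hQ'
  have hQd : ∀ F, ∀ᵐ s : ℝ, s ∈ Ioo 0 T → HasDerivAt (Q F) (Q' F s) s := by
    intro F
    filter_upwards [ae_Ioi h.hasDeriv] with s hs hs'
    have h1 := HasDerivAt.fun_sum (u := F) fun i _ => (hs hs'.1 i).fun_mul (hs hs'.1 i)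
    convert! h1 using 1
    simp only [hQ', inner_toL2_trunc]
    rw [Finset.mul_sum, ← Finset.sum_add_distrib, Finset.mul_sum]
    exact Finset.sum_congr rfl fun i _ => by ring
  have hQi := fun F => integral_eq_sub_of_absCont hT.le
    (AbsolutelyContinuousOnInterval.finsetSum F fun i =>
      (h.absCont T hT i).fun_mul (h.absCont T hT i)) (hQd F)
  have hlimQ : ∀ t, Tendsto (fun F => Q F t) atTop (𝓝 (‖f t‖ ^ 2)) := by
    intro t
    have := trigL2_isParsevalFrame (f t)
    simp only [sq] at this ⊢
    exact this
  have hlim := intervalIntegral.tendsto_integral_filter_of_dominated_convergence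
    (μ := volume) (a := 0) (b := T) (l := atTop) (F := Q')
    (f := fun s => -2 * (ν * gradNorm (D s) ^ 2))
    (fun s => 2 * (B * (2 * M * gradNorm (D s)) + |ν| * gradNorm (D s) ^ 2)) ?_ ?_ ?_ ?_
  · have h1 := tendsto_nhds_unique hlim
      (((hlimQ T).sub (hlimQ 0)).congr fun F => (hQi F).2.symm)
    simp only [intervalIntegral.integral_const_mul] at h1
    linarith
  · refine Eventually.of_forall fun F => ?_
    exact (intervalIntegrable_iff.1 (hQi F).1).aestronglyMeasurable
  · refine Eventually.of_forall fun F => ?_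
    filter_upwards [ae_Ioi h.weakGrad] with s hs hs'
    rw [uIoc_of_le hT.le] at hs'
    have h1 := (hs hs'.1).energyLE F
    have h2 : |inner ℝ (toL2 (trunc F (f s))) (advect (V s) (D s))| ≤
        B * (2 * M * gradNorm (D s)) := by
      refine (abs_real_inner_le_norm _ _).trans ?_
      exact mul_le_mul ((norm_toL2_trunc_le F _).trans (hB s (Ioc_subset_Icc_self hs')))
        (norm_advect_le_gradNorm (h.norm_le s) _) (norm_nonneg _) hB0
    have h3 : 0 ≤ ∑ i ∈ F, i.eig * inner ℝ (trigL2 i) (f s) ^ 2 :=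
      Finset.sum_nonneg fun i _ => mul_nonneg i.eig_nonneg (sq_nonneg _)
    rw [Real.norm_eq_abs, abs_mul, abs_neg, abs_two]
    refine mul_le_mul_of_nonneg_left ((abs_add_le _ _).trans (add_le_add h2 ?_)) zero_le_two
    rw [abs_mul, abs_of_nonneg h3]
    exact mul_le_mul_of_nonneg_left h1 (abs_nonneg _)
  · exact (((h.intervalIntegrable le_rfl hT.le).const_mul _).const_mul _ |>.add
      ((h.intervalIntegrable_sq le_rfl hT.le).const_mul _)).const_mul _
  · filter_upwards [ae_Ioi h.weakGrad] with s hs hs'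
    rw [uIoc_of_le hT.le] at hs'
    have h1 := hs hs'.1
    have h2 : Tendsto (fun F => inner ℝ (toL2 (trunc F (f s))) (advect (V s) (D s))) atTop
        (𝓝 0) := by
      rw [← inner_self_advect (h.divFree s) h1]
      exact (tendsto_trunc (f s)).inner tendsto_const_nhds
    have h3 : Tendsto (fun F => ∑ i ∈ F, i.eig * inner ℝ (trigL2 i) (f s) ^ 2) atTop
        (𝓝 (gradNorm (D s) ^ 2)) := by
      rw [gradNorm_sq]; exact hasSum_energy h1
    have h4 := (h2.add (h3.const_mul ν)).const_mul (-2)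
    rwa [zero_add] at h4

theorem IsEvolution.norm_le_norm_zero (h : IsEvolution ν M V f D) (hν : 0 ≤ ν) {T : ℝ}
    (hT : 0 ≤ T) : ‖f T‖ ≤ ‖f 0‖ := by
  rcases hT.eq_or_lt with rfl | hT
  · exact le_rfl
  have h1 := h.energy_eq hT
  have h2 : 0 ≤ ∫ s in (0 : ℝ)..T, gradNorm (D s) ^ 2 :=
    intervalIntegral.integral_nonneg hT.le fun _ _ => sq_nonneg _
  refine le_of_sq_le_sq ?_ (norm_nonneg _)
  nlinarith [mul_nonneg hν h2]

theorem IsEvolution.norm_antitone (h : IsEvolution ν M V f D) (hν : 0 ≤ ν) {s T : ℝ}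
    (hs : 0 ≤ s) (hsT : s ≤ T) : ‖f T‖ ≤ ‖f s‖ := by
  rcases hs.eq_or_lt with rfl | hs
  · exact h.norm_le_norm_zero hν hsT
  have h1 := h.energy_eq hs
  have h2 := h.energy_eq (hs.trans_le hsT)
  have h3 := intervalIntegral.integral_add_adjacent_intervals
    (h.intervalIntegrable_sq le_rfl hs.le) (h.intervalIntegrable_sq hs.le hsT)
  have h4 : 0 ≤ ∫ r in s..T, gradNorm (D r) ^ 2 :=
    intervalIntegral.integral_nonneg hsT fun _ _ => sq_nonneg _
  refine le_of_sq_le_sq ?_ (norm_nonneg _)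
  rw [← h3] at h2
  nlinarith [mul_nonneg hν h4]

theorem trig_zero : trig (0, false) = 1 := by
  ext z; simp [trig_false, mFourier_zero]

/-- The mean of a solution is conserved. -/
theorem IsEvolution.mean_eq (h : IsEvolution ν M V f D) {T : ℝ} (hT : 0 < T) :
    inner ℝ (toL2 1) (f T) = inner ℝ (toL2 1) (f 0) := by
  have h1 := integral_eq_sub_of_absCont (A' := fun _ => 0) hT.le (h.absCont T hT (0, false)) (by
    filter_upwards [ae_Ioi h.hasDeriv, ae_Ioi h.weakGrad] with s hs hw hs'
    have h2 := hs hs'.1 (0, false)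
    have h3 : Mode.eig (0, false) = 0 := by simp [Mode.eig, Mode.freq]
    rw [h3, trigL2, trig_zero, inner_one_advect (h.divFree s) (hw hs'.1)] at h2
    rw [trigL2, trig_zero]
    simpa using h2)
  have h2 := h1.2
  rw [intervalIntegral.integral_zero, trigL2, trig_zero] at h2
  linarith

/-- At some time of a unit interval the gradient is at most its mean. -/
theorem IsEvolution.exists_good_time (h : IsEvolution ν M V f D) (n : ℕ) :
    ∃ s ∈ Ioc (0 : ℝ) 1, IsWeakGradL2 (f (n + s)) (D (n + s)) ∧
      gradNorm (D (n + s)) ≤ ∫ r in (n : ℝ)..(n + 1), gradNorm (D r) := by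
  have hn : (0 : ℝ) ≤ n := n.cast_nonneg
  set μ := volume.restrict (Ioc (n : ℝ) (n + 1)) with hμ
  have : IsProbabilityMeasure μ := ⟨by simp [hμ]⟩
  have hi : Integrable (fun s => gradNorm (D s)) μ := by
    have := h.intervalIntegrable hn (by linarith : (n : ℝ) ≤ n + 1)
    rwa [intervalIntegrable_iff_integrableOn_Ioc_of_le (by linarith)] at this
  have hae : ∀ᵐ s ∂μ, s ∈ Ioc (n : ℝ) (n + 1) ∧ IsWeakGradL2 (f s) (D s) := by
    rw [hμ, ae_restrict_iff' measurableSet_Ioc]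
    filter_upwards [ae_Ioi h.weakGrad] with s hs hs'
    exact ⟨hs', hs (hn.trans_lt hs'.1)⟩
  obtain ⟨s, hs1, hs2⟩ := exists_notMem_null_le_integral hi (ae_iff.1 hae)
  have hs3 := not_not.1 hs1
  refine ⟨s - n, ⟨by linarith [hs3.1.1], by linarith [hs3.1.2]⟩, ?_, ?_⟩
  · rw [add_sub_cancel]; exact hs3.2
  · rw [add_sub_cancel, intervalIntegral.integral_of_le (by linarith)]; exact hs2

/-- Jensen's inequality on a unit interval. -/
theorem IsEvolution.sq_integral_le (h : IsEvolution ν M V f D) (n : ℕ) :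
    (∫ r in (n : ℝ)..(n + 1), gradNorm (D r)) ^ 2 ≤
      ∫ r in (n : ℝ)..(n + 1), gradNorm (D r) ^ 2 := by
  have hn : (0 : ℝ) ≤ n := n.cast_nonneg
  have hn1 : (n : ℝ) ≤ n + 1 := by linarith
  have i1 := h.intervalIntegrable hn hn1
  have i2 := h.intervalIntegrable_sq hn hn1
  set c := ∫ r in (n : ℝ)..(n + 1), gradNorm (D r) with hc
  have h1 : 0 ≤ ∫ r in (n : ℝ)..(n + 1), (gradNorm (D r) - c) ^ 2 :=
    intervalIntegral.integral_nonneg hn1 fun _ _ => sq_nonneg _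
  have h2 : ∀ r, (gradNorm (D r) - c) ^ 2 =
      gradNorm (D r) ^ 2 + (-2 * c) * gradNorm (D r) + c ^ 2 :=
    fun r => by ring
  simp only [h2] at h1
  rw [intervalIntegral.integral_add (i2.add (i1.const_mul _)) intervalIntegrable_const,
    intervalIntegral.integral_add i2 (i1.const_mul _), intervalIntegral.integral_const_mul,
    ← hc, intervalIntegral.integral_const] at h1
  simp only [add_sub_cancel_left, one_smul] at h1
  nlinarith

end

/-! ### Comparison of the solution with transport along the flow -/

theorem compL2_comp {R R' S : Torus2 → Torus2} (hR : MeasurePreserving R torusMeasure torusMeasure)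
    (hR' : MeasurePreserving R' torusMeasure torusMeasure)
    (hS : MeasurePreserving S torusMeasure torusMeasure) (h : ∀ z, R (R' z) = S z) (g : L2) :
    compL2 hR' (compL2 hR g) = compL2 hS g := by
  refine Lp.ext ?_
  filter_upwards [coeFn_compL2 hR' (compL2 hR g), coeFn_compL2 hS g,
    hR'.quasiMeasurePreserving.ae (coeFn_compL2 hR g)] with z h1 h2 h3
  rw [h1, h2, Function.comp_apply, h3, Function.comp_apply, Function.comp_apply, h]

theorem compL2_id {R : Torus2 → Torus2} (hR : MeasurePreserving R torusMeasure torusMeasure)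
    (h : ∀ z, R z = z) (g : L2) : compL2 hR g = g := by
  refine Lp.ext ?_
  filter_upwards [coeFn_compL2 hR g] with z h1
  rw [h1, Function.comp_apply, h]

section

variable {L : ℝ≥0} {v : ℝ → Torus2 → Plane} {ψ : ℝ → Torus2 → Torus2}

theorem sqrt_four_mul_exp_sq_mul (L B : ℝ) :
    √(4 * Real.exp L ^ 2 * B) = 2 * Real.exp L * √B := by
  rw [show 4 * Real.exp L ^ 2 * B = (2 * Real.exp L) ^ 2 * B by ring,
    Real.sqrt_mul (sq_nonneg _), Real.sqrt_sq (by positivity)]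

/-- Composition with the flow from time `s` to time `t`. -/
def pull (hv : IsVelocityField L v) (hψ : IsFlowMap v ψ) {s t : ℝ} (hs : s ∈ Icc (0 : ℝ) 1)
    (ht : t ∈ Icc (0 : ℝ) 1) : L2 →ₗᵢ[ℝ] L2 :=
  compL2 (measurePreserving_flowBetween hv hψ hs ht)

variable (hv : IsVelocityField L v) (hψ : IsFlowMap v ψ)

theorem pull_pull {r s t : ℝ} (hr : r ∈ Icc (0 : ℝ) 1) (hs : s ∈ Icc (0 : ℝ) 1)
    (ht : t ∈ Icc (0 : ℝ) 1) (g : L2) :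
    pull hv hψ hr hs (pull hv hψ hs ht g) = pull hv hψ hr ht g :=
  compL2_comp _ _ _ (fun z => flowBetween_trans hv hψ hs z) g

theorem pull_self {s : ℝ} (hs : s ∈ Icc (0 : ℝ) 1) (g : L2) : pull hv hψ hs hs g = g :=
  compL2_id _ (fun z => flowBetween_self hv hψ hs z) g

theorem EnergyLE.pull {g : L2} {B : ℝ} (hg : EnergyLE g B) {s t : ℝ} (hs : s ∈ Icc (0 : ℝ) 1)
    (ht : t ∈ Icc (0 : ℝ) 1) :
    EnergyLE (pull hv hψ hs ht g) (4 * Real.exp L ^ 2 * B) := by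
  have := hg.comp (lipschitz_flowBetween_exp hv hψ hs ht)
    (measurePreserving_flowBetween hv hψ hs ht)
  rwa [Real.coe_toNNReal _ (Real.exp_nonneg _)] at this

/-- Integrals along the flow against the pull-back of `φ`, expressed at the current time. -/
theorem integral_flow_mul_pull {r : ℝ} (hr : r ∈ Icc (0 : ℝ) 1) (φ : L2) (g : C(Torus2, ℝ)) :
    ∫ z, g (ψ r z) * pull hv hψ (left_mem_Icc.2 zero_le_one) (right_mem_Icc.2 zero_le_one) φ z
        ∂torusMeasure =
      inner ℝ (toL2 g) (pull hv hψ hr (right_mem_Icc.2 zero_le_one) φ) := by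
  have h0 : (0 : ℝ) ∈ Icc (0 : ℝ) 1 := left_mem_Icc.2 zero_le_one
  rw [← pull_pull hv hψ h0 hr (right_mem_Icc.2 zero_le_one),
    ← (pull hv hψ h0 hr).inner_map_map (toL2 g)]
  generalize pull hv hψ h0 hr (pull hv hψ hr (right_mem_Icc.2 zero_le_one) φ) = θ
  rw [L2_inner_eq]
  have hmp := measurePreserving_flowBetween hv hψ h0 hr
  refine integral_congr_ae ?_
  filter_upwards [coeFn_compL2 hmp (toL2 g), hmp.quasiMeasurePreserving.ae
    (ContinuousMap.coeFn_toLp (p := 2) (𝕜 := ℝ) torusMeasure g)] with z h1 h2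
  rw [pull, h1, Function.comp_apply, h2, flowBetween_zero_left hv hψ]

variable {ν M : ℝ} {V : ℝ → Fin 2 → C(Torus2, ℝ)} {f : ℝ → L2} {D : ℝ → Fin 2 → L2}

/-- The coefficient `⟨eᵢ, φ ∘ flowBetween r 1⟩` is Lipschitz in `r`, hence absolutely continuous,
and has the derivative given by the transport equation. The initial time is shifted by `n`. -/
theorem coeff_pull_deriv (hV : ∀ s j z, V s j z = periodicExt v s z j) (n : ℕ) {s : ℝ}
    (hs : s ∈ Icc (0 : ℝ) 1) (φ : L2) (i : Mode) :
    ∃ b : ℝ → ℝ, (∀ r (hr : r ∈ Icc (0 : ℝ) 1),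
        b (n + r) = inner ℝ (trigL2 i) (pull hv hψ hr (right_mem_Icc.2 zero_le_one) φ)) ∧
      AbsolutelyContinuousOnInterval b ((n : ℝ) + s) (n + 1) ∧
      ∀ᵐ t : ℝ, t ∈ Ioo ((n : ℝ) + s) (n + 1) → ∀ hr : t - (n : ℝ) ∈ Icc (0 : ℝ) 1,
        HasDerivAt b (inner ℝ (advect (V t) fun j => toL2 (trigGrad i j))
          (pull hv hψ hr (right_mem_Icc.2 zero_le_one) φ)) t := by
  set θ := pull hv hψ (left_mem_Icc.2 zero_le_one) (right_mem_Icc.2 zero_le_one) φ with hθ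
  have hθi := L2_integrable θ
  set β : ℝ → ℝ := fun r => ∫ z, trig i (ψ r z) * θ z ∂torusMeasure with hβ
  obtain ⟨K, hK⟩ := (hasGrad_trig i).exists_lipschitz
  obtain ⟨M', hM0, -, hM⟩ := exists_dist_flow_le hv hψ
  have hsn : (n : ℝ) + s ≤ n + 1 := by linarith [hs.2]
  have hlip : ∀ r ∈ Icc (0 : ℝ) 1, ∀ q ∈ Icc (0 : ℝ) 1,
      |β r - β q| ≤ K * M' * (∫ z, |θ z| ∂torusMeasure) * |r - q| := by
    intro r hr q hq
    have hi : ∀ r ∈ Icc (0 : ℝ) 1, Integrable (fun z => trig i (ψ r z) * θ z) torusMeasure := by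
      intro r hr
      have := integrable_mul_continuous hθi
        ⟨fun z => trig i (ψ r z), (trig i).continuous.comp (continuous_flow hv hψ hr)⟩
      simpa [mul_comm] using this
    rw [hβ]
    simp only
    rw [← integral_sub (hi r hr) (hi q hq)]
    have h1 : ∀ z, ‖trig i (ψ r z) * θ z - trig i (ψ q z) * θ z‖ ≤ K * M' * |r - q| * |θ z| := by
      intro z
      rw [← sub_mul, norm_mul, Real.norm_eq_abs, Real.norm_eq_abs]
      refine mul_le_mul_of_nonneg_right ((hK _ _).trans ?_) (abs_nonneg _)
      rw [mul_assoc]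
      exact mul_le_mul_of_nonneg_left (hM q hq r hr z) K.coe_nonneg
    have h2 := norm_integral_le_of_norm_le (hθi.abs.const_mul (K * M' * |r - q|))
      (Eventually.of_forall h1)
    rw [integral_const_mul] at h2
    rw [Real.norm_eq_abs] at h2
    linarith
  have hAC : AbsolutelyContinuousOnInterval (fun t => β (t - n)) ((n : ℝ) + s) (n + 1) := by
    have h1 : LipschitzOnWith (Real.toNNReal (K * M' * (∫ z, |θ z| ∂torusMeasure)))
        (fun t => β (t - n)) (uIcc ((n : ℝ) + s) (n + 1)) := by
      refine LipschitzOnWith.of_dist_le_mul fun x hx y hy => ?_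
      rw [uIcc_of_le hsn] at hx hy
      rw [Real.coe_toNNReal _ (mul_nonneg (by positivity)
        (integral_nonneg fun _ => abs_nonneg _)), Real.dist_eq, Real.dist_eq]
      have := hlip (x - n) ⟨by linarith [hx.1, hs.1], by linarith [hx.2]⟩ (y - n)
        ⟨by linarith [hy.1, hs.1], by linarith [hy.2]⟩
      rwa [sub_sub_sub_cancel_right] at this
    exact h1.absolutelyContinuousOnInterval
  refine ⟨fun t => β (t - n), ?_, hAC, ?_⟩
  · intro r hr
    simp only [add_sub_cancel_left, hβ]
    exact integral_flow_mul_pull hv hψ hr φ (trig i)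
  · filter_upwards [hAC.ae_differentiableAt] with t ht ht' hr
    have hdiff := (ht (by rw [uIcc_of_le hsn]; exact Ioo_subset_Icc_self ht')).hasDerivAt
    have hr' : t - n ∈ Ico (0 : ℝ) 1 := ⟨hr.1, by linarith [ht'.2]⟩
    have h1 := hasDerivWithinAt_integral_flow hv hψ (hasGrad_trig i) hθi (Y := id) continuous_id hr'
    have hfr : Int.fract t = t - n := by
      rw [Int.fract_eq_iff]; exact ⟨hr'.1, hr'.2, n, by push_cast; ring⟩
    have h2 : ∫ z, (∑ j, v (t - n) (ψ (t - n) (id z)) j * trigGrad i j (ψ (t - n) (id z))) * θ z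
        ∂torusMeasure = inner ℝ (advect (V t) fun j => toL2 (trigGrad i j))
          (pull hv hψ hr (right_mem_Icc.2 zero_le_one) φ) := by
      have h3 : advect (V t) (fun j => toL2 (trigGrad i j)) =
          toL2 (∑ j, V t j * trigGrad i j) := by
        simp only [advect, mulL2_toL2, map_sum]
      rw [h3, ← integral_flow_mul_pull hv hψ hr]
      refine integral_congr_ae (Eventually.of_forall fun z => ?_)
      simp only [id, ContinuousMap.coe_sum, Finset.sum_apply, ContinuousMap.coe_mul, Pi.mul_apply,
        hV, periodicExt, hfr]
      rw [hθ]
    rw [h2] at h1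
    have h4 : HasDerivWithinAt (fun t => β (t - n)) (inner ℝ (advect (V t) fun j =>
        toL2 (trigGrad i j)) (pull hv hψ hr (right_mem_Icc.2 zero_le_one) φ)) (Ici t) t := by
      have h5 : HasDerivWithinAt (fun t : ℝ => t - n) 1 (Ici t) t :=
        (hasDerivWithinAt_id t _).sub_const _
      have h6 := HasDerivWithinAt.scomp (h := fun t : ℝ => t - n) t h1 h5
        (fun x hx => by simpa using hx)
      rw [one_smul] at h6
      exact h6
    rwa [(uniqueDiffWithinAt_Ici t).eq_deriv _ hdiff.hasDerivWithinAt h4] at hdiff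

/-- Over the rest of a period, pairing the solution with `φ` differs from pairing it with the
transported `φ` only through diffusion. -/
theorem IsEvolution.abs_inner_sub_inner_pull_le (h : IsEvolution ν M V f D) (hν : 0 ≤ ν)
    (hV : ∀ s j z, V s j z = periodicExt v s z j) (n : ℕ) {s : ℝ} (hs : s ∈ Icc (0 : ℝ) 1)
    {φ : L2} {B : ℝ} (hφ : EnergyLE φ B) :
    |inner ℝ (f (n + 1)) φ -
        inner ℝ (f (n + s)) (pull hv hψ hs (right_mem_Icc.2 zero_le_one) φ)| ≤
      ν * (2 * Real.exp L * √B) * ∫ r in (n : ℝ)..(n + 1), gradNorm (D r) := by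
  have h1I : (1 : ℝ) ∈ Icc (0 : ℝ) 1 := right_mem_Icc.2 zero_le_one
  have hn : (0 : ℝ) ≤ n := n.cast_nonneg
  have hsn : (n : ℝ) + s ≤ n + 1 := by linarith [hs.2]
  have hns : (0 : ℝ) ≤ n + s := by linarith [hs.1]
  have hM : 0 ≤ M := (norm_nonneg _).trans (h.norm_le 0 0)
  have hmem : ∀ t : ℝ, t ∈ Ioo ((n : ℝ) + s) ((n : ℝ) + 1) → t - (n : ℝ) ∈ Icc (0 : ℝ) 1 :=
    fun t ht =>
    ⟨by linarith [ht.1, hs.1], by linarith [ht.2]⟩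
  choose b hb hbAC hbd using fun i => coeff_pull_deriv hv hψ hV n hs φ i
  set A : Finset Mode → ℝ → ℝ := fun F t => ∑ i ∈ F, inner ℝ (trigL2 i) (f t) * b i t with hA
  set A' : Finset Mode → ℝ → ℝ := fun F t => ∑ i ∈ F,
    (-(inner ℝ (trigL2 i) (advect (V t) (D t)) + ν * (i.eig * inner ℝ (trigL2 i) (f t))) * b i t +
      inner ℝ (trigL2 i) (f t) * deriv (b i) t) with hA'
  have hbd' : ∀ᵐ t : ℝ, ∀ i, t ∈ Ioo ((n : ℝ) + s) (n + 1) → ∀ hr : t - (n : ℝ) ∈ Icc (0 : ℝ) 1,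
        HasDerivAt (b i) (inner ℝ (advect (V t) fun j => toL2 (trigGrad i j))
          (pull hv hψ hr h1I φ)) t := ae_all_iff.2 hbd
  have hAd : ∀ F, ∀ᵐ t : ℝ, t ∈ Ioo ((n : ℝ) + s) (n + 1) → HasDerivAt (A F) (A' F t) t := by
    intro F
    filter_upwards [ae_Ioi h.hasDeriv, hbd'] with t ht hbt ht'
    refine HasDerivAt.fun_sum fun i _ => ?_
    have h2 := hbt i ht' (hmem t ht')
    rw [h2.deriv]
    exact (ht (hns.trans_lt ht'.1) i).fun_mul h2
  have hac : ∀ i, AbsolutelyContinuousOnInterval (fun t => inner ℝ (trigL2 i) (f t))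
      ((n : ℝ) + s) (n + 1) := by
    intro i
    refine (h.absCont (n + 1) (by linarith) i).mono ?_
    rw [uIcc_of_le hsn, uIcc_of_le (by linarith)]
    exact Icc_subset_Icc_left hns
  have hAi := fun F => integral_eq_sub_of_absCont hsn
    (AbsolutelyContinuousOnInterval.finsetSum F fun i => (hac i).fun_mul (hbAC i)) (hAd F)
  have hlimA : ∀ r (hr : r ∈ Icc (0 : ℝ) 1), Tendsto (fun F => A F (n + r)) atTop
      (𝓝 (inner ℝ (f (n + r)) (pull hv hψ hr h1I φ))) := by
    intro r hr
    have := trigL2_isParsevalFrame.hasSum_inner_mul_inner (f (n + r)) (pull hv hψ hr h1I φ)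
    simp only [← hb] at this
    exact this
  -- the derivative, as advection error plus diffusion
  have hform : ∀ᵐ t : ℝ, t ∈ Ioo ((n : ℝ) + s) (n + 1) → ∀ hr : t - (n : ℝ) ∈ Icc (0 : ℝ) 1, ∀ F,
      A' F t = inner ℝ (advect (V t) fun j => toL2 (truncGrad F (f t) j)) (pull hv hψ hr h1I φ) -
        inner ℝ (toL2 (trunc F (advect (V t) (D t)))) (pull hv hψ hr h1I φ) -
        ν * ∑ i ∈ F, i.eig * (inner ℝ (trigL2 i) (f t) *
          inner ℝ (trigL2 i) (pull hv hψ hr h1I φ)) := by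
    filter_upwards [hbd'] with t hbt ht' hr F
    have h2 : advect (V t) (fun j => toL2 (truncGrad F (f t) j)) =
        ∑ i ∈ F, inner ℝ (trigL2 i) (f t) • advect (V t) fun j => toL2 (trigGrad i j) := by
      simp only [advect, truncGrad, map_sum, map_smul, Finset.smul_sum]
      rw [Finset.sum_comm]
    rw [h2, sum_inner, inner_toL2_trunc, Finset.mul_sum, ← Finset.sum_sub_distrib,
      ← Finset.sum_sub_distrib]
    refine Finset.sum_congr rfl fun i _ => ?_
    have h3 := hb i (t - n) hr
    rw [add_sub_cancel] at h3
    rw [(hbt i ht' hr).deriv, h3, real_inner_smul_left]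
    ring
  have hEpull : ∀ r (hr : r ∈ Icc (0 : ℝ) 1), EnergyLE (pull hv hψ hr h1I φ)
      (4 * Real.exp L ^ 2 * B) := fun r hr => hφ.pull hv hψ hr h1I
  have hsqrt := sqrt_four_mul_exp_sq_mul L B
  set c := 2 * Real.exp L * √B with hc
  have hc0 : 0 ≤ c := by positivity
  have hne : ∀ᵐ t : ℝ, t ≠ n + 1 := by simp [ae_iff]
  have hbound : ∀ t (hr : t - (n : ℝ) ∈ Icc (0 : ℝ) 1), IsWeakGradL2 (f t) (D t) →
      ∀ F : Finset Mode,
      |∑ i ∈ F, i.eig * (inner ℝ (trigL2 i) (f t) *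
          inner ℝ (trigL2 i) (pull hv hψ hr h1I φ))| ≤ gradNorm (D t) * c := by
    intro t hr hw F
    have := hw.energyLE.abs_sum_le (hEpull _ hr) F (m := Mode.eig)
      fun i => (abs_of_nonneg i.eig_nonneg).le
    rwa [hsqrt, Real.sqrt_sq (gradNorm_nonneg _)] at this
  -- the limit of the diffusion term
  set E : ℝ → ℝ := fun t => ∑' i : Mode, i.eig * (inner ℝ (trigL2 i) (f t) * b i t) with hE
  have hElim : ∀ t (hr : t - (n : ℝ) ∈ Icc (0 : ℝ) 1), IsWeakGradL2 (f t) (D t) →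
      Tendsto (fun F : Finset Mode => ∑ i ∈ F, i.eig * (inner ℝ (trigL2 i) (f t) *
          inner ℝ (trigL2 i) (pull hv hψ hr h1I φ))) atTop (𝓝 (E t)) := by
    intro t hr hw
    have h3 : ∀ i, b i t = inner ℝ (trigL2 i) (pull hv hψ hr h1I φ) := fun i => by
      have := hb i (t - n) hr
      rwa [add_sub_cancel] at this
    simp only [← h3]
    refine Summable.hasSum ?_
    have s1 : Summable fun i : Mode => i.eig * inner ℝ (trigL2 i) (f t) ^ 2 :=
      summable_of_sum_le (fun i => mul_nonneg i.eig_nonneg (sq_nonneg _)) hw.energyLE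
    have s2 : Summable fun i : Mode => i.eig * b i t ^ 2 := by
      simp only [h3]
      exact summable_of_sum_le (fun i => mul_nonneg i.eig_nonneg (sq_nonneg _)) (hEpull _ hr)
    refine Summable.of_norm_bounded (s1.add s2) fun i => ?_
    rw [norm_mul, Real.norm_of_nonneg i.eig_nonneg, ← mul_add]
    refine mul_le_mul_of_nonneg_left ?_ i.eig_nonneg
    rw [Real.norm_eq_abs, abs_le]
    constructor <;> nlinarith [sq_nonneg (inner ℝ (trigL2 i) (f t) + b i t),
      sq_nonneg (inner ℝ (trigL2 i) (f t) - b i t), sq_nonneg (b i t)]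
  have hEle : ∀ t (hr : t - (n : ℝ) ∈ Icc (0 : ℝ) 1), IsWeakGradL2 (f t) (D t) →
      |E t| ≤ gradNorm (D t) * c := fun t hr hw =>
    le_of_tendsto (hElim t hr hw).abs (Eventually.of_forall fun F => hbound t hr hw F)
  have hlim := intervalIntegral.tendsto_integral_filter_of_dominated_convergence
    (μ := volume) (a := n + s) (b := n + 1) (l := atTop) (F := A') (f := fun t => -(ν * E t))
    (fun t => 4 * M * gradNorm (D t) * ‖φ‖ + ν * (gradNorm (D t) * c)) ?_ ?_ ?_ ?_
  · have h2 := tendsto_nhds_unique hlim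
      (((hlimA 1 h1I).sub (hlimA s hs)).congr fun F => (hAi F).2.symm)
    rw [pull_self] at h2
    rw [← h2, ← Real.norm_eq_abs]
    have i1 := h.intervalIntegrable hns hsn
    have h3 := intervalIntegral.norm_integral_le_of_norm_le (f := fun t => -(ν * E t))
      (g := fun t => ν * c * gradNorm (D t)) hsn (μ := volume) ?_ (i1.const_mul _)
    · refine h3.trans ?_
      rw [intervalIntegral.integral_const_mul]
      refine mul_le_mul_of_nonneg_left ?_ (by positivity)
      have h4 := intervalIntegral.integral_add_adjacent_intervals
        (h.intervalIntegrable hn (by linarith [hs.1])) i1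
      have h5 : 0 ≤ ∫ r in (n : ℝ)..(n + s), gradNorm (D r) :=
        intervalIntegral.integral_nonneg (by linarith [hs.1]) fun _ _ => gradNorm_nonneg _
      linarith
    · filter_upwards [ae_Ioi h.weakGrad] with t hw ht
      have hr : t - (n : ℝ) ∈ Icc (0 : ℝ) 1 := ⟨by linarith [ht.1, hs.1], by linarith [ht.2]⟩
      rw [norm_neg, norm_mul, Real.norm_of_nonneg hν, mul_assoc, mul_comm c]
      exact mul_le_mul_of_nonneg_left (hEle t hr (hw (hns.trans_lt ht.1))) hν
  · exact Eventually.of_forall fun F =>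
      (intervalIntegrable_iff.1 (hAi F).1).aestronglyMeasurable
  · refine Eventually.of_forall fun F => ?_
    filter_upwards [ae_Ioi h.weakGrad, hform, hne] with t hw hf ht1 ht
    rw [uIoc_of_le hsn] at ht
    have ht' : t ∈ Ioo ((n : ℝ) + s) (n + 1) := ⟨ht.1, lt_of_le_of_ne ht.2 ht1⟩
    have hr := hmem t ht'
    have hw' := hw (hns.trans_lt ht.1)
    rw [hf ht' hr F]
    have hnorm : ‖pull hv hψ hr h1I φ‖ = ‖φ‖ := LinearIsometry.norm_map _ _
    have e1 : |inner ℝ (advect (V t) fun j => toL2 (truncGrad F (f t) j))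
        (pull hv hψ hr h1I φ)| ≤ 2 * M * gradNorm (D t) * ‖φ‖ := by
      refine (abs_real_inner_le_norm _ _).trans ?_
      rw [hnorm]
      refine mul_le_mul_of_nonneg_right ((norm_advect_le_gradNorm (h.norm_le t) _).trans ?_)
        (norm_nonneg _)
      exact mul_le_mul_of_nonneg_left (gradNorm_truncGrad_le hw' F) (by positivity)
    have e2 : |inner ℝ (toL2 (trunc F (advect (V t) (D t))))
        (pull hv hψ hr h1I φ)| ≤ 2 * M * gradNorm (D t) * ‖φ‖ := by
      refine (abs_real_inner_le_norm _ _).trans ?_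
      rw [hnorm]
      exact mul_le_mul_of_nonneg_right ((norm_toL2_trunc_le F _).trans
        (norm_advect_le_gradNorm (h.norm_le t) _)) (norm_nonneg _)
    have e3 := mul_le_mul_of_nonneg_left (hbound t hr hw' F) hν
    have e4 : ∀ x y z : ℝ, |x - y - ν * z| ≤ |x| + |y| + ν * |z| := by
      intro x y z
      refine (abs_sub _ _).trans ?_
      rw [abs_mul, abs_of_nonneg hν]
      linarith [abs_sub x y]
    rw [Real.norm_eq_abs]
    refine (e4 _ _ _).trans ?_
    linarith
  · have i1 := h.intervalIntegrable hns hsn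
    exact ((i1.const_mul _).mul_const _).add ((i1.mul_const _).const_mul _)
  · filter_upwards [ae_Ioi h.weakGrad, hform, hne] with t hw hf ht1 ht
    rw [uIoc_of_le hsn] at ht
    have ht' : t ∈ Ioo ((n : ℝ) + s) (n + 1) := ⟨ht.1, lt_of_le_of_ne ht.2 ht1⟩
    have hr := hmem t ht'
    have hw' := hw (hns.trans_lt ht.1)
    simp only [hf ht' hr]
    have l1 : Tendsto (fun F => inner ℝ (advect (V t) fun j => toL2 (truncGrad F (f t) j))
        (pull hv hψ hr h1I φ)) atTop (𝓝 (inner ℝ (advect (V t) (D t)) (pull hv hψ hr h1I φ))) :=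
      (tendsto_advect (V t) fun j => tendsto_truncGrad hw' j).inner tendsto_const_nhds
    have l2 : Tendsto (fun F => inner ℝ (toL2 (trunc F (advect (V t) (D t))))
        (pull hv hψ hr h1I φ)) atTop (𝓝 (inner ℝ (advect (V t) (D t)) (pull hv hψ hr h1I φ))) :=
      (tendsto_trunc _).inner tendsto_const_nhds
    have l3 := (l1.sub l2).sub ((hElim t hr hw').const_mul ν)
    rwa [sub_self, zero_sub] at l3

end

/-! ### Spectral form of the heat semigroup -/

/-- Integration by parts on the torus. -/
theorem inner_toL2_integrationByParts {g h : C(Torus2, ℝ)} {Γ Δ : Fin 2 → C(Torus2, ℝ)}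
    (hg : HasGrad g Γ) (hh : HasGrad h Δ) (j : Fin 2) :
    inner ℝ (toL2 g) (toL2 (Δ j)) = -inner ℝ (toL2 (Γ j)) (toL2 h) := by
  -- the integral of a derivative vanishes; polarize this for squares
  have key : ∀ {g : C(Torus2, ℝ)} {Γ : Fin 2 → C(Torus2, ℝ)}, HasGrad g Γ →
      inner ℝ (toL2 g) (toL2 (Γ j)) = 0 := by
    intro g Γ hg
    have h1 := tendsto_inner_diffQuot hg.sq 1 j
    have h2 : ∀ s, diffQuot 1 j s = 0 := fun s => by ext z; simp [diffQuot]
    simp only [h2, map_zero, inner_zero_right] at h1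
    have h3 := tendsto_nhds_unique h1 tendsto_const_nhds
    rw [map_smul, real_inner_smul_left, real_inner_comm, inner_toL2_toL2] at h3
    rw [real_inner_comm, inner_toL2_toL2]
    simp only [ContinuousMap.coe_mul, Pi.mul_apply, ContinuousMap.one_apply, mul_one] at h3
    linarith
  have h1 := key (hg.add hh)
  have h2 := key hg
  have h3 := key hh
  simp only [Pi.add_apply, map_add, inner_add_left, inner_add_right] at h1
  rw [real_inner_comm (toL2 h)]
  linarith

/-- Symmetry of the Laplacian on the trigonometric functions. -/
theorem eig_mul_inner_trigL2 (i l : Mode) :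
    i.eig * inner ℝ (trigL2 i) (trigL2 l) = l.eig * inner ℝ (trigL2 i) (trigL2 l) := by
  have h1 : ∀ (i l : Mode) (j : Fin 2), l.freq j * inner ℝ (trigL2 i) (trigL2 l.flip) =
      -(i.freq j * inner ℝ (trigL2 i.flip) (trigL2 l)) := by
    intro i l j
    have := inner_toL2_integrationByParts (hasGrad_trig i) (hasGrad_trig l) j
    rwa [toL2_trigGrad, toL2_trigGrad, real_inner_smul_left, real_inner_smul_right] at this
  simp only [Mode.eig, Finset.sum_mul]
  refine Finset.sum_congr rfl fun j _ => ?_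
  have h2 := h1 i l.flip j
  have h3 := h1 i.flip l j
  simp only [Mode.flip_flip, Mode.freq_flip] at h2 h3
  linear_combination (-i.freq j) * h3 + (l.freq j) * h2

/-- The factor by which the heat semigroup at time `ν` multiplies the mode `i`. -/
def heatFactor (ν : ℝ) (i : Mode) : ℝ := Real.exp (-(ν * i.eig))

theorem heatFactor_pos (ν : ℝ) (i : Mode) : 0 < heatFactor ν i := Real.exp_pos _

/-- Distinct modes need not be orthogonal, but they are if their eigenvalues differ. -/
theorem heatFactor_mul_inner (ν : ℝ) (i l : Mode) :
    heatFactor ν i * inner ℝ (trigL2 i) (trigL2 l) =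
      heatFactor ν l * inner ℝ (trigL2 i) (trigL2 l) := by
  by_cases h : inner ℝ (trigL2 i) (trigL2 l) = 0
  · rw [h, mul_zero, mul_zero]
  · rw [heatFactor, heatFactor, mul_right_cancel₀ h (eig_mul_inner_trigL2 i l)]

theorem eig_eq (i : Mode) :
    i.eig = 4 * Real.pi ^ 2 * (i.1 0 : ℝ) ^ 2 + 4 * Real.pi ^ 2 * (i.1 1 : ℝ) ^ 2 := by
  rcases i with ⟨k, _ | _⟩ <;> simp [Mode.eig, Mode.freq, Fin.sum_univ_two] <;> ring

theorem summable_int_heat {ν : ℝ} (hν : 0 < ν) :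
    Summable fun n : ℤ => Real.exp (-Real.pi * n ^ 2 * (4 * Real.pi * ν)) := by
  have := (HurwitzZeta.hasSum_int_evenKernel 0
    (t := 4 * Real.pi * ν) (by positivity)).summable
  simpa using this

theorem summable_heatFactor {ν : ℝ} (hν : 0 < ν) : Summable (heatFactor ν) := by
  have h1 := summable_int_heat hν
  have h2 := h1.mul_of_nonneg h1 (fun _ => (Real.exp_pos _).le) fun _ => (Real.exp_pos _).le
  have h3 : Summable fun k : Fin 2 → ℤ => heatFactor ν (k, false) := by
    refine ((finTwoArrowEquiv ℤ).summable_iff.2 h2).congr fun k => ?_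
    have hk : finTwoArrowEquiv ℤ k = (k 0, k 1) := rfl
    simp only [heatFactor, eig_eq, Function.comp_apply, hk, ← Real.exp_add]
    congr 1
    ring
  rw [summable_prod_of_nonneg fun i => (heatFactor_pos ν i).le]
  refine ⟨fun k => Summable.of_finite, ?_⟩
  simp only [tsum_fintype, Fintype.sum_bool]
  exact (h3.add h3).congr fun k => by simp only [heatFactor, eig_eq]

theorem coe_coord (z : Torus2) (j : Fin 2) : ((coord z j : ℝ) : UnitAddCircle) = z j :=
  AddCircle.coe_equivIco

theorem heatKernel_eq_evenKernel {ν : ℝ} (hν : 0 < ν) (z : Torus2) :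
    heatKernel ν z = (4 * Real.pi * ν)⁻¹ *
      (HurwitzZeta.evenKernel (z 0) (1 / (4 * Real.pi * ν)) *
        HurwitzZeta.evenKernel (z 1) (1 / (4 * Real.pi * ν))) := by
  have ht : 0 < 1 / (4 * Real.pi * ν) := by positivity
  have hg : ∀ j, HasSum (fun n : ℤ => Real.exp (-(coord z j + n) ^ 2 / (4 * ν)))
      (HurwitzZeta.evenKernel (z j) (1 / (4 * Real.pi * ν))) := by
    intro j
    have := HurwitzZeta.hasSum_int_evenKernel (coord z j) ht
    rw [coe_coord] at this
    refine this.congr_fun fun n => ?_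
    congr 1
    field_simp
    ring
  have hG := (hg 0).mul (hg 1) ((hg 0).summable.mul_of_nonneg (hg 1).summable
    (fun _ => (Real.exp_pos _).le) fun _ => (Real.exp_pos _).le)
  rw [heatKernel, tsum_mul_left, ← hG.tsum_eq, ← (finTwoArrowEquiv ℤ).tsum_eq]
  congr 1
  refine tsum_congr fun k => ?_
  have hk : finTwoArrowEquiv ℤ k = (k 0, k 1) := rfl
  rw [hk, ← Real.exp_add, Fin.sum_univ_two]
  congr 1
  ring

theorem heatKernel_eq_cosKernel {ν : ℝ} (hν : 0 < ν) (z : Torus2) :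
    heatKernel ν z = HurwitzZeta.cosKernel (z 0) (4 * Real.pi * ν) *
      HurwitzZeta.cosKernel (z 1) (4 * Real.pi * ν) := by
  have ht : 0 < 1 / (4 * Real.pi * ν) := by positivity
  rw [heatKernel_eq_evenKernel hν, HurwitzZeta.evenKernel_functional_equation,
    HurwitzZeta.evenKernel_functional_equation, one_div_one_div, ← Real.sqrt_eq_rpow]
  generalize HurwitzZeta.cosKernel (z 0) (4 * Real.pi * ν) = A
  generalize HurwitzZeta.cosKernel (z 1) (4 * Real.pi * ν) = B
  obtain ⟨s, h0, h1, h2⟩ : ∃ s : ℝ, s ≠ 0 ∧ s * s = 1 / (4 * Real.pi * ν) ∧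
      √(1 / (4 * Real.pi * ν)) = s :=
    ⟨_, (Real.sqrt_pos.2 ht).ne', Real.mul_self_sqrt ht.le, rfl⟩
  rw [h2, ← one_div (4 * Real.pi * ν), ← h1]
  field_simp

theorem hasSum_fourier_cosKernel {ν : ℝ} (hν : 0 < ν) (a : UnitAddCircle) :
    HasSum (fun n : ℤ => fourier n a *
      ((Real.exp (-Real.pi * n ^ 2 * (4 * Real.pi * ν)) : ℝ) : ℂ))
      (HurwitzZeta.cosKernel a (4 * Real.pi * ν) : ℂ) := by
  induction a using QuotientAddGroup.induction_on with
  | H x =>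
    refine (HurwitzZeta.hasSum_int_cosKernel x (by positivity)).congr_fun fun n => ?_
    have h1 := fourier_coe_apply (T := 1) (n := n) (x := x)
    refine congrArg₂ _ (h1.trans ?_) rfl
    congr 1
    push_cast
    ring

theorem hasSum_pi_mul {c d : ℤ → ℂ} {a b : ℂ} (hc : HasSum c a) (hd : HasSum d b)
    (hc' : Summable fun n => ‖c n‖) (hd' : Summable fun n => ‖d n‖) :
    HasSum (fun k : Fin 2 → ℤ => c (k 0) * d (k 1)) (a * b) :=
  (finTwoArrowEquiv ℤ).hasSum_iff.2 (hc.mul hd (summable_mul_of_summable_norm hc' hd'))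

/-- Poisson summation: the Fourier series of the periodized heat kernel. -/
theorem hasSum_heatKernel {ν : ℝ} (hν : 0 < ν) (z : Torus2) :
    HasSum (fun k : Fin 2 → ℤ => heatFactor ν (k, false) * trig (k, false) z)
      (heatKernel ν z) := by
  have hn : ∀ a : UnitAddCircle, Summable fun n : ℤ => ‖fourier n a *
      ((Real.exp (-Real.pi * n ^ 2 * (4 * Real.pi * ν)) : ℝ) : ℂ)‖ := by
    intro a
    refine (summable_int_heat hν).congr fun n => ?_
    rw [norm_mul, Complex.norm_real, Real.norm_of_nonneg (Real.exp_pos _).le, fourier_apply,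
      Circle.norm_coe, one_mul]
  have hR := Complex.hasSum_re (hasSum_pi_mul (hasSum_fourier_cosKernel hν (z 0))
    (hasSum_fourier_cosKernel hν (z 1)) (hn _) (hn _))
  rw [← Complex.ofReal_mul, Complex.ofReal_re, ← heatKernel_eq_cosKernel hν] at hR
  refine hR.congr_fun fun k => ?_
  have hm : mFourier k z = fourier (k 0) (z 0) * fourier (k 1) (z 1) :=
    Fin.prod_univ_two fun j => fourier (k j) (z j)
  rw [trig_false, hm, mul_mul_mul_comm, ← Complex.ofReal_mul,
    Complex.re_mul_ofReal, ← Real.exp_add, mul_comm, heatFactor, eig_eq]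
  congr 2
  ring

/-- The addition theorem for the cosine. -/
theorem trig_false_sub (k : Fin 2 → ℤ) (z w : Torus2) :
    trig (k, false) (z - w) = ∑ b : Bool, trig (k, b) z * trig (k, b) w := by
  have h : mFourier k (-w) = (starRingEnd ℂ) (mFourier k w) := by
    rw [← mFourier_neg]
    simp [mFourier, fourier_apply]
  rw [trig_false, sub_eq_add_neg, mFourier_apply_add, h, Fintype.sum_bool]
  simp only [trig_false, trig_true, Complex.mul_re, Complex.conj_re, Complex.conj_im]
  ring

theorem norm_trig_le (i : Mode) : ‖trig i‖ ≤ 1 :=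
  (ContinuousMap.norm_le _ zero_le_one).2 (abs_trig_le i)

theorem summable_smul_trig {ν : ℝ} (hν : 0 < ν) {c : Mode → ℝ} {C : ℝ} (hc : ∀ i, |c i| ≤ C) :
    Summable fun i => (heatFactor ν i * c i) • trig i := by
  refine Summable.of_norm_bounded ((summable_heatFactor hν).mul_right C) fun i => ?_
  rw [norm_smul, Real.norm_eq_abs, abs_mul, abs_of_pos (heatFactor_pos ν i)]
  refine (mul_le_of_le_one_right (mul_nonneg (heatFactor_pos ν i).le (abs_nonneg _))
    (norm_trig_le i)).trans ?_
  exact mul_le_mul_of_nonneg_left (hc i) (heatFactor_pos ν i).le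

/-- The image of `g` under the heat semigroup at time `ν`, as a Fourier series. -/
def heatCont (ν : ℝ) (g : L2) : C(Torus2, ℝ) :=
  ∑' i, (heatFactor ν i * inner ℝ (trigL2 i) g) • trig i

theorem abs_inner_trigL2_le (i : Mode) (g : L2) : |inner ℝ (trigL2 i) g| ≤ ‖g‖ := by
  refine (abs_real_inner_le_norm _ _).trans ?_
  exact mul_le_of_le_one_left (norm_nonneg _) ((norm_toL2_le _).trans (norm_trig_le i))

theorem hasSum_heatCont {ν : ℝ} (hν : 0 < ν) (g : L2) :
    HasSum (fun i => (heatFactor ν i * inner ℝ (trigL2 i) g) • trig i) (heatCont ν g) :=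
  (summable_smul_trig hν fun i => abs_inner_trigL2_le i g).hasSum

/-- Convolution with the periodized heat kernel is the Fourier multiplier `heatFactor ν`. -/
theorem heat_eq {ν : ℝ} (hν : 0 < ν) {g : Torus2 → ℝ} (hg : MemLp g 2 torusMeasure) :
    heat ν g = heatCont ν (hg.toLp g) := by
  ext z
  set G : L2 := hg.toLp g with hG
  have h1 : Summable fun i => (heatFactor ν i * trig i z) • trig i :=
    summable_smul_trig hν fun i => abs_trig_le i z
  set κ : C(Torus2, ℝ) := ∑' i, (heatFactor ν i * trig i z) • trig i with hκ
  have h2 : ∀ w, κ w = heatKernel ν (z - w) := by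
    intro w
    have h3 := h1.hasSum.mapL (ContinuousMap.evalCLM ℝ w)
    simp only [ContinuousMap.evalCLM_apply, ContinuousMap.smul_apply, smul_eq_mul] at h3
    have h4 := h3.prod_fiberwise fun k => hasSum_fintype _
    refine h4.unique ?_
    refine (hasSum_heatKernel hν (z - w)).congr_fun fun k => ?_
    rw [trig_false_sub, Finset.mul_sum]
    refine Finset.sum_congr rfl fun b _ => ?_
    simp only [heatFactor, eig_eq]
    ring
  have h5 : heat ν g z = inner ℝ (toL2 κ) G := by
    rw [heat, inner_toL2]
    refine integral_congr_ae ?_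
    filter_upwards [hg.coeFn_toLp] with w hw
    rw [h2, hw, mul_comm]
  have h6 := ((h1.hasSum.mapL toL2).mapL (innerSL ℝ G))
  have h7 := (hasSum_heatCont hν G).mapL (ContinuousMap.evalCLM ℝ z)
  rw [h5]
  simp only [innerSL_apply_apply, map_smul, ContinuousMap.evalCLM_apply, smul_eq_mul] at h6 h7
  rw [real_inner_comm]
  refine h6.unique (h7.congr_fun fun i => ?_)
  rw [real_inner_comm, trigL2]
  ring

/-- The modes are not orthogonal, but non-orthogonal ones share their heat factor. -/
theorem inner_trigL2_heatCont {ν : ℝ} (hν : 0 < ν) (g : L2) (i : Mode) :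
    inner ℝ (trigL2 i) (toL2 (heatCont ν g)) = heatFactor ν i * inner ℝ (trigL2 i) g := by
  have h1 := ((hasSum_heatCont hν g).mapL toL2).mapL (innerSL ℝ (trigL2 i))
  have h2 := (trigL2_isParsevalFrame.hasSum_inner_mul_inner g (trigL2 i)).mul_left
    (heatFactor ν i)
  rw [real_inner_comm] at h2
  refine HasSum.unique ?_ h2
  refine h1.congr_fun fun l => ?_
  simp only [map_smul, innerSL_apply_apply, smul_eq_mul]
  have h3 := heatFactor_mul_inner ν l i
  rw [show toL2 (trig l) = trigL2 l from rfl, real_inner_comm (trigL2 l) (trigL2 i)]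
  linear_combination (-inner ℝ (trigL2 l) g) * h3

/-- The heat semigroup at time `ν`, from `L²` to `L²`. -/
def heatL2 (ν : ℝ) (g : L2) : L2 := toL2 (heatCont ν g)

variable {ν : ℝ}

theorem heatFactor_le_one (hν : 0 < ν) (i : Mode) : heatFactor ν i ≤ 1 :=
  Real.exp_le_one_iff.2 (neg_nonpos.2 (mul_nonneg hν.le i.eig_nonneg))

/-- Smoothing: the gradient after the heat flow is controlled by the dissipated energy. -/
theorem energyLE_heatL2 (hν : 0 < ν) (g : L2) :
    EnergyLE (heatL2 ν g) ((‖g‖ ^ 2 - ‖heatL2 ν g‖ ^ 2) / (2 * ν)) := by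
  intro F
  have h1 := sum_le_hasSum F (fun i _ => ?_)
    ((trigL2_isParsevalFrame g).sub (trigL2_isParsevalFrame (heatL2 ν g)))
  · rw [le_div_iff₀ (by positivity), Finset.sum_mul]
    refine le_trans (Finset.sum_le_sum fun i _ => ?_) h1
    rw [heatL2, inner_trigL2_heatCont hν]
    set x := ν * i.eig with hx
    have hx0 : 0 ≤ x := mul_nonneg hν.le i.eig_nonneg
    -- the elementary inequality behind the smoothing estimate, `e ^ (-2x) (1 + 2x) ≤ 1`
    have h2 : heatFactor ν i ^ 2 * (1 + 2 * x) ≤ 1 := by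
      have h3 : heatFactor ν i ^ 2 = Real.exp (-(2 * x)) := by
        rw [heatFactor, ← Real.exp_nat_mul]; congr 1; push_cast; ring
      have h4 := Real.add_one_le_exp (2 * x)
      rw [h3, Real.exp_neg, inv_mul_le_one₀ (Real.exp_pos _)]
      linarith
    have h5 := mul_le_mul_of_nonneg_right h2 (sq_nonneg (inner ℝ (trigL2 i) g))
    calc _ = (heatFactor ν i ^ 2 * (1 + 2 * x) - heatFactor ν i ^ 2) *
          inner ℝ (trigL2 i) g ^ 2 := by rw [hx]; ring
      _ ≤ _ := by linarith
  · rw [heatL2, inner_trigL2_heatCont hν]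
    have h3 : heatFactor ν i ^ 2 ≤ 1 :=
      pow_le_one₀ (heatFactor_pos ν i).le (heatFactor_le_one hν i)
    nlinarith [sq_nonneg (inner ℝ (trigL2 i) g)]

/-- The increment under the heat flow has no more Dirichlet energy than the function. -/
theorem EnergyLE.heatL2_sub_self (hν : 0 < ν) {g : L2} {B : ℝ} (hg : EnergyLE g B) :
    EnergyLE (heatL2 ν g - g) B := by
  refine fun F => (Finset.sum_le_sum fun i _ => ?_).trans (hg F)
  rw [inner_sub_right, heatL2, inner_trigL2_heatCont hν]
  refine mul_le_mul_of_nonneg_left ?_ i.eig_nonneg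
  have h1 := heatFactor_pos ν i
  have h2 := heatFactor_le_one hν i
  rw [show heatFactor ν i * inner ℝ (trigL2 i) g - inner ℝ (trigL2 i) g =
    (heatFactor ν i - 1) * inner ℝ (trigL2 i) g by ring, mul_pow]
  exact mul_le_of_le_one_left (sq_nonneg _) (by nlinarith)

/-- The multiplier `(1 - e ^ (-ν λ)) / ν` is dominated by `λ`. -/
theorem abs_inner_heatL2_sub_self_le (hν : 0 < ν) {g h : L2} {A B : ℝ} (hh : EnergyLE h A)
    (hg : EnergyLE g B) : |inner ℝ h (heatL2 ν g - g)| ≤ ν * (√A * √B) := by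
  have h1 := trigL2_isParsevalFrame.hasSum_inner_mul_inner h (heatL2 ν g - g)
  refine le_of_tendsto h1.abs (Eventually.of_forall fun F => ?_)
  have h2 := hh.abs_sum_le hg F (m := fun i => (heatFactor ν i - 1) / ν) fun i => ?_
  · have h3 : ∑ i ∈ F, inner ℝ (trigL2 i) h * inner ℝ (trigL2 i) (heatL2 ν g - g) =
        ν * ∑ i ∈ F, (heatFactor ν i - 1) / ν * (inner ℝ (trigL2 i) h * inner ℝ (trigL2 i) g) := by
      rw [Finset.mul_sum]
      refine Finset.sum_congr rfl fun i _ => ?_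
      rw [inner_sub_right, heatL2, inner_trigL2_heatCont hν]
      field_simp
    rw [h3, abs_mul, abs_of_pos hν]
    exact mul_le_mul_of_nonneg_left h2 hν.le
  · rw [abs_div, abs_of_pos hν, div_le_iff₀ hν,
      abs_of_nonpos (by linarith [heatFactor_le_one hν i])]
    have := Real.add_one_le_exp (-(ν * i.eig))
    rw [heatFactor]
    linarith

/-! ### Pulsed diffusion against the solution -/

section

variable {L : ℝ≥0} {v : ℝ → Torus2 → Plane} {ψ : ℝ → Torus2 → Torus2}
variable (hv : IsVelocityField L v) (hψ : IsFlowMap v ψ)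

theorem zero_mem_unit : (0 : ℝ) ∈ Icc (0 : ℝ) 1 := left_mem_Icc.2 zero_le_one

theorem one_mem_unit : (1 : ℝ) ∈ Icc (0 : ℝ) 1 := right_mem_Icc.2 zero_le_one

/-- One step of the pulsed diffusion, on `L²`. -/
def pulsedL2 (ν : ℝ) (g : L2) : L2 := heatL2 ν (pull hv hψ one_mem_unit zero_mem_unit g)

/-- The pulsed diffusion of functions acts on their classes in `L²` as `pulsedL2`. -/
theorem exists_memLp_pulsed {ν : ℝ} (hν : 0 < ν) {g : Torus2 → ℝ}
    (hg : MemLp g 2 torusMeasure) :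
    ∃ h : MemLp (pulsed ν ψ g) 2 torusMeasure, h.toLp _ = pulsedL2 hv hψ ν (hg.toLp g) := by
  have hfun : Function.invFun (ψ 1) = flowBetween ψ 1 0 :=
    funext fun z => (flowBetween_zero_right hψ z).symm
  have hmp := measurePreserving_flowBetween hv hψ one_mem_unit zero_mem_unit
  have hγ : MemLp (g ∘ Function.invFun (ψ 1)) 2 torusMeasure := by
    rw [hfun]; exact hg.comp_measurePreserving hmp
  have h1 : hγ.toLp _ = pull hv hψ one_mem_unit zero_mem_unit (hg.toLp g) := by
    refine Lp.ext ?_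
    filter_upwards [hγ.coeFn_toLp, coeFn_compL2 hmp (hg.toLp g),
      hmp.quasiMeasurePreserving.ae hg.coeFn_toLp] with z h1 h2 h3
    rw [h1, pull, h2, Function.comp_apply, Function.comp_apply, h3, hfun]
  have h2 := heat_eq hν hγ
  have h3 : MemLp (pulsed ν ψ g) 2 torusMeasure := by
    rw [pulsed, h2]
    exact (Lp.memLp (toL2 (heatCont ν (hγ.toLp _)))).ae_eq
      (ContinuousMap.coeFn_toLp (p := 2) (𝕜 := ℝ) torusMeasure _)
  refine ⟨h3, Lp.ext ?_⟩
  filter_upwards [h3.coeFn_toLp, ContinuousMap.coeFn_toLp (p := 2) (𝕜 := ℝ) torusMeasure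
    (heatCont ν (hγ.toLp _))] with z h4 h5
  rw [h4, pulsed, h2, pulsedL2, heatL2, ← h1, h5]

theorem exists_memLp_pulsed_iterate {ν : ℝ} (hν : 0 < ν) {g : Torus2 → ℝ}
    (hg : MemLp g 2 torusMeasure) (n : ℕ) :
    ∃ h : MemLp ((pulsed ν ψ)^[n] g) 2 torusMeasure,
      h.toLp _ = (pulsedL2 hv hψ ν)^[n] (hg.toLp g) := by
  induction n with
  | zero => exact ⟨hg, rfl⟩
  | succ n ih =>
    obtain ⟨h, hh⟩ := ih
    obtain ⟨h', hh'⟩ := exists_memLp_pulsed hv hψ hν h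
    simp only [Function.iterate_succ_apply']
    exact ⟨h', by rw [hh', hh]⟩

theorem norm_pulsedL2_iterate_le {ν : ℝ} (hν : 0 < ν) {n₀ : ℕ}
    (h : ∀ g : Torus2 → ℝ, MemLp g 2 torusMeasure → ∫ z, g z ∂torusMeasure = 0 →
      eLpNorm ((pulsed ν ψ)^[n₀] g) 2 torusMeasure ≤ (1 / 2) * eLpNorm g 2 torusMeasure)
    {g : L2} (hg : ∫ z, g z ∂torusMeasure = 0) :
    ‖(pulsedL2 hv hψ ν)^[n₀] g‖ ≤ 1 / 2 * ‖g‖ := by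
  obtain ⟨h1, h2⟩ := exists_memLp_pulsed_iterate hv hψ hν (Lp.memLp g) n₀
  have h3 := h g (Lp.memLp g) hg
  rw [Lp.toLp_coeFn] at h2
  rw [← h2, Lp.norm_toLp, Lp.norm_def]
  have h4 := ENNReal.toReal_mono (ENNReal.mul_ne_top (by simp) (Lp.memLp g).eLpNorm_ne_top) h3
  rw [ENNReal.toReal_mul] at h4
  simpa using h4

theorem norm_pull {s t : ℝ} (hs : s ∈ Icc (0 : ℝ) 1) (ht : t ∈ Icc (0 : ℝ) 1) (g : L2) :
    ‖pull hv hψ hs ht g‖ = ‖g‖ := LinearIsometry.norm_map _ _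

/-- The adjoint of composition with the flow is composition with the inverse flow. -/
theorem inner_pull_right {s t : ℝ} (hs : s ∈ Icc (0 : ℝ) 1) (ht : t ∈ Icc (0 : ℝ) 1) (g h : L2) :
    inner ℝ g (pull hv hψ hs ht h) = inner ℝ (pull hv hψ ht hs g) h := by
  rw [← (pull hv hψ hs ht).inner_map_map (pull hv hψ ht hs g), pull_pull, pull_self]

theorem inner_one_eq_integral (g : L2) : inner ℝ (toL2 1) g = ∫ z, g z ∂torusMeasure := by
  rw [inner_toL2]; simp

theorem integral_pull {s t : ℝ} (hs : s ∈ Icc (0 : ℝ) 1) (ht : t ∈ Icc (0 : ℝ) 1) (g : L2) :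
    ∫ z, pull hv hψ hs ht g z ∂torusMeasure = ∫ z, g z ∂torusMeasure := by
  rw [← inner_one_eq_integral, ← inner_one_eq_integral, inner_pull_right]
  have hmp := measurePreserving_flowBetween hv hψ ht hs
  have h1 : pull hv hψ ht hs (toL2 1) = toL2 1 :=
    compL2_toL2 (R := ⟨flowBetween ψ t s, continuous_flowBetween hv hψ ht hs⟩) hmp 1
  rw [h1]

variable {ν M : ℝ} {V : ℝ → Fin 2 → C(Torus2, ℝ)} {f : ℝ → L2} {D : ℝ → Fin 2 → L2}

/-- One period changes the pairing of the solution with the pulsed diffusion little, in terms of the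
gradients of both. -/
theorem IsEvolution.abs_inner_pulsedL2_sub_le (h : IsEvolution ν M V f D) (hν : 0 < ν)
    (hV : ∀ s j z, V s j z = periodicExt v s z j) (n : ℕ) {g : L2} {B : ℝ} (hg : EnergyLE g B) :
    |inner ℝ (f (n + 1)) (pulsedL2 hv hψ ν g) - inner ℝ (f n) g| ≤
      12 * Real.exp L ^ 2 * ν * (√B * ∫ r in (n : ℝ)..(n + 1), gradNorm (D r)) := by
  set d := ∫ r in (n : ℝ)..(n + 1), gradNorm (D r) with hd
  set γ := pull hv hψ one_mem_unit zero_mem_unit g with hγ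
  have hγE : EnergyLE γ (4 * Real.exp L ^ 2 * B) := hg.pull hv hψ _ _
  have hφE := hγE.heatL2_sub_self hν
  -- transport of `γ`
  have h1 := h.abs_inner_sub_inner_pull_le hv hψ hν.le hV n zero_mem_unit hγE
  rw [hγ, pull_pull, pull_self, add_zero, ← hγ, sqrt_four_mul_exp_sq_mul, ← hd] at h1
  -- the increment of `γ` under the heat flow, paired at a time with a good gradient bound
  obtain ⟨s, hs, hw, hsd⟩ := h.exists_good_time n
  have hs' : s ∈ Icc (0 : ℝ) 1 := Ioc_subset_Icc_self hs
  have h2 := h.abs_inner_sub_inner_pull_le hv hψ hν.le hV n hs' hφE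
  rw [inner_pull_right, sqrt_four_mul_exp_sq_mul, ← hd] at h2
  have h3 := abs_inner_heatL2_sub_self_le hν (hw.energyLE.pull hv hψ one_mem_unit hs') hγE
  rw [sqrt_four_mul_exp_sq_mul, sqrt_four_mul_exp_sq_mul, Real.sqrt_sq (gradNorm_nonneg _)] at h3
  have h4 : ν * (2 * Real.exp L * gradNorm (D (n + s)) * (2 * Real.exp L * √B)) ≤
      ν * (2 * Real.exp L * d * (2 * Real.exp L * √B)) := by gcongr
  have h5 : inner ℝ (f (n + 1)) (pulsedL2 hv hψ ν g) =
      inner ℝ (f (n + 1)) γ + inner ℝ (f (n + 1)) (heatL2 ν γ - γ) := by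
    rw [← inner_add_right, add_sub_cancel, pulsedL2]
  rw [h5]
  rw [abs_le] at h1 h2 h3 ⊢
  constructor <;> linarith [h1.1, h1.2, h2.1, h2.2, h3.1, h3.2]

/-- The weights are such that the term with `B` is absorbed by the dissipation of the pulsed
diffusion. -/
theorem mul_le_weighted_sq (K : ℝ) {B : ℝ} (hB : 0 ≤ B) (d : ℝ) :
    K * (√B * d) ≤ 1 / 4 * B + K ^ 2 * d ^ 2 := by
  nlinarith [sq_nonneg (1 / 2 * √B - K * d), Real.sq_sqrt hB]

/-- Follow the pairing of the solution with the pulsed diffusion over many periods. The gradient of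
the pulsed diffusion is paid for by its own dissipation, which telescopes. -/
theorem IsEvolution.exists_energyLE_and_abs_sub_le (h : IsEvolution ν M V f D) (hν : 0 < ν)
    (hV : ∀ s j z, V s j z = periodicExt v s z j) {g : L2} {B₀ : ℝ} (hg : EnergyLE g B₀) (n : ℕ) :
    ∃ B, EnergyLE ((pulsedL2 hv hψ ν)^[n] g) B ∧
      |inner ℝ (f (n + 1)) ((pulsedL2 hv hψ ν)^[n] g) - inner ℝ (f 1) g| ≤
        1 / 4 * (ν * B₀ + (‖g‖ ^ 2 - ‖(pulsedL2 hv hψ ν)^[n] g‖ ^ 2) / 2 - ν * B) +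
          (12 * Real.exp L ^ 2) ^ 2 * (ν * ∫ r in (0 : ℝ)..(n + 1), gradNorm (D r) ^ 2) := by
  induction n with
  | zero =>
    refine ⟨B₀, hg, ?_⟩
    have h1 : 0 ≤ ∫ r in (0 : ℝ)..1, gradNorm (D r) ^ 2 :=
      intervalIntegral.integral_nonneg zero_le_one fun _ _ => sq_nonneg _
    simp only [Nat.cast_zero, zero_add, Function.iterate_zero, id, sub_self, abs_zero]
    have : 0 ≤ (12 * Real.exp L ^ 2) ^ 2 * (ν * ∫ r in (0 : ℝ)..1, gradNorm (D r) ^ 2) := by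
      positivity
    linarith
  | succ n ih =>
    obtain ⟨B, hB, ih⟩ := ih
    rw [Function.iterate_succ_apply']
    set gn := (pulsedL2 hv hψ ν)^[n] g with hgn
    have h1 := h.abs_inner_pulsedL2_sub_le hv hψ hν hV (n + 1) hB
    have h2 := h.sq_integral_le (n + 1)
    push_cast at h1 h2 ⊢
    set d := ∫ r in (n + 1 : ℝ)..(n + 1 + 1), gradNorm (D r) with hd
    have hn : (0 : ℝ) ≤ n := n.cast_nonneg
    have h3 := intervalIntegral.integral_add_adjacent_intervals
      (h.intervalIntegrable_sq le_rfl (by linarith : (0 : ℝ) ≤ n + 1))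
      (h.intervalIntegrable_sq (by linarith : (0 : ℝ) ≤ n + 1)
        (by linarith : (n + 1 : ℝ) ≤ n + 1 + 1))
    refine ⟨(‖gn‖ ^ 2 - ‖pulsedL2 hv hψ ν gn‖ ^ 2) / (2 * ν), ?_, ?_⟩
    · have := energyLE_heatL2 hν (pull hv hψ one_mem_unit zero_mem_unit gn)
      rwa [norm_pull] at this
    · have h4 : ν * ((‖gn‖ ^ 2 - ‖pulsedL2 hv hψ ν gn‖ ^ 2) / (2 * ν)) =
          (‖gn‖ ^ 2 - ‖pulsedL2 hv hψ ν gn‖ ^ 2) / 2 := by field_simp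
      rw [h4, ← h3]
      have h5 := mul_le_mul_of_nonneg_left (mul_le_weighted_sq
        (12 * Real.exp L ^ 2) hB.nonneg d) hν.le
      have h6 := mul_le_mul_of_nonneg_left (mul_le_mul_of_nonneg_left h2 hν.le)
        (sq_nonneg (12 * Real.exp L ^ 2))
      have h7 := abs_sub_le (inner ℝ (f (n + 1 + 1)) (pulsedL2 hv hψ ν gn))
        (inner ℝ (f (n + 1)) gn) (inner ℝ (f 1) g)
      linarith

/-- If the pulsed diffusion halves the norm of mean-zero functions in `n₀` steps, the solution
dissipates a fixed fraction of its norm by time `n₀ + 1`. -/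
theorem IsEvolution.norm_le_of_pulsedL2 (h : IsEvolution ν M V f D) (hν : 0 < ν)
    (hV : ∀ s j z, V s j z = periodicExt v s z j) {n₀ : ℕ}
    (hp : ∀ g : L2, ∫ z, g z ∂torusMeasure = 0 → ‖(pulsedL2 hv hψ ν)^[n₀] g‖ ≤ 1 / 2 * ‖g‖)
    (h0 : ∫ z, f 0 z ∂torusMeasure = 0) :
    ‖f (n₀ + 1)‖ ≤ (1 - 1 / (16 * (12 * Real.exp L ^ 2) ^ 2)) * ‖f 0‖ := by
  set K := 12 * Real.exp L ^ 2 with hK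
  have hK12 : 12 ≤ K := by
    have : 1 ≤ Real.exp L := Real.one_le_exp L.coe_nonneg
    nlinarith
  set δ := 1 / (16 * K ^ 2) with hδ
  have hδK : K ^ 2 * δ = 1 / 16 := by rw [hδ]; field_simp
  have hδ0 : 0 < δ := by positivity
  have hKδ : K * δ ≤ 1 / 192 := by nlinarith
  have hδ1 : δ ≤ 1 / 2304 := by nlinarith
  by_contra! hcon
  have hT : (0 : ℝ) < n₀ + 1 := by positivity
  have hN := h.norm_le_norm_zero hν.le hT.le
  set N := ‖f 0‖ with hNdef
  set R := ‖f (n₀ + 1)‖ with hR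
  have hN0 : 0 < N := by
    by_contra! hneg
    have : N = 0 := le_antisymm hneg (norm_nonneg _)
    rw [this, mul_zero] at hcon
    linarith
  have hRN : (1 - 2 * δ) * N ^ 2 ≤ R ^ 2 := by
    have h1 : ((1 - δ) * N) ^ 2 ≤ R ^ 2 :=
      pow_le_pow_left₀ (mul_nonneg (by linarith) hN0.le) hcon.le 2
    nlinarith [mul_pos hδ0 hδ0, sq_nonneg (δ * N)]
  -- the total dissipation is small, as `N ^ 2 - R ^ 2 ≤ 2 * δ * N ^ 2`
  have hE := h.energy_eq hT
  set I := ∫ r in (0 : ℝ)..(n₀ + 1), gradNorm (D r) ^ 2 with hI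
  have hIle : ν * I ≤ δ * N ^ 2 := by linarith
  -- start the pulsed diffusion from the solution at a time with a good gradient bound
  obtain ⟨s, hs, hw, hsd⟩ := h.exists_good_time 0
  have hs' : s ∈ Icc (0 : ℝ) 1 := Ioc_subset_Icc_self hs
  have hn₀ : (0 : ℝ) ≤ n₀ := n₀.cast_nonneg
  have hjen := h.sq_integral_le 0
  simp only [Nat.cast_zero, zero_add] at hw hsd hjen
  set d := ∫ r in (0 : ℝ)..1, gradNorm (D r) with hd
  have hd2 : ν * d ^ 2 ≤ δ * N ^ 2 := by
    have h1 := intervalIntegral.integral_add_adjacent_intervals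
      (h.intervalIntegrable_sq le_rfl zero_le_one)
      (h.intervalIntegrable_sq zero_le_one (by linarith : (1 : ℝ) ≤ n₀ + 1))
    have h2 : 0 ≤ ∫ r in (1 : ℝ)..(n₀ + 1), gradNorm (D r) ^ 2 :=
      intervalIntegral.integral_nonneg (by linarith) fun _ _ => sq_nonneg _
    refine le_trans (mul_le_mul_of_nonneg_left ?_ hν.le) hIle
    linarith
  set g := pull hv hψ one_mem_unit hs' (f s) with hg
  have hd0 : 0 ≤ d := (gradNorm_nonneg _).trans hsd
  have hgE : EnergyLE g (4 * Real.exp L ^ 2 * d ^ 2) :=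
    (hw.energyLE.mono (pow_le_pow_left₀ (gradNorm_nonneg _) hsd 2)).pull hv hψ _ _
  have hgN : ‖g‖ = ‖f s‖ := norm_pull hv hψ _ _ _
  have hgle : ‖g‖ ≤ N := hgN ▸ h.norm_le_norm_zero hν.le hs'.1
  have hgge : R ≤ ‖g‖ := hgN ▸ h.norm_antitone hν.le hs'.1 (by linarith [hs.2])
  have hg0 : ∫ z, g z ∂torusMeasure = 0 := by
    rw [hg, integral_pull, ← inner_one_eq_integral, h.mean_eq hs.1, inner_one_eq_integral, h0]
  have h1 := h.abs_inner_sub_inner_pull_le hv hψ hν.le hV 0 hs' hgE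
  simp only [Nat.cast_zero, zero_add] at h1
  rw [hg, pull_pull, pull_self, ← hg, real_inner_self_eq_norm_sq, ← hgN,
    sqrt_four_mul_exp_sq_mul, Real.sqrt_sq hd0, ← hd] at h1
  obtain ⟨B, hB, h2⟩ := h.exists_energyLE_and_abs_sub_le hv hψ hν hV hgE n₀
  have h3 := mul_nonneg hν.le hB.nonneg
  have h4 : |inner ℝ (f (n₀ + 1)) ((pulsedL2 hv hψ ν)^[n₀] g)| ≤ 1 / 2 * N ^ 2 := by
    refine (abs_real_inner_le_norm _ _).trans ?_
    calc _ ≤ N * (1 / 2 * N) := mul_le_mul hN ((hp g hg0).trans (by linarith)) (norm_nonneg _)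
          hN0.le
      _ = 1 / 2 * N ^ 2 := by ring
  have h5 : R ^ 2 ≤ ‖g‖ ^ 2 := pow_le_pow_left₀ (norm_nonneg _) hgge 2
  have h6 : ‖g‖ ^ 2 ≤ N ^ 2 := pow_le_pow_left₀ (norm_nonneg _) hgle 2
  have h7 := sq_nonneg ‖(pulsedL2 hv hψ ν)^[n₀] g‖
  have h8 : K ^ 2 * (ν * I) ≤ 1 / 16 * N ^ 2 := by
    have := mul_le_mul_of_nonneg_left hIle (sq_nonneg K)
    rw [← hδK]; linarith
  have h9 : K * (ν * d ^ 2) ≤ 1 / 192 * N ^ 2 := by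
    have := mul_le_mul_of_nonneg_left hd2 (by linarith : 0 ≤ K)
    nlinarith [sq_nonneg N]
  have h10 : δ * N ^ 2 ≤ 1 / 2304 * N ^ 2 := mul_le_mul_of_nonneg_right hδ1 (sq_nonneg N)
  have h11 : ν * (2 * Real.exp L * (2 * Real.exp L * d)) * d = 1 / 3 * (K * (ν * d ^ 2)) := by
    rw [hK]; ring
  have h12 : ν * (4 * Real.exp L ^ 2 * d ^ 2) = 1 / 3 * (K * (ν * d ^ 2)) := by
    rw [hK]; ring
  rw [h11] at h1
  rw [h12] at h2
  -- `⟨f (n₀ + 1), gₙ₀⟩` is at least `(7/8) ‖g₀‖²` up to small multiples of `N ^ 2`, but at most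
  -- `N ^ 2 / 2`
  have h13 := (abs_le.1 h1).1
  have h14 := (abs_le.1 h2).1
  have h15 := (abs_le.1 h4).2
  have h16 : 0 < N ^ 2 := by positivity
  linarith

end

end PulsedDiffusion
end

theorem lemma2p5 :
    ∀ L : NNReal, ∃ δ : ℝ, 0 < δ ∧ δ < 1 ∧
      ∀ (v : ℝ → PulsedDiffusion.Torus2 → PulsedDiffusion.Plane)
        (_hv : PulsedDiffusion.IsVelocityField L v)
        (ψ : ℝ → PulsedDiffusion.Torus2 → PulsedDiffusion.Torus2)
        (_hψ : PulsedDiffusion.IsFlowMap v ψ)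
        (ν : ℝ) (_hν : 0 < ν) (n₀ : ℕ)
        (_hpulsed : ∀ g : PulsedDiffusion.Torus2 → ℝ,
          MeasureTheory.MemLp g 2 PulsedDiffusion.torusMeasure →
          ∫ z, g z ∂PulsedDiffusion.torusMeasure = 0 →
          MeasureTheory.eLpNorm ((PulsedDiffusion.pulsed ν ψ)^[n₀] g) 2
              PulsedDiffusion.torusMeasure ≤
            (1 / 2) * MeasureTheory.eLpNorm g 2 PulsedDiffusion.torusMeasure)
        (f₀ : MeasureTheory.Lp ℝ 2 PulsedDiffusion.torusMeasure)
        (_hf₀ : ∫ z, f₀ z ∂PulsedDiffusion.torusMeasure = 0)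
        (f : ℝ → MeasureTheory.Lp ℝ 2 PulsedDiffusion.torusMeasure)
        (_hf : PulsedDiffusion.IsSolution ν (PulsedDiffusion.periodicExt v) f₀ f),
        ‖f ((n₀ : ℝ) + 1)‖ ≤ (1 - δ) * ‖f₀‖ := by
  intro L
  have hexp : 1 ≤ Real.exp L := Real.one_le_exp L.coe_nonneg
  refine ⟨1 / (16 * (12 * Real.exp L ^ 2) ^ 2), by positivity, ?_, ?_⟩
  · rw [div_lt_one (by positivity)]
    nlinarith [one_le_pow₀ hexp (n := 4)]
  · intro v hv ψ hψ ν hν n₀ hp f₀ hf₀ f hf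
    obtain ⟨M, V, D, h, hV⟩ := PulsedDiffusion.IsSolution.exists_isEvolution hv hf
    have h0 : f 0 = f₀ := hf.2.1
    subst h0
    exact h.norm_le_of_pulsedL2 hv hψ hν hV
      (fun g hg => PulsedDiffusion.norm_pulsedL2_iterate_le hv hψ hν hp hg) hf₀
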